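/- **Theorem 2.6.** Fix $k\ge 0$. There is a polynomial-time algorithm (its running time is bounded by a polynomial in the number of symbols needed to write down the input, integers being written in binary) that does the following. *Input:* integers $d,n\ge 0$; a rational function of $\mathbf x=(x_1,\dots,x_d)$, given by a formula $$f(\mathbf x)=\sum_{i\in I}\alpha_i\,\frac{\mathbf x^{p_i}}{(1-\mathbf x^{a_{i1}})\cdots(1-\mathbf x^{a_{ik}})},$$ where $I$ is a finite set, $\alpha_i\in\mathbb Q$, $p_i,a_{ij}\in\mathbb Z^d$ and $a_{ij}\neq 0$ for all $i,j$; and vectors $l_1,\dots,l_d\in\mathbb Z^n$, defining the monomial map $\phi:\mathbb C^n\to\mathbb C^d$, $\phi(\mathbf z)=(\mathbf z^{l_1},\dots,\mathbf z^{l_d})$ (defined at those $\mathbf z$ for which no zero coordinate is raised to a negative power; $0^0=1$). It is assumed that the image of $\phi$ does not lie entirely in the set of poles of $f$, that is, $f$ is regular at some point of the image. The numbers $d,n$, the set $I$, the $\alpha_i$, the vectors $p_i,a_{ij}$ and the $l_i$ all vary with the input (the numbers of variables $d$ and $n$ are counted in unary in the input size). *Output:* the function $g(\mathbf z)=f(\phi(\mathbf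 z))$, as a formula $$g(\mathbf z)=\sum_{i\in I'}\beta_i\,\frac{\mathbf z^{q_i}}{(1-\mathbf z^{b_{i1}})\cdots(1-\mathbf z^{b_{is}})},$$ where $I'$ is finite, $s\le k$, $\beta_i\in\mathbb Q$, $q_i,b_{ij}\in\mathbb Z^n$ and $b_{ij}\ne 0$ for all $i,j$. That is, the rational function given by this formula is regular with value $f(\phi(\mathbf z))$ at every $\mathbf z$ for which $\phi(\mathbf z)$ is defined and is not a pole of $f$. In particular, if $(1,\dots,1)$ is not a pole of $f$, the case $n=0$ computes the value $f(1,\dots,1)$, as $\sum_{i\in I'}\beta_i$. -/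

import Mathlib

noncomputable section

namespace ShortRational

/-! ### Rational functions on `ℂⁿ`, their poles and their values -/

/-- The field `ℂ(x₁, …, xₙ)` of rational functions in `n` variables. -/
abbrev RatFun (n : ℕ) : Type := FractionRing (MvPolynomial (Fin n) ℂ)

/-- The rational function `f` is regular at the point `x`, with value `f(x) = y`: it can be written
as a quotient `P / Q` of polynomials with `Q(x) ≠ 0`, and `y = P(x) / Q(x)`. -/
def HasValueAt {n : ℕ} (f : RatFun n) (x : Fin n → ℂ) (y : ℂ) : Prop :=
  ∃ P Q : MvPolynomial (Fin n) ℂ, MvPolynomial.eval x Q ≠ 0 ∧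
    f = algebraMap _ (RatFun n) P / algebraMap _ (RatFun n) Q ∧
    y = MvPolynomial.eval x P / MvPolynomial.eval x Q

/-- The set of poles of `f`: the points at which `f` is not regular. -/
def poles {n : ℕ} (f : RatFun n) : Set (Fin n → ℂ) :=
  {x | ¬ ∃ y, HasValueAt f x y}

/-- The Laurent monomial `x^m = x₁^{m₁} ⋯ xₙ^{mₙ}`, as a rational function. -/
def monomial {n : ℕ} (m : Fin n → ℤ) : RatFun n :=
  ∏ i, (algebraMap _ (RatFun n) (MvPolynomial.X i : MvPolynomial (Fin n) ℂ)) ^ m i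

/-! ### Short rational functions -/

/-- The data of a fraction `α x^p / ((1 - x^{a₁}) ⋯ (1 - x^{aₖ}))` in `d` variables, with
`α ∈ ℚ`, `p, aⱼ ∈ ℤᵈ` and `aⱼ ≠ 0`. -/
structure Fraction (d k : ℕ) where
  /-- the coefficient `α` -/
  coeff : ℚ
  /-- the exponent vector `p` of the numerator -/
  num : Fin d → ℤ
  /-- the exponent vectors `a₁, …, aₖ` of the binomials in the denominator -/
  den : Fin k → Fin d → ℤ
  den_ne_zero : ∀ j, den j ≠ 0

/-- The rational function given by the data of a fraction. -/
def Fraction.toRatFun {d k : ℕ} (t : Fraction d k) : RatFun d :=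
  (t.coeff : RatFun d) * monomial t.num / ∏ j, (1 - monomial (t.den j))

/-- A formula `∑_{i ∈ I} αᵢ x^{pᵢ} / ((1 - x^{aᵢ₁}) ⋯ (1 - x^{aᵢₖ}))` in `d` variables, with a
finite set `I` of indices: the list of its fractions. -/
abbrev Formula (d k : ℕ) : Type := List (Fraction d k)

/-- The rational function given by a formula. -/
def Formula.toRatFun {d k : ℕ} (f : Formula d k) : RatFun d :=
  (f.map Fraction.toRatFun).sum

/-! ### Monomial maps -/

/-- The monomial map given by `l₁, …, l_d ∈ ℤⁿ` is defined at `z ∈ ℂⁿ` if no coordinate of `z` that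
is raised to a negative power vanishes. -/
def DefinedAt {d n : ℕ} (l : Fin d → Fin n → ℤ) (z : Fin n → ℂ) : Prop :=
  ∀ i j, l i j < 0 → z j ≠ 0

/-- The monomial map `z ↦ (z^{l₁}, …, z^{l_d})` from `ℂⁿ` to `ℂᵈ` (with `0⁰ = 1`; meaningful where
it is defined in the sense of `DefinedAt`). -/
def monomialMap {d n : ℕ} (l : Fin d → Fin n → ℤ) (z : Fin n → ℂ) : Fin d → ℂ :=
  fun i => ∏ j, z j ^ l i j

/-- The image of a monomial map. -/
def monomialImage {d n : ℕ} (l : Fin d → Fin n → ℤ) : Set (Fin d → ℂ) :=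
  monomialMap l '' {z | DefinedAt l z}

/-! ### Instances of the substitution problem -/

/-- A formula in `d` variables with `k` binomials in each fraction, and a monomial map
from `ℂⁿ` to `ℂᵈ`; the numbers `d` and `n` are part of the instance. -/
structure Instance (k : ℕ) where
  /-- the number of variables of the formula -/
  d : ℕ
  /-- the number of variables after the substitution -/
  n : ℕ
  /-- the formula -/
  f : Formula d k
  /-- the exponent vectors of the monomial map -/
  l : Fin d → Fin n → ℤ

/-- The image of the monomial map does not lie entirely in the set of poles of `f`. -/
def Instance.Admissible {k : ℕ} (I : Instance k) : Prop :=
  ¬ monomialImage I.l ⊆ poles I.f.toRatFun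

/-! ### Writing formulas and monomial maps down

Words over the finite alphabet `Computability.Γ'` (two bits, two brackets, a comma and a blank).
Integers are written in binary. The numbers of variables `d` and `n` head an instance in unary;
as soon as `d ≠ 0` this at most doubles the length, since the `d × n` exponents of the monomial map
are written out as well. -/

open Computability (Γ')

/-- An integer: a sign bit, the binary digits of the absolute value (least significant first), and
a comma. -/
def encodeInt (a : ℤ) : List Γ' :=
  Γ'.bit (decide (a < 0)) :: ((Computability.encodeNat a.natAbs).map Γ'.bit ++ [Γ'.comma])

/-- A rational number: its numerator and its denominator in lowest terms. -/
def encodeRat (q : ℚ) : List Γ' :=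
  encodeInt q.num ++ encodeInt (q.den : ℤ)

/-- An integer vector: its coordinates, in brackets. -/
def encodeVec {d : ℕ} (v : Fin d → ℤ) : List Γ' :=
  Γ'.bra :: ((List.ofFn v).flatMap encodeInt ++ [Γ'.ket])

/-- A sequence of integer vectors, in brackets. -/
def encodeVecs {m d : ℕ} (v : Fin m → Fin d → ℤ) : List Γ' :=
  Γ'.bra :: ((List.ofFn v).flatMap encodeVec ++ [Γ'.ket])

/-- A fraction: the coefficient, the exponent vector of the numerator and those of the
denominator, in brackets. -/
def Fraction.encode {d k : ℕ} (t : Fraction d k) : List Γ' :=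
  Γ'.bra :: (encodeRat t.coeff ++ encodeVec t.num ++ encodeVecs t.den ++ [Γ'.ket])

/-- A formula: its fractions, in brackets. -/
def Formula.encode {d k : ℕ} (f : Formula d k) : List Γ' :=
  Γ'.bra :: (f.flatMap Fraction.encode ++ [Γ'.ket])

/-- A natural number in unary, followed by a comma. -/
def encodeUnary (m : ℕ) : List Γ' :=
  List.replicate m (Γ'.bit true) ++ [Γ'.comma]

/-- An instance: the numbers of variables, the formula and the monomial map. -/
def Instance.encode {k : ℕ} (I : Instance k) : List Γ' :=
  encodeUnary I.d ++ encodeUnary I.n ++ Formula.encode I.f ++ encodeVecs I.l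

end ShortRational

end

/-!
# Monomial substitution into short rational functions in polynomial time

Substituting `x_i = z^{l_i}` into the fractions of `f` one by one may fail, because factors
`1 - x^a` of the denominators may become `0` even though the sum of the fractions is regular.
Therefore one substitutes `x_i = z^{l_i} e^{w_i τ}` with a vector `w ∈ ℤᵈ` such that `⟨w, a⟩ ≠ 0`
for all vectors `a` in the denominators. Each factor becomes `1 - z^b e^{cτ} ≠ 0` with
`c = ⟨w, a⟩`, and the fractions become Laurent series in `τ` over `ℂ(z)` with a pole of order at
most `k`. Their sum has no pole, and its constant term is `f(z^l)`: if `f = P / Q` with `Q` not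
vanishing at a point of the image, then `P(z^l e^{wτ}) / Q(z^l e^{wτ})` is a power series in `τ`.
Hence `g` is the sum of the coefficients of `τ^k` of the power series `τ^k t(z^l e^{wτ})`, where
`t` runs over the fractions of `f` (`hasValueAt_sum_coeff`).

These coefficients are short rational functions in `z`. If `b = 0`, then `τ / (1 - e^{cτ})` has
rational coefficients, which come from the Bernoulli numbers. Otherwise the coefficients of
`τ / (1 - z^b e^{cτ})` are found from the geometric series
`∑ z^{jb} (e^{cτ} - 1)^j (1 - z^b)^{-(j + 1)}`; in degree `m` the denominators have at most `m`
factors. As `k` is fixed, only finitely many universal constants are needed (`expTable`,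
`poleTable`, `geomTable`), the product of the expansions has boundedly many terms for each
fraction, and the terms of degree `k` have at most `k` factors in the denominator
(`fractionTerms_spec`, `topTerms_spec`). The vector `w = (1, B, B², …)` does, where `B` exceeds
all the numbers in the denominators: then `⟨w, a⟩` is the number with the digits `a` in base `B`
(`eq_zero_of_horner_eq_zero`).

Two normalizations remain. A formula has the same number of factors in all denominators, so
fractions with fewer factors are multiplied by `(1 - z^e) / (1 - z^e)` (`padOnce_spec`); without
variables there are no factors at all. Coefficients are written in lowest terms, and instead of
computing greatest common divisors one splits `N / D` into the fractions `2^i / D` for the binary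
digits `1` of `N`, each of which is reduced by halving as long as possible (`dyadic_foldl`).

For the running time, structured programs over four stacks are compiled to Turing machines
(`Prog.computableInPolyTime`). They compute on binary trees in Polish notation, and `PolyFun f`
says that `f` is computed by such a program in polynomial time. This class is closed under
composition and case distinction, and under folds along lists if the intermediate results are of
polynomial size (`PolyFun.foldl_of_size`). All of the arithmetic of binary integers, the parser,
the printer and the substitution are put together from folds; for most of them a measure of the
size of the result grows by a summand in each step, which bounds it polynomially
(`PolyFun.foldl`).
-/

noncomputable section

namespace ShortRational

open Computability (Γ')

open Turing (TM2.Stmt TM2.Cfg TM2.step)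

/-! ### Structured programs over stacks and their compilation to `TM2` machines -/

/-- The four stacks of a program. -/
inductive Reg
  | main | left | right | count
  deriving DecidableEq

instance : Fintype Reg :=
  ⟨{.main, .left, .right, .count}, fun k => by cases k <;> simp⟩

/-- The memory of a program: one symbol variable and four stacks. -/
structure Mem where
  /-- the symbol read last, `none` after reading from an empty stack -/
  var : Option Γ'
  /-- the stack of values -/
  main : List Γ'
  /-- an auxiliary stack; it holds the input word at the start -/
  left : List Γ'
  /-- an auxiliary stack; it holds the output word at the end -/
  right : List Γ'
  /-- a stack that serves as a unary counter -/
  count : List Γ'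

/-- The contents of a stack. -/
def Mem.get (m : Mem) : Reg → List Γ'
  | .main => m.main
  | .left => m.left
  | .right => m.right
  | .count => m.count

/-- Replace the contents of a stack. -/
def Mem.set (m : Mem) : Reg → List Γ' → Mem
  | .main, l => { m with main := l }
  | .left, l => { m with left := l }
  | .right, l => { m with right := l }
  | .count, l => { m with count := l }

theorem Mem.get_set (m : Mem) (k : Reg) (l : List Γ') :
    (m.set k l).get = Function.update m.get k l := by
  funext j
  cases k <;> cases j <;> rfl

theorem Mem.set_var (m : Mem) (k : Reg) (l : List Γ') : (m.set k l).var = m.var := by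
  cases k <;> rfl

/-- Structured programs over the four stacks; all conditions test the symbol variable. -/
inductive Prog
  | push (k : Reg) (f : Option Γ' → Γ')
  | pop (k : Reg)
  | seq (p q : Prog)
  | ite (c : Option Γ' → Bool) (p q : Prog)
  | loop (c : Option Γ' → Bool) (p : Prog)

/-- Big-step semantics: `Exec p m m' t` says that `p` leads from the memory `m` to the memory `m'`
in `t` steps. -/
inductive Exec : Prog → Mem → Mem → ℕ → Prop
  | push (k f m) : Exec (.push k f) m (m.set k (f m.var :: m.get k)) 1
  | pop (k m) : Exec (.pop k) m { m.set k (m.get k).tail with var := (m.get k).head? } 1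
  | seq {p q m₁ m₂ m₃ s t} : Exec p m₁ m₂ s → Exec q m₂ m₃ t → Exec (.seq p q) m₁ m₃ (s + t)
  | iteTrue {c p q m₁ m₂ t} : c m₁.var = true → Exec p m₁ m₂ t → Exec (.ite c p q) m₁ m₂ (t + 1)
  | iteFalse {c p q m₁ m₂ t} : c m₁.var = false → Exec q m₁ m₂ t →
      Exec (.ite c p q) m₁ m₂ (t + 1)
  | loopFalse {c p m} : c m.var = false → Exec (.loop c p) m m 1
  | loopTrue {c p m₁ m₂ m₃ s t} : c m₁.var = true → Exec p m₁ m₂ s → Exec (.loop c p) m₂ m₃ t →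
      Exec (.loop c p) m₁ m₃ (s + t + 1)

/-- The labels of the machine that runs a program. -/
def Prog.Label : Prog → Type
  | .push _ _ => Unit
  | .pop _ => Unit
  | .seq p q => p.Label ⊕ q.Label
  | .ite _ p q => Option (p.Label ⊕ q.Label)
  | .loop _ p => Option p.Label

theorem Prog.finite_label : ∀ p : Prog, Finite p.Label
  | .push _ _ => inferInstanceAs (Finite Unit)
  | .pop _ => inferInstanceAs (Finite Unit)
  | .seq p q =>
    have := p.finite_label
    have := q.finite_label
    inferInstanceAs (Finite (p.Label ⊕ q.Label))
  | .ite _ p q =>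
    have := p.finite_label
    have := q.finite_label
    inferInstanceAs (Finite (Option (p.Label ⊕ q.Label)))
  | .loop _ p =>
    have := p.finite_label
    inferInstanceAs (Finite (Option p.Label))

/-- The label at which the execution of a program starts. -/
def Prog.entry : (p : Prog) → p.Label
  | .push _ _ => ()
  | .pop _ => ()
  | .seq p _ => Sum.inl p.entry
  | .ite _ _ _ => none
  | .loop _ _ => none

/-- The statements of the machine that runs a program as part of a larger machine: the labels of
the program are embedded into those of the large machine by `e`, and control passes to the label
`x` at the end. -/
def Prog.code {Λ : Type} : (p : Prog) → (p.Label → Λ) → Λ → p.Label →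
    TM2.Stmt (fun _ : Reg => Γ') Λ (Option Γ')
  | .push k f, _, x, _ => .push k f (.goto fun _ => x)
  | .pop k, _, x, _ => .pop k (fun _ h => h) (.goto fun _ => x)
  | .seq p q, e, _, .inl l => p.code (fun l => e (.inl l)) (e (.inr q.entry)) l
  | .seq _ q, e, x, .inr l => q.code (fun l => e (.inr l)) x l
  | .ite c p q, e, _, none =>
    .branch c (.goto fun _ => e (some (.inl p.entry))) (.goto fun _ => e (some (.inr q.entry)))
  | .ite _ p _, e, x, some (.inl l) => p.code (fun l => e (some (.inl l))) x l
  | .ite _ _ q, e, x, some (.inr l) => q.code (fun l => e (some (.inr l))) x l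
  | .loop c p, e, x, none => .branch c (.goto fun _ => e (some p.entry)) (.goto fun _ => x)
  | .loop _ p, e, _, some l => p.code (fun l => e (some l)) (e none) l

/-- A machine that contains the code of a program simulates it step by step. -/
theorem Exec.iterate_step {p : Prog} {m m' : Mem} {t : ℕ} (h : Exec p m m' t) :
    ∀ {Λ : Type} (M : Λ → TM2.Stmt (fun _ : Reg => Γ') Λ (Option Γ')) (e : p.Label → Λ) (x : Λ),
      (∀ l, M (e l) = p.code e x l) →
      (flip bind (TM2.step M))^[t] (some ⟨some (e p.entry), m.var, m.get⟩) =
        some ⟨some x, m'.var, m'.get⟩ := by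
  induction h with
  | push k f m =>
    intro Λ M e x hM
    have h : M (e (Prog.push k f).entry) = _ := hM ()
    simp [flip, h, Prog.code, Mem.get_set, Mem.set_var]
  | pop k m =>
    intro Λ M e x hM
    have h : M (e (Prog.pop k).entry) = _ := hM ()
    simp only [Function.iterate_one, flip, Option.bind_eq_bind, Option.bind_some, TM2.step, h,
      Prog.code, Turing.TM2.stepAux]
    rw [← Mem.get_set]
    cases k <;> rfl
  | @seq p q m₁ m₂ m₃ s t hp hq ihp ihq =>
    intro Λ M e x hM
    rw [Nat.add_comm, Function.iterate_add_apply]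
    exact (congrArg _ (ihp M _ _ fun l => hM (.inl l))).trans (ihq M _ _ fun l => hM (.inr l))
  | @iteTrue c p q m₁ m₂ t hc hp ihp =>
    intro Λ M e x hM
    rw [Function.iterate_add_apply]
    have h : M (e (Prog.ite c p q).entry) = _ := hM none
    have := ihp M _ _ fun l => hM (some (.inl l))
    simpa [flip, h, Prog.code, hc] using this
  | @iteFalse c p q m₁ m₂ t hc hp ihp =>
    intro Λ M e x hM
    rw [Function.iterate_add_apply]
    have h : M (e (Prog.ite c p q).entry) = _ := hM none
    have := ihp M _ _ fun l => hM (some (.inr l))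
    simpa [flip, h, Prog.code, hc] using this
  | @loopFalse c p m hc =>
    intro Λ M e x hM
    have h : M (e (Prog.loop c p).entry) = _ := hM none
    simp [flip, h, Prog.code, hc]
  | @loopTrue c p m₁ m₂ m₃ s t hc hp hq ihp ihq =>
    intro Λ M e x hM
    have h : M (e (Prog.loop c p).entry) = _ := hM none
    have h1 := ihp M _ _ fun l => hM (some l)
    have h2 := ihq M _ _ hM
    rw [Function.iterate_add_apply, Nat.add_comm, Function.iterate_add_apply]
    simp only [Function.iterate_one]
    have h0 : flip bind (TM2.step M) (some ⟨some (e (Prog.loop c p).entry), m₁.var, m₁.get⟩) =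
        some ⟨some (e (some p.entry)), m₁.var, m₁.get⟩ := by
      simp [flip, h, Prog.code, hc]
    exact ((congrArg _ (congrArg _ h0)).trans (congrArg _ h1)).trans h2

/-- The machine of a program: the input is on the stack `left`, the output on the stack `right`. -/
def Prog.toFinTM2 (p : Prog) : Turing.FinTM2 :=
  haveI := p.finite_label
  { K := Reg
    k₀ := .left
    k₁ := .right
    Γ := fun _ => Γ'
    Λ := Option p.Label
    main := some p.entry
    ΛFin := Fintype.ofFinite _
    σ := Option Γ'
    initialState := none
    m := fun l => match l with
      | none => .load (fun _ => none) .halt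
      | some l => p.code some none l }

theorem Prog.outputs {p : Prog} {u w : List Γ'} {v : Option Γ'} {t : ℕ}
    (h : Exec p ⟨none, [], u, [], []⟩ ⟨v, [], [], w, []⟩ t) :
    Nonempty (Turing.TM2OutputsInTime p.toFinTM2 u (some w) (t + 1)) := by
  refine ⟨⟨⟨t + 1, ?_⟩, le_rfl⟩⟩
  have h1 := h.iterate_step p.toFinTM2.m some none fun l => rfl
  have h2 : (Turing.initList p.toFinTM2 u) =
      (⟨some (some p.entry), none, Mem.get ⟨none, [], u, [], []⟩⟩ :
        TM2.Cfg (fun _ : Reg => Γ') (Option p.Label) (Option Γ')) := by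
    unfold Turing.initList
    congr 1
    funext k
    cases k <;> rfl
  have h3 : (Turing.haltList p.toFinTM2 w) =
      (⟨none, none, Mem.get ⟨v, [], [], w, []⟩⟩ :
        TM2.Cfg (fun _ : Reg => Γ') (Option p.Label) (Option Γ')) := by
    unfold Turing.haltList
    congr 1
    funext k
    cases k <;> rfl
  rw [Nat.add_comm, Function.iterate_add_apply]
  rw [h2]
  refine (congrArg _ h1).trans (Eq.trans ?_ (congrArg some h3.symm))
  rfl

/-- A program runs in polynomial time, so its machine does. -/
theorem Prog.computableInPolyTime {α β : Type} {ea : α → List Γ'} {eb : β → List Γ'} {f : α → β}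
    (p : Prog) (q : Polynomial ℕ)
    (h : ∀ a, ∃ v t, t ≤ q.eval (ea a).length ∧
      Exec p ⟨none, [], ea a, [], []⟩ ⟨v, [], [], eb (f a), []⟩ t) :
    Nonempty (Turing.TM2ComputableInPolyTime ea eb f) := by
  choose v t ht h using h
  refine ⟨⟨⟨p.toFinTM2, Equiv.refl _, Equiv.refl _⟩, q + 1, fun a => ?_⟩⟩
  have o : ∀ u w : List Γ', u = ea a → w = eb (f a) →
      Nonempty (Turing.TM2OutputsInTime p.toFinTM2 u (some w) (t a + 1)) := by
    rintro _ _ rfl rfl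
    exact Prog.outputs (h a)
  have o := (o _ _ (List.map_id _) (List.map_id _)).some
  refine ⟨⟨o.steps, o.evals_in_steps⟩, o.steps_le_m.trans ?_⟩
  simpa using ht a

/-- A program adds at most one symbol per step to its stacks. -/
theorem Exec.length_le {p : Prog} {m m' : Mem} {t : ℕ} (h : Exec p m m' t) :
    m'.main.length + m'.left.length + m'.right.length + m'.count.length ≤
      m.main.length + m.left.length + m.right.length + m.count.length + t := by
  induction h with
  | push k f m => cases k <;> simp [Mem.get, Mem.set] <;> omega
  | pop k m => cases k <;> simp [Mem.get, Mem.set] <;> omega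
  | seq _ _ _ _ => omega
  | iteTrue _ _ _ => omega
  | iteFalse _ _ _ => omega
  | loopFalse _ => omega
  | loopTrue _ _ _ _ _ => omega

/-! ### Binary trees on the main stack -/

/-- Binary trees, the values on which programs compute. -/
inductive BinTree
  | nil
  | cons (a b : BinTree)

/-- The number of nodes of a tree. -/
def BinTree.size : BinTree → ℕ
  | nil => 1
  | cons a b => a.size + b.size + 1

/-- A tree in Polish notation. This is a prefix code, so that a stack can hold a sequence of
trees. -/
def BinTree.word : BinTree → List Γ'
  | nil => [.bit false]
  | cons a b => .bit true :: (a.word ++ b.word)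

theorem BinTree.length_word (x : BinTree) : x.word.length = x.size := by
  induction x with
  | nil => rfl
  | cons a b iha ihb => simp [word, size, iha, ihb]

theorem BinTree.size_pos (x : BinTree) : 0 < x.size := by
  cases x <;> simp [size]

theorem BinTree.comma_notMem_word (x : BinTree) : Γ'.comma ∉ x.word := by
  induction x with
  | nil => simp [word]
  | cons a b iha ihb => simp [word, iha, ihb]

/-- Move the topmost tree of the main stack, performing `w` on each of its symbols. The counter
holds the number of subtrees that are still to be read, less one. -/
def moveLoop (w : Prog) : Prog :=
  .loop Option.isSome (.seq (.pop .main) (.seq w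
    (.ite (fun v => v = some (.bit true)) (.push .count fun _ => .blank) (.pop .count))))

theorem Exec.cast {p : Prog} {m m' : Mem} {s t : ℕ} (h : Exec p m m' s) (e : s = t) :
    Exec p m m' t :=
  e ▸ h

theorem exec_moveLoop {w : Prog} {L R : List Γ' → Γ' → List Γ'} {τ : ℕ}
    (hw : ∀ s m a b c, Exec w ⟨some s, m, a, b, c⟩ ⟨some s, m, L a s, R b s, c⟩ τ) (x : BinTree) :
    ∀ {s r a b c m T},
      Exec (moveLoop w) ⟨c.head?, r, x.word.foldl L a, x.word.foldl R b, c.tail⟩ m T →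
      Exec (moveLoop w) ⟨some s, x.word ++ r, a, b, c⟩ m (T + (τ + 4) * x.size) := by
  induction x with
  | nil =>
    intro s r a b c m T h
    refine Exec.cast (Exec.loopTrue rfl (Exec.seq (Exec.pop .main _) (Exec.seq (hw _ _ _ _ _)
        (Exec.iteFalse rfl (Exec.pop .count _)))) h) ?_
    simp only [BinTree.size]
    ring
  | cons x y ihx ihy =>
    intro s r a b c m T h
    rw [BinTree.word] at h
    simp only [List.foldl_cons, List.foldl_append] at h
    have h1 := ihx (s := .bit true) (c := .blank :: c) (ihy (s := .blank) h)
    rw [← List.append_assoc] at h1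
    refine Exec.cast (Exec.loopTrue rfl (Exec.seq (Exec.pop .main _) (Exec.seq (hw _ _ _ _ _)
        (Exec.iteTrue rfl (Exec.push .count _ _)))) h1) ?_
    simp only [BinTree.size]
    ring

/-- Move the topmost tree of the main stack, performing `w` on each of its symbols. -/
def move (w : Prog) : Prog :=
  .seq (.push .count fun _ => .blank) (.seq (.pop .count) (moveLoop w))

theorem exec_move {w : Prog} {L R : List Γ' → Γ' → List Γ'} {τ : ℕ}
    (hw : ∀ s m a b c, Exec w ⟨some s, m, a, b, c⟩ ⟨some s, m, L a s, R b s, c⟩ τ) (x : BinTree)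
    (v : Option Γ') (r a b : List Γ') :
    Exec (move w) ⟨v, x.word ++ r, a, b, []⟩ ⟨none, r, x.word.foldl L a, x.word.foldl R b, []⟩
      ((τ + 4) * x.size + 3) := by
  refine Exec.cast (Exec.seq (Exec.push .count _ _) (Exec.seq (Exec.pop .count _)
    (exec_moveLoop hw x (s := .blank) (c := []) (Exec.loopFalse rfl)))) ?_
  ring

/-- Push the symbol variable. -/
def pushVar (k : Reg) : Prog :=
  .push k fun v => v.getD .blank

theorem foldl_flip_cons (u a : List Γ') : u.foldl (fun a s => s :: a) a = u.reverse ++ a := by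
  induction u generalizing a with
  | nil => rfl
  | cons s u ih => simp [ih]

theorem foldl_const (u a : List Γ') : u.foldl (fun a _ => a) a = a := by
  simp

/-- Remove the topmost tree of the main stack. -/
def drop : Prog :=
  move (.seq (pushVar .left) (.pop .left))

/-- Move the topmost tree of the main stack to the stack `left`, on top of a comma. -/
def stashLeft : Prog :=
  .seq (.push .left fun _ => .comma) (move (pushVar .left))

/-- Move the topmost tree of the main stack to the stack `right`, on top of a comma. -/
def stashRight : Prog :=
  .seq (.push .right fun _ => .comma) (move (pushVar .right))

/-- Move the topmost tree of the main stack to both auxiliary stacks. -/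
def stashBoth : Prog :=
  .seq (.push .left fun _ => .comma) (.seq (.push .right fun _ => .comma)
    (move (.seq (pushVar .left) (pushVar .right))))

/-- Move a stashed tree from the stack `left` back to the main stack. -/
def unstashLeft : Prog :=
  .seq (.pop .left) (.loop (fun v => v ≠ some .comma) (.seq (pushVar .main) (.pop .left)))

/-- Move a stashed tree from the stack `right` back to the main stack. -/
def unstashRight : Prog :=
  .seq (.pop .right) (.loop (fun v => v ≠ some .comma) (.seq (pushVar .main) (.pop .right)))

theorem exec_drop (x : BinTree) (v : Option Γ') (r a b : List Γ') :
    Exec drop ⟨v, x.word ++ r, a, b, []⟩ ⟨none, r, a, b, []⟩ (6 * x.size + 3) := by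
  have := exec_move (w := .seq (pushVar .left) (.pop .left)) (L := fun a _ => a)
    (R := fun a _ => a) (fun s m a b c => Exec.seq (Exec.push .left _ _) (Exec.pop .left _))
    x v r a b
  rwa [foldl_const, foldl_const] at this

theorem exec_stashLeft (x : BinTree) (v : Option Γ') (r a b : List Γ') :
    Exec stashLeft ⟨v, x.word ++ r, a, b, []⟩ ⟨none, r, x.word.reverse ++ .comma :: a, b, []⟩
      (5 * x.size + 4) := by
  have := exec_move (w := pushVar .left) (L := fun a s => s :: a)
    (R := fun a _ => a) (fun s m a b c => Exec.push .left _ _) x v r (.comma :: a) b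
  rw [foldl_const, foldl_flip_cons] at this
  exact Exec.cast (Exec.seq (Exec.push .left _ _) this) (by ring)

theorem exec_stashRight (x : BinTree) (v : Option Γ') (r a b : List Γ') :
    Exec stashRight ⟨v, x.word ++ r, a, b, []⟩ ⟨none, r, a, x.word.reverse ++ .comma :: b, []⟩
      (5 * x.size + 4) := by
  have := exec_move (w := pushVar .right) (L := fun a _ => a)
    (R := fun a s => s :: a) (fun s m a b c => Exec.push .right _ _) x v r a (.comma :: b)
  rw [foldl_const, foldl_flip_cons] at this
  exact Exec.cast (Exec.seq (Exec.push .right _ _) this) (by ring)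

theorem exec_stashBoth (x : BinTree) (v : Option Γ') (r a b : List Γ') :
    Exec stashBoth ⟨v, x.word ++ r, a, b, []⟩
      ⟨none, r, x.word.reverse ++ .comma :: a, x.word.reverse ++ .comma :: b, []⟩
      (6 * x.size + 5) := by
  have := exec_move (w := .seq (pushVar .left) (pushVar .right)) (L := fun a s => s :: a)
    (R := fun a s => s :: a)
    (fun s m a b c => Exec.seq (Exec.push .left _ _) (Exec.push .right _ _)) x v r
    (.comma :: a) (.comma :: b)
  rw [foldl_flip_cons, foldl_flip_cons] at this
  exact Exec.cast (Exec.seq (Exec.push .left _ _) (Exec.seq (Exec.push .right _ _) this)) (by ring)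

theorem exec_unstashLeft (x : BinTree) (v : Option Γ') (r a b : List Γ') :
    Exec unstashLeft ⟨v, r, x.word.reverse ++ .comma :: a, b, []⟩
      ⟨some .comma, x.word ++ r, a, b, []⟩ (3 * x.size + 2) := by
  have key : ∀ (u : List Γ') (r : List Γ'), .comma ∉ u →
      Exec (.loop (fun v => v ≠ some .comma) (.seq (pushVar .main) (.pop .left)))
        ⟨(u ++ .comma :: a).head?, r, (u ++ .comma :: a).tail, b, []⟩
        ⟨some .comma, u.reverse ++ r, a, b, []⟩ (3 * u.length + 1) := by
    intro u
    induction u with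
    | nil => exact fun r _ => Exec.loopFalse (by simp)
    | cons s u ih =>
      intro r hu
      simp only [List.mem_cons, not_or] at hu
      rw [List.reverse_cons, List.append_assoc]
      exact Exec.cast (Exec.loopTrue (by simp [Ne.symm hu.1])
        (Exec.seq (Exec.push .main _ _) (Exec.pop .left _)) (ih (s :: r) hu.2)) (by simp; ring)
  have := key x.word.reverse r (by simpa using x.comma_notMem_word)
  rw [List.reverse_reverse, List.length_reverse, x.length_word] at this
  exact Exec.cast (Exec.seq (Exec.pop .left _) this) (by ring)

theorem exec_unstashRight (x : BinTree) (v : Option Γ') (r a b : List Γ') :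
    Exec unstashRight ⟨v, r, a, x.word.reverse ++ .comma :: b, []⟩
      ⟨some .comma, x.word ++ r, a, b, []⟩ (3 * x.size + 2) := by
  have key : ∀ (u : List Γ') (r : List Γ'), .comma ∉ u →
      Exec (.loop (fun v => v ≠ some .comma) (.seq (pushVar .main) (.pop .right)))
        ⟨(u ++ .comma :: b).head?, r, a, (u ++ .comma :: b).tail, []⟩
        ⟨some .comma, u.reverse ++ r, a, b, []⟩ (3 * u.length + 1) := by
    intro u
    induction u with
    | nil => exact fun r _ => Exec.loopFalse (by simp)
    | cons s u ih =>
      intro r hu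
      simp only [List.mem_cons, not_or] at hu
      rw [List.reverse_cons, List.append_assoc]
      exact Exec.cast (Exec.loopTrue (by simp [Ne.symm hu.1])
        (Exec.seq (Exec.push .main _ _) (Exec.pop .right _)) (ih (s :: r) hu.2)) (by simp; ring)
  have := key x.word.reverse r (by simpa using x.comma_notMem_word)
  rw [List.reverse_reverse, List.length_reverse, x.length_word] at this
  exact Exec.cast (Exec.seq (Exec.pop .right _) this) (by ring)

/-! ### Programs as operations on a stack of trees -/

/-- A sequence of trees, the topmost one first. -/
def stackWord (xs : List BinTree) : List Γ' :=
  xs.flatMap BinTree.word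

/-- `Runs p xs ys T` says that `p`, started with the trees `xs` on top of the main stack, replaces
them by the trees `ys` within `T` steps, whatever else the stacks contain. -/
def Runs (p : Prog) (xs ys : List BinTree) (T : ℕ) : Prop :=
  ∀ v r a b, ∃ v' t, t ≤ T ∧
    Exec p ⟨v, stackWord xs ++ r, a, b, []⟩ ⟨v', stackWord ys ++ r, a, b, []⟩ t

theorem Runs.mono {p : Prog} {xs ys : List BinTree} {S T : ℕ} (h : Runs p xs ys S) (hST : S ≤ T) :
    Runs p xs ys T := fun v r a b =>
  let ⟨v', t, ht, h⟩ := h v r a b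
  ⟨v', t, ht.trans hST, h⟩

theorem Runs.seq {p q : Prog} {xs ys zs : List BinTree} {S T : ℕ} (h : Runs p xs ys S)
    (h' : Runs q ys zs T) : Runs (.seq p q) xs zs (S + T) := fun v r a b =>
  let ⟨v', s, hs, h⟩ := h v r a b
  let ⟨v'', t, ht, h'⟩ := h' v' r a b
  ⟨v'', s + t, add_le_add hs ht, .seq h h'⟩

theorem Runs.frame {p : Prog} {xs ys : List BinTree} {T : ℕ} (h : Runs p xs ys T)
    (zs : List BinTree) : Runs p (xs ++ zs) (ys ++ zs) T := fun v r a b => by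
  simpa [stackWord] using h v (stackWord zs ++ r) a b

/-- A program that runs within `T` steps does not enlarge the trees by more than `T`. -/
theorem Runs.size_le {p : Prog} {x y : BinTree} {T : ℕ} (h : Runs p [x] [y] T) :
    y.size ≤ x.size + T := by
  obtain ⟨v', t, ht, h⟩ := h none [] [] []
  have := h.length_le
  simp [stackWord, BinTree.length_word] at this
  omega

theorem stackWord_nil (r : List Γ') : stackWord [] ++ r = r := rfl

theorem stackWord_cons (x : BinTree) (xs : List BinTree) (r : List Γ') :
    stackWord (x :: xs) ++ r = x.word ++ (stackWord xs ++ r) := by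
  simp [stackWord]

theorem BinTree.word_cons_append (x y : BinTree) (r : List Γ') :
    (x.cons y).word ++ r = .bit true :: (x.word ++ (y.word ++ r)) := by
  simp [word]

theorem runs_drop (x : BinTree) : Runs drop [x] [] (6 * x.size + 3) := fun v r a b => by
  rw [stackWord_cons]
  exact ⟨_, _, le_rfl, exec_drop x v r a b⟩

/-- Duplicate the topmost tree. -/
def dup : Prog :=
  .seq stashBoth (.seq unstashLeft unstashRight)

theorem runs_dup (x : BinTree) : Runs dup [x] [x, x] (12 * x.size + 9) := fun v r a b => by
  simp only [stackWord_cons, stackWord_nil]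
  exact ⟨_, _, le_rfl, Exec.cast (.seq (exec_stashBoth x v r a b) (.seq
    (exec_unstashLeft x _ _ _ _) (exec_unstashRight x _ _ _ _))) (by ring)⟩

/-- Exchange the two topmost trees. -/
def swap : Prog :=
  .seq stashLeft (.seq stashRight (.seq unstashLeft unstashRight))

theorem runs_swap (x y : BinTree) : Runs swap [x, y] [y, x] (8 * (x.size + y.size) + 12) :=
  fun v r a b => by
    simp only [stackWord_cons, stackWord_nil]
    exact ⟨_, _, le_rfl, Exec.cast (.seq (exec_stashLeft x v (y.word ++ r) a b) (.seq
      (exec_stashRight y _ _ _ _) (.seq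
      (exec_unstashLeft x _ _ _ _) (exec_unstashRight y _ _ _ _)))) (by ring)⟩

/-- The first component of a pair. -/
def first : Prog :=
  .seq (.pop .main) (.seq stashLeft (.seq drop unstashLeft))

theorem runs_first (x y : BinTree) : Runs first [x.cons y] [x] (8 * (x.cons y).size + 10) :=
  fun v r a b => by
    simp only [stackWord_cons, stackWord_nil, BinTree.word_cons_append]
    refine ⟨_, _, ?_, Exec.seq (Exec.pop .main _) (.seq (exec_stashLeft x _ (y.word ++ r) a b) (.seq
      (exec_drop y _ _ _ _) (exec_unstashLeft x _ _ _ _)))⟩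
    simp only [BinTree.size]
    omega

/-- The second component of a pair. -/
def second : Prog :=
  .seq (.pop .main) drop

theorem runs_second (x y : BinTree) : Runs second [x.cons y] [y] (6 * (x.cons y).size + 4) :=
  fun v r a b => by
    simp only [stackWord_cons, stackWord_nil, BinTree.word_cons_append]
    refine ⟨_, _, ?_, Exec.seq (Exec.pop .main _) (exec_drop x _ (y.word ++ r) a b)⟩
    simp only [BinTree.size]
    omega

theorem runs_mkCons (x y : BinTree) :
    Runs (.push .main fun _ => .bit true) [x, y] [x.cons y] 1 := fun v r a b =>
  ⟨_, _, le_rfl, by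
    simpa [stackWord, BinTree.word, Mem.set, Mem.get] using
      Exec.push .main (fun _ => .bit true) ⟨v, stackWord [x, y] ++ r, a, b, []⟩⟩

theorem runs_mkNil : Runs (.push .main fun _ => .bit false) [] [.nil] 1 := fun v r a b =>
  ⟨_, _, le_rfl, Exec.push .main (fun _ => .bit false) ⟨v, r, a, b, []⟩⟩

/-- Perform `p` or `q`, depending on whether the topmost tree is a pair or trivial. -/
def branch (p q : Prog) : Prog :=
  .seq (.pop .main) (.seq (pushVar .main) (.ite (fun v => v = some (.bit true)) p q))

theorem runs_branch_cons {p : Prog} (q : Prog) {x y : BinTree} {xs ys : List BinTree} {T : ℕ}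
    (h : Runs p (x.cons y :: xs) ys T) : Runs (branch p q) (x.cons y :: xs) ys (T + 3) :=
  fun v r a b =>
    let ⟨v', t, ht, h⟩ := h (some (.bit true)) r a b
    ⟨v', 1 + (1 + (t + 1)), by omega,
      .seq (.pop .main _) (.seq (.push .main _ _) (.iteTrue rfl h))⟩

theorem runs_branch_nil (p : Prog) {q : Prog} {xs ys : List BinTree} {T : ℕ}
    (h : Runs q (.nil :: xs) ys T) : Runs (branch p q) (.nil :: xs) ys (T + 3) :=
  fun v r a b =>
    let ⟨v', t, ht, h⟩ := h (some (.bit false)) r a b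
    ⟨v', 1 + (1 + (t + 1)), by omega,
      .seq (.pop .main _) (.seq (.push .main _ _) (.iteFalse rfl h))⟩

/-- Perform `p` on all members of a list, from left to right. The list is the topmost tree on the
stack and the second one is the accumulator; `p` is applied to the pair of the two, while the rest
of the list is kept on the stack `left`. -/
def foldProg (p : Prog) : Prog :=
  .seq (.pop .main) (.seq (pushVar .main) (.seq (.loop (fun v => v = some (.bit true))
    (.seq (.pop .main) (.seq swap (.seq stashLeft (.seq (.push .main fun _ => .bit true)
      (.seq p (.seq unstashLeft (.seq (.pop .main) (pushVar .main))))))))) (.pop .main)))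

/-- The list of given trees. -/
def BinTree.ofList : List BinTree → BinTree
  | [] => .nil
  | x :: xs => .cons x (ofList xs)

/-- The running time of a fold, where `T` bounds the time of a step and `S` the size of the list. -/
theorem runs_foldProg {p : Prog} {β σ : Type} {eb : β → BinTree} {es : σ → BinTree}
    {F : σ → β → σ} {S T : ℕ} (l : List β)
    (hS : (BinTree.ofList (l.map eb)).size ≤ S) (x : σ)
    (hp : ∀ l₁ h, l₁ ++ [h] <+: l →
      Runs p [(eb h).cons (es (l₁.foldl F x))] [es (F (l₁.foldl F x) h)] T) :
    Runs (foldProg p) [BinTree.ofList (l.map eb), es x] [es (l.foldl F x)]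
      (l.length * (T + 16 * S + 23) + 4) := by
  have key : ∀ (l : List β) (x : σ), (BinTree.ofList (l.map eb)).size ≤ S →
      (∀ l₁ h, l₁ ++ [h] <+: l →
        Runs p [(eb h).cons (es (l₁.foldl F x))] [es (F (l₁.foldl F x) h)] T) →
      ∀ r a b, ∃ t, t ≤ l.length * (T + 16 * S + 23) + 1 ∧
        Exec (.loop (fun v => v = some (.bit true)) (.seq (.pop .main) (.seq swap (.seq stashLeft
          (.seq (.push .main fun _ => .bit true) (.seq p (.seq unstashLeft (.seq (.pop .main)
          (pushVar .main)))))))))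
          ⟨(BinTree.ofList (l.map eb)).word.head?,
            (BinTree.ofList (l.map eb)).word ++ ((es x).word ++ r), a, b, []⟩
          ⟨some (.bit false), .bit false :: ((es (l.foldl F x)).word ++ r), a, b, []⟩ t := by
    intro l
    induction l with
    | nil =>
      exact fun x _ _ r a b => ⟨1, by simp, .loopFalse rfl⟩
    | cons h l ih =>
      intro x hS hp r a b
      simp only [List.map_cons, BinTree.ofList, BinTree.size] at hS
      have hp0 := hp [] h (by simp)
      obtain ⟨v1, t1, ht1, h1⟩ := runs_swap (eb h) (BinTree.ofList (l.map eb))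
        (some (.bit true)) ((es x).word ++ r) a b
      simp only [stackWord_cons, stackWord_nil] at h1
      have h2 := exec_stashLeft (BinTree.ofList (l.map eb)) v1
        ((eb h).word ++ ((es x).word ++ r)) a b
      obtain ⟨v3, t3, ht3, h3⟩ := hp0 none r
        ((BinTree.ofList (l.map eb)).word.reverse ++ .comma :: a) b
      simp only [stackWord_cons, stackWord_nil, List.foldl_nil, BinTree.word_cons_append] at h3
      have h4 := exec_unstashLeft (BinTree.ofList (l.map eb)) v3 ((es (F x h)).word ++ r) a b
      obtain ⟨t5, ht5, h5⟩ := ih (F x h) (by omega) (fun l₁ h' hl => by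
        simpa using hp (h :: l₁) h' (by simpa using hl)) r a b
      have hw : ∃ s u, (BinTree.ofList (l.map eb)).word = s :: u := by
        cases l <;> exact ⟨_, _, rfl⟩
      obtain ⟨s, u, hw⟩ := hw
      simp only [hw, List.head?_cons, List.cons_append] at h1 h2 h3 h4 h5
      simp only [List.map_cons, BinTree.ofList, BinTree.word_cons_append, hw]
      refine ⟨_, ?_, .loopTrue rfl (.seq (.pop .main _) (.seq h1 (.seq h2 (.seq (.push .main _ _)
        (.seq h3 (.seq h4 (.seq (.pop .main _) (.push .main _ _)))))))) h5⟩
      have := (eb h).size_pos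
      simp only [List.length_cons, Nat.add_mul, Nat.one_mul]
      simp only [Nat.mul_add] at ht5 ⊢
      omega
  intro v r a b
  obtain ⟨t, ht, h⟩ := key l x hS hp r a b
  have hw : ∃ s u, (BinTree.ofList (l.map eb)).word = s :: u := by
    cases l <;> exact ⟨_, _, rfl⟩
  obtain ⟨s, u, hw⟩ := hw
  simp only [stackWord_cons, stackWord_nil]
  simp only [hw, List.head?_cons, List.cons_append] at h ⊢
  exact ⟨_, _, by omega, .seq (.pop .main _) (.seq (.push .main _ _) (.seq h (.pop .main _)))⟩

/-! ### Polynomial-time functions on types whose elements are encoded by trees -/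

/-- A type whose elements are represented by trees. -/
class Enc (α : Type) where
  /-- the tree that represents an element -/
  enc : α → BinTree

open Enc (enc)

instance : Enc BinTree := ⟨id⟩

instance : Enc Unit := ⟨fun _ => .nil⟩

instance : Enc Bool := ⟨fun b => if b then .cons .nil .nil else .nil⟩

instance {α β : Type} [Enc α] [Enc β] : Enc (α × β) := ⟨fun p => .cons (enc p.1) (enc p.2)⟩

instance {α : Type} [Enc α] : Enc (List α) := ⟨fun l => .ofList (l.map enc)⟩

/-- The size of the tree that represents an element. -/
def esize {α : Type} [Enc α] (x : α) : ℕ := (enc x).size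

/-- The function is computed by a program within time polynomial in the size of the argument. -/
def PolyFun {α β : Type} [Enc α] [Enc β] (f : α → β) : Prop :=
  ∃ (p : Prog) (q : Polynomial ℕ), ∀ x, Runs p [enc x] [enc (f x)] (q.eval (esize x))

theorem eval_mono (q : Polynomial ℕ) {m n : ℕ} (h : m ≤ n) : q.eval m ≤ q.eval n := by
  rw [Polynomial.eval_eq_sum, Polynomial.eval_eq_sum, Polynomial.sum, Polynomial.sum]
  gcongr

section

variable {α β γ σ : Type} [Enc α] [Enc β] [Enc γ] [Enc σ]

theorem enc_cons (x : α) (l : List α) : enc (x :: l) = .cons (enc x) (enc l) := rfl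

theorem esize_pair (x : α) (y : β) : esize (x, y) = esize x + esize y + 1 := rfl

theorem esize_nil : esize ([] : List α) = 1 := rfl

theorem esize_cons (x : α) (l : List α) : esize (x :: l) = esize x + esize l + 1 := rfl

theorem length_le_esize (l : List α) : l.length ≤ esize l := by
  induction l with
  | nil => exact Nat.zero_le _
  | cons x l ih => rw [esize_cons, List.length_cons]; omega

theorem esize_le_of_mem {l : List α} {x : α} (h : x ∈ l) : esize x ≤ esize l := by
  induction l with
  | nil => simp at h
  | cons y l ih =>
    rw [esize_cons]
    rcases List.mem_cons.1 h with rfl | h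
    · omega
    · have := ih h
      omega

theorem esize_append (l l' : List α) : esize (l ++ l') + 1 = esize l + esize l' := by
  induction l with
  | nil => rw [List.nil_append, esize_nil]; omega
  | cons x l ih => rw [List.cons_append, esize_cons, esize_cons]; omega

namespace PolyFun

theorem esize_le {f : α → β} (h : PolyFun f) :
    ∃ q : Polynomial ℕ, ∀ x, esize (f x) ≤ q.eval (esize x) := by
  obtain ⟨p, q, h⟩ := h
  exact ⟨.X + q, fun x => by simpa [esize] using (h x).size_le⟩

/-- Only the encoding of the values matters, not their type. -/
theorem of_enc_eq {f : α → β} {g : α → γ} (h : PolyFun f) (e : ∀ x, enc (g x) = enc (f x)) :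
    PolyFun g := by
  obtain ⟨p, q, h⟩ := h
  exact ⟨p, q, fun x => by rw [e]; exact h x⟩

theorem congr {f g : α → β} (h : PolyFun f) (e : ∀ x, g x = f x) : PolyFun g :=
  h.of_enc_eq fun x => by rw [e]

/-- A function that changes the type but not the encoding. -/
theorem retype {f : α → β} (e : ∀ x, enc (f x) = enc x) : PolyFun f :=
  ⟨.ite (fun _ => true) (.seq (.push .left fun _ => .blank) (.pop .left)) (.pop .left), 3,
    fun x v r a b => ⟨_, 3, by simp, by
      rw [e]
      exact .iteTrue rfl (.seq (.push .left _ _) (.pop .left _))⟩⟩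

theorem id : PolyFun (fun x : α => x) :=
  retype fun _ => rfl

theorem comp {g : β → γ} {f : α → β} (hg : PolyFun g) (hf : PolyFun f) :
    PolyFun fun x => g (f x) := by
  obtain ⟨qs, hs⟩ := hf.esize_le
  obtain ⟨pf, qf, hf⟩ := hf
  obtain ⟨pg, qg, hg⟩ := hg
  refine ⟨.seq pf pg, qf + qg.comp qs, fun x => ((hf x).seq (hg _)).mono ?_⟩
  simpa using eval_mono qg (hs x)

theorem pair {f : α → β} {g : α → γ} (hf : PolyFun f) (hg : PolyFun g) :
    PolyFun fun x => (f x, g x) := by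
  obtain ⟨qs, hs⟩ := hg.esize_le
  obtain ⟨pf, qf, hf⟩ := hf
  obtain ⟨pg, qg, hg⟩ := hg
  refine ⟨.seq dup (.seq pg (.seq swap (.seq pf (.push .main fun _ => .bit true)))),
    12 * .X + 9 + (qg + (8 * (qs + .X) + 12 + (qf + 1))), fun x =>
    ((runs_dup (enc x)).seq (((hg x).frame [enc x]).seq ((runs_swap _ _).seq
      (((hf x).frame [enc (g x)]).seq (runs_mkCons _ _))))).mono ?_⟩
  have := hs x
  simp only [Polynomial.eval_add, Polynomial.eval_mul, Polynomial.eval_X, Polynomial.eval_ofNat,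
    Polynomial.eval_one, esize] at this ⊢
  omega

theorem fst : PolyFun (Prod.fst : α × β → α) :=
  ⟨first, 8 * .X + 10, fun x => (runs_first _ _).mono (by simp [esize, enc])⟩

theorem snd : PolyFun (Prod.snd : α × β → β) :=
  ⟨second, 6 * .X + 4, fun x => (runs_second _ _).mono (by simp [esize, enc])⟩

theorem fst' {f : α → β × γ} (h : PolyFun f) : PolyFun fun x => (f x).1 :=
  fst.comp h

theorem snd' {f : α → β × γ} (h : PolyFun f) : PolyFun fun x => (f x).2 :=
  snd.comp h

theorem const (y : β) : PolyFun fun _ : α => y := by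
  have key : ∀ t : BinTree, ∃ p T, Runs p [] [t] T := by
    intro t
    induction t with
    | nil => exact ⟨_, _, runs_mkNil⟩
    | cons a b iha ihb =>
      obtain ⟨p, S, hp⟩ := iha
      obtain ⟨q, T, hq⟩ := ihb
      exact ⟨_, _, hq.seq ((hp.frame [b]).seq (runs_mkCons a b))⟩
  obtain ⟨p, T, hp⟩ := key (enc y)
  refine ⟨.seq drop p, 6 * .X + 3 + .C T, fun x => ((runs_drop (enc x)).seq hp).mono ?_⟩
  simp [esize]

/-- Case distinction on the shape of a list. -/
theorem listCases {l : α → List β} {f : α → σ} {g : α → β → List β → σ} (hl : PolyFun l)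
    (hf : PolyFun f) (hg : PolyFun fun p : α × β × List β => g p.1 p.2.1 p.2.2) :
    PolyFun fun x => match l x with
      | [] => f x
      | y :: t => g x y t := by
  obtain ⟨qs, hs⟩ := hl.esize_le
  obtain ⟨pl, ql, hl⟩ := hl
  obtain ⟨pf, qf, hf⟩ := hf
  obtain ⟨pg, qg, hg⟩ := hg
  refine ⟨.seq dup (.seq pl (branch (.seq swap (.seq (.push .main fun _ => .bit true) pg))
    (.seq drop pf))), 12 * .X + 9 + (ql + (8 * (qs + .X) + 12 + (1 + qg.comp (.X + qs + 1)) +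
      (6 * qs + 3 + qf) + 3)), fun x => ?_⟩
  have hsx := hs x
  refine Runs.mono (S := 12 * esize x + 9 + (ql.eval (esize x) +
    (8 * (esize (l x) + esize x) + 12 + (1 + qg.eval (esize x + esize (l x) + 1)) +
      (6 * esize (l x) + 3 + qf.eval (esize x)) + 3))) ?_ ?_
  · refine (runs_dup (enc x)).seq (((hl x).frame [enc x]).seq ?_)
    beta_reduce
    cases l x with
    | nil =>
      refine ((runs_branch_nil _ (((runs_drop .nil).frame [enc x]).seq (hf x)))).mono ?_
      rw [esize_nil]
      simp only [BinTree.size]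
      omega
    | cons y t =>
      refine (runs_branch_cons _ ((runs_swap _ _).seq ((runs_mkCons _ _).seq
        (hg (x, y, t))))).mono ?_
      rw [esize_pair, show esize (y, t) = esize (y :: t) from rfl]
      change 8 * (esize (y :: t) + esize x) + _ + _ + _ ≤ _
      omega
  · simp only [Polynomial.eval_add, Polynomial.eval_mul, Polynomial.eval_X, Polynomial.eval_ofNat,
      Polynomial.eval_one, Polynomial.eval_comp]
    gcongr
    exact eval_mono qg (by omega)

/-- Evaluate a polynomial-time function along a list. It suffices that the intermediate results
have polynomial size. -/
theorem foldl_of_size {l : α → List β} {s : α → σ} {step : α → σ → β → σ} (hl : PolyFun l)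
    (hs : PolyFun s) (hstep : PolyFun fun p : α × σ × β => step p.1 p.2.1 p.2.2)
    (hb : ∃ q : Polynomial ℕ, ∀ x l', l' <+: l x →
      esize (l'.foldl (step x) (s x)) ≤ q.eval (esize x)) :
    PolyFun fun x => (l x).foldl (step x) (s x) := by
  obtain ⟨qb, hb⟩ := hb
  obtain ⟨ql, hql⟩ := hl.esize_le
  obtain ⟨p₀, q₀, h₀⟩ := hl.pair (id.pair hs)
  have h1 : PolyFun fun p : β × α × σ => (p.2.1, step p.2.1 p.2.2 p.1) :=
    pair (fst' snd) (hstep.comp (pair (fst' snd) (pair (snd' snd) fst)))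
  obtain ⟨p₁, q₁, h₁⟩ := h1
  refine ⟨.seq p₀ (.seq (.pop .main) (.seq (foldProg p₁) second)),
    q₀ + (1 + (ql * (q₁.comp (ql + .X + qb + 2) + 16 * ql + 23) + 4 + (6 * (.X + qb + 1) + 4))),
    fun x => ?_⟩
  have hsplit : ∀ a b : BinTree, Runs (.pop .main) [a.cons b] [a, b] 1 := fun a b v r c d => by
    simp only [stackWord_cons, stackWord_nil, BinTree.word_cons_append]
    exact ⟨_, _, le_rfl, .pop .main _⟩
  have hfold : ∀ l' : List β, l'.foldl (fun (p : α × σ) y => (p.1, step p.1 p.2 y)) (x, s x) =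
      (x, l'.foldl (step x) (s x)) := fun l' => by
    induction l' using List.reverseRecOn with
    | nil => rfl
    | append_singleton l' y ih => simp [ih]
  have h2 := runs_foldProg (p := p₁) (eb := (enc : β → BinTree)) (es := (enc : α × σ → BinTree))
    (F := fun (p : α × σ) y => (p.1, step p.1 p.2 y)) (S := esize (l x))
    (T := q₁.eval (esize (l x) + esize x + qb.eval (esize x) + 2)) (l x) le_rfl (x, s x)
    (fun l₁ y hl₁ => by
      rw [hfold]
      refine (h₁ (y, x, l₁.foldl (step x) (s x))).mono (eval_mono q₁ ?_)
      rw [esize_pair, esize_pair]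
      have := hb x l₁ ((List.prefix_append _ _).trans hl₁)
      have := esize_le_of_mem (hl₁.subset (List.mem_append_right l₁ (List.mem_singleton_self y)))
      omega)
  rw [hfold] at h2
  refine ((h₀ x).seq ((hsplit _ _).seq (h2.seq (runs_second _ _)))).mono ?_
  have e1 := hb x (l x) (List.prefix_refl _)
  have e2 := hql x
  have e3 := length_le_esize (l x)
  simp only [Polynomial.eval_add, Polynomial.eval_mul, Polynomial.eval_X, Polynomial.eval_ofNat,
    Polynomial.eval_one, Polynomial.eval_comp]
  gcongr
  · exact e3.trans e2
  · exact eval_mono q₁ (by omega)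
  · change esize x + esize (List.foldl (step x) (s x) (l x)) + 1 ≤ _
    omega

/-- Evaluate a polynomial-time function along a list. It suffices that each step enlarges the
intermediate result by a summand that does not depend on it; its size may be measured by any
function `μ` that is polynomially equivalent to the size of the encoding. -/
theorem foldl {l : α → List β} {s : α → σ} {step : α → σ → β → σ} (hl : PolyFun l)
    (hs : PolyFun s) (hstep : PolyFun fun p : α × σ × β => step p.1 p.2.1 p.2.2)
    (μ : σ → ℕ) (hμ : ∀ y, μ y ≤ esize y) (qμ : Polynomial ℕ) (hqμ : ∀ y, esize y ≤ qμ.eval (μ y))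
    (hb : ∃ q : Polynomial ℕ, ∀ x y b, μ (step x y b) ≤ μ y + q.eval (esize x + esize b)) :
    PolyFun fun x => (l x).foldl (step x) (s x) := by
  obtain ⟨q, hb⟩ := hb
  obtain ⟨ql, hql⟩ := hl.esize_le
  obtain ⟨qs, hqs⟩ := hs.esize_le
  refine foldl_of_size hl hs hstep ⟨qμ.comp (qs + ql * q.comp (.X + ql)), fun x l' hl' => ?_⟩
  have key : ∀ l' : List β, l' <+: l x → μ (l'.foldl (step x) (s x)) ≤
      esize (s x) + l'.length * q.eval (esize x + esize (l x)) := by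
    intro l'
    induction l' using List.reverseRecOn with
    | nil => exact fun _ => by simpa using hμ (s x)
    | append_singleton l' y ih =>
      intro hl'
      have h1 := ih ((List.prefix_append _ _).trans hl')
      have h2 := hb x (l'.foldl (step x) (s x)) y
      have h3 := eval_mono q (Nat.add_le_add_left (esize_le_of_mem (hl'.subset
        (List.mem_append_right l' (List.mem_singleton_self y)))) (esize x))
      simp only [List.foldl_append, List.foldl_cons, List.foldl_nil, List.length_append,
        List.length_singleton, Nat.add_mul, Nat.one_mul]
      omega
  refine (hqμ _).trans ?_
  rw [Polynomial.eval_comp]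
  refine eval_mono qμ ((key l' hl').trans ?_)
  simp only [Polynomial.eval_add, Polynomial.eval_mul, Polynomial.eval_X, Polynomial.eval_comp]
  have := hql x
  gcongr
  · exact hqs x
  · exact (hl'.length_le.trans (length_le_esize _)).trans this
  · exact eval_mono q (by omega)

end PolyFun
end

namespace PolyFun

/-! ### Lists -/

variable {α β γ σ : Type} [Enc α] [Enc β] [Enc γ] [Enc σ]

theorem cond {c : α → Bool} {f g : α → β} (hc : PolyFun c) (hf : PolyFun f) (hg : PolyFun g) :
    PolyFun fun x => if c x then f x else g x := by
  have h : PolyFun fun x => if c x then [()] else [] :=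
    hc.of_enc_eq fun x => by cases c x <;> rfl
  refine (h.listCases hg (g := fun x _ _ => f x) (hf.comp fst)).congr fun x => ?_
  cases c x <;> rfl

theorem cons {f : α → β} {l : α → List β} (hf : PolyFun f) (hl : PolyFun l) :
    PolyFun fun x => f x :: l x :=
  (hf.pair hl).of_enc_eq fun _ => rfl

theorem isEmpty {l : α → List β} (hl : PolyFun l) : PolyFun fun x => (l x).isEmpty :=
  (hl.listCases (const true) (g := fun _ _ _ => false) (const false)).congr fun x => by
    cases l x <;> rfl

theorem tail {l : α → List β} (hl : PolyFun l) : PolyFun fun x => (l x).tail :=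
  (hl.listCases (const []) (g := fun _ _ t => t) (snd' snd)).congr fun x => by
    cases l x <;> rfl

theorem headD {l : α → List β} {f : α → β} (hl : PolyFun l) (hf : PolyFun f) :
    PolyFun fun x => (l x).headD (f x) :=
  (hl.listCases hf (g := fun _ y _ => y) (fst' snd)).congr fun x => by
    cases l x <;> rfl

theorem reverse {l : α → List β} (hl : PolyFun l) : PolyFun fun x => (l x).reverse := by
  refine (foldl (s := fun _ => []) (step := fun _ t b => b :: t) hl (const _)
    (cons (snd' snd) (fst' snd)) esize (fun _ => le_rfl) .X (fun _ => by simp)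
    ⟨.X + 1, fun x y b => ?_⟩).congr fun x => ?_
  · simp only [esize_cons, Polynomial.eval_add, Polynomial.eval_X, Polynomial.eval_one]
    omega
  · simp

theorem foldr {l : α → List β} {s : α → σ} {step : α → β → σ → σ} (hl : PolyFun l)
    (hs : PolyFun s) (hstep : PolyFun fun p : α × β × σ => step p.1 p.2.1 p.2.2)
    (μ : σ → ℕ) (hμ : ∀ y, μ y ≤ esize y) (qμ : Polynomial ℕ) (hqμ : ∀ y, esize y ≤ qμ.eval (μ y))
    (hb : ∃ q : Polynomial ℕ, ∀ x b y, μ (step x b y) ≤ μ y + q.eval (esize x + esize b)) :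
    PolyFun fun x => (l x).foldr (step x) (s x) := by
  obtain ⟨q, hb⟩ := hb
  refine (foldl (step := fun x y b => step x b y) (reverse hl) hs
    (hstep.comp (pair fst (pair (snd' snd) (fst' snd)))) μ hμ qμ hqμ
    ⟨q, fun x y b => hb x b y⟩).congr fun x => ?_
  simp

theorem append {l l' : α → List β} (hl : PolyFun l) (hl' : PolyFun l') :
    PolyFun fun x => l x ++ l' x := by
  refine (foldr (step := fun _ b t => b :: t) hl hl' (cons (fst' snd) (snd' snd))
    esize (fun _ => le_rfl) .X (fun _ => by simp) ⟨.X + 1, fun x y b => ?_⟩).congr fun x => ?_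
  · simp only [esize_cons, Polynomial.eval_add, Polynomial.eval_X, Polynomial.eval_one]
    omega
  · simp

theorem map {l : α → List β} {g : α → β → γ} (hl : PolyFun l)
    (hg : PolyFun fun p : α × β => g p.1 p.2) : PolyFun fun x => (l x).map (g x) := by
  obtain ⟨q, hq⟩ := hg.esize_le
  refine (foldr (s := fun _ => []) (step := fun x b t => g x b :: t) hl (const _)
    (cons (hg.comp (pair fst (fst' snd))) (snd' snd))
    esize (fun _ => le_rfl) .X (fun _ => by simp) ⟨q.comp (.X + 1) + 1, fun x b y => ?_⟩).congr
      fun x => ?_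
  · have : esize (g x b) ≤ _ := hq (x, b)
    rw [esize_pair] at this
    simp only [esize_cons, Polynomial.eval_add, Polynomial.eval_X, Polynomial.eval_one,
      Polynomial.eval_comp]
    omega
  · simp

theorem flatMap {l : α → List β} {g : α → β → List γ} (hl : PolyFun l)
    (hg : PolyFun fun p : α × β => g p.1 p.2) : PolyFun fun x => (l x).flatMap (g x) := by
  obtain ⟨q, hq⟩ := hg.esize_le
  refine (foldr (s := fun _ => []) (step := fun x b t => g x b ++ t) hl (const _)
    (append (hg.comp (pair fst (fst' snd))) (snd' snd))
    esize (fun _ => le_rfl) .X (fun _ => by simp) ⟨q.comp (.X + 1), fun x b y => ?_⟩).congr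
      fun x => ?_
  · have : esize (g x b) ≤ _ := hq (x, b)
    rw [esize_pair] at this
    have := esize_append (g x b) y
    simp only [Polynomial.eval_add, Polynomial.eval_X, Polynomial.eval_one,
      Polynomial.eval_comp]
    omega
  · induction l x with
    | nil => rfl
    | cons b t ih => rw [List.foldr_cons, ← ih, List.flatMap_cons]

theorem filter {l : α → List β} {c : α → β → Bool} (hl : PolyFun l)
    (hc : PolyFun fun p : α × β => c p.1 p.2) : PolyFun fun x => (l x).filter (c x) := by
  refine (flatMap (g := fun x b => if c x b then [b] else []) hl
    (cond hc (cons snd (const _)) (const _))).congr fun x => ?_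
  induction l x with
  | nil => rfl
  | cons b t ih =>
    rw [List.filter_cons, List.flatMap_cons, ih]
    split <;> rfl

theorem and {c d : α → Bool} (hc : PolyFun c) (hd : PolyFun d) : PolyFun fun x => c x && d x :=
  (cond hc hd (const false)).congr fun x => by cases c x <;> rfl

theorem not {c : α → Bool} (hc : PolyFun c) : PolyFun fun x => !c x :=
  (cond hc (const false) (const true)).congr fun x => by cases c x <;> rfl

theorem all {l : α → List β} {c : α → β → Bool} (hl : PolyFun l)
    (hc : PolyFun fun p : α × β => c p.1 p.2) : PolyFun fun x => (l x).all (c x) := by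
  refine (isEmpty (filter (c := fun x b => !c x b) hl (not hc))).congr fun x => ?_
  induction l x with
  | nil => rfl
  | cons b t ih =>
    rw [List.all_cons, ih, List.filter_cons]
    cases c x b <;> simp

theorem zip {l : α → List β} {l' : α → List γ} (hl : PolyFun l) (hl' : PolyFun l') :
    PolyFun fun x => (l x).zip (l' x) := by
  have hstep : PolyFun fun p : α × (List γ × List (β × γ)) × β =>
      match p.2.1.1 with
      | [] => (([], p.2.1.2) : List γ × List (β × γ))
      | c :: t => (t, (p.2.2, c) :: p.2.1.2) := by
    refine listCases (g := fun (p : α × (List γ × List (β × γ)) × β) c t =>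
      (t, (p.2.2, c) :: p.2.1.2)) (fst' (fst' snd)) (pair (const _) (snd' (fst' snd))) ?_
    exact pair (snd' snd) (cons (pair (snd' (snd' fst)) (fst' snd)) (snd' (fst' (snd' fst))))
  refine (reverse (snd' (foldl (s := fun x => (l' x, [])) (step := fun x p b =>
      match p.1 with
      | [] => (([], p.2) : List γ × List (β × γ))
      | c :: t => (t, (b, c) :: p.2)) hl (pair hl' (const _)) hstep
    esize (fun _ => le_rfl) .X (fun _ => by simp) ⟨.X + 1, fun x p b => ?_⟩))).congr fun x => ?_
  · obtain ⟨l, t⟩ := p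
    cases l with
    | nil => simp only [esize_pair]; omega
    | cons c l =>
      simp only [esize_pair, esize_cons, Polynomial.eval_add, Polynomial.eval_X,
        Polynomial.eval_one]
      omega
  · have key : ∀ (l : List β) (l' : List γ) (t : List (β × γ)),
        (l.foldl (fun p b =>
          match p.1 with
          | [] => (([], p.2) : List γ × List (β × γ))
          | c :: t => (t, (b, c) :: p.2)) (l', t)).2.reverse = t.reverse ++ l.zip l' := by
      intro l
      induction l with
      | nil => simp
      | cons b l ih =>
        intro l' t
        cases l' with
        | nil => simpa using ih [] t
        | cons c l' => simp [ih]
    simpa using (key (l x) (l' x) []).symm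

theorem zipWith {l : α → List β} {l' : α → List γ} {g : β → γ → σ} (hl : PolyFun l)
    (hl' : PolyFun l') (hg : PolyFun fun p : β × γ => g p.1 p.2) :
    PolyFun fun x => List.zipWith g (l x) (l' x) :=
  (map (g := fun _ (p : β × γ) => g p.1 p.2) (zip hl hl') (hg.comp snd)).congr fun x =>
    (List.map_zip_eq_zipWith (f := fun p => g p.1 p.2) (l := l x) (l' := l' x)).symm

theorem bool₃ (g : Bool → Bool → Bool → Bool) {a b c : α → Bool} (ha : PolyFun a) (hb : PolyFun b)
    (hc : PolyFun c) : PolyFun fun x => g (a x) (b x) (c x) := by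
  refine (cond ha (cond hb (cond hc (const (g true true true)) (const (g true true false)))
    (cond hc (const (g true false true)) (const (g true false false))))
    (cond hb (cond hc (const (g false true true)) (const (g false true false)))
    (cond hc (const (g false false true)) (const (g false false false))))).congr fun x => ?_
  cases a x <;> cases b x <;> cases c x <;> rfl

end PolyFun

/-! ### Binary arithmetic -/

instance : Enc ℕ := ⟨fun n => enc n.bits⟩

/-- The value of a sequence of binary digits, the least significant first. -/
def ofDigits (l : List Bool) : ℕ :=
  l.foldr Nat.bit 0

theorem ofDigits_cons (b : Bool) (l : List Bool) :
    ofDigits (b :: l) = 2 * ofDigits l + b.toNat := by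
  simp [ofDigits, Nat.bit_val]

theorem ofDigits_append (l l' : List Bool) :
    ofDigits (l ++ l') = ofDigits l + 2 ^ l.length * ofDigits l' := by
  induction l with
  | nil => simp [ofDigits]
  | cons b l ih =>
    rw [List.cons_append, ofDigits_cons, ofDigits_cons, ih, List.length_cons]
    ring

theorem ofDigits_bits (n : ℕ) : ofDigits n.bits = n := by
  induction n using Nat.binaryRec' with
  | zero => rfl
  | bit b n h ih => rw [Nat.bits_append_bit _ _ h, ofDigits, List.foldr_cons, ← ofDigits, ih]

theorem ofDigits_lt (l : List Bool) : ofDigits l < 2 ^ l.length := by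
  induction l with
  | nil => simp [ofDigits]
  | cons b l ih =>
    rw [ofDigits_cons, List.length_cons, pow_succ]
    have := b.toNat_le
    omega

theorem size_le_esize (n : ℕ) : n.size ≤ esize n := by
  rw [← Nat.size_eq_bits_len]
  exact length_le_esize n.bits

theorem esize_bool_le (b : Bool) : esize b ≤ 3 := by
  cases b <;> decide

theorem esize_nat_le (n : ℕ) : esize n ≤ 4 * n.size + 1 := by
  rw [← Nat.size_eq_bits_len]
  change esize n.bits ≤ _
  induction n.bits with
  | nil => simp [esize_nil]
  | cons b l ih =>
    have := esize_bool_le b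
    rw [esize_cons, List.length_cons]
    omega

theorem nat_size_add_le (m n : ℕ) : (m + n).size ≤ m.size + n.size + 1 := by
  rw [Nat.size_le, pow_add, pow_add, pow_one]
  have h1 := Nat.lt_size_self m
  have h2 := Nat.lt_size_self n
  nlinarith

theorem nat_size_mul_le (m n : ℕ) : (m * n).size ≤ m.size + n.size := by
  rw [Nat.size_le, pow_add]
  exact Nat.mul_lt_mul'' (Nat.lt_size_self m) (Nat.lt_size_self n)

theorem nat_size_bit_le (b : Bool) (n : ℕ) : (Nat.bit b n).size ≤ n.size + 1 := by
  rw [Nat.size_le, pow_add, pow_one, Nat.bit_val]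
  have h1 := Nat.lt_size_self n
  have := b.toNat_le
  omega

namespace PolyFun

variable {α : Type} [Enc α]

theorem bits {f : α → ℕ} (hf : PolyFun f) : PolyFun fun x => (f x).bits :=
  hf.of_enc_eq fun _ => rfl

theorem natBit {b : α → Bool} {f : α → ℕ} (hb : PolyFun b) (hf : PolyFun f) :
    PolyFun fun x => Nat.bit (b x) (f x) := by
  refine (cond (cond hb (const false) (isEmpty (bits hf))) (const []) (cons hb (bits hf))).of_enc_eq
    fun x => ?_
  change enc (Nat.bit (b x) (f x)).bits = _
  rcases Nat.eq_zero_or_pos (f x) with h | h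
  · cases b x <;> simp [h, Nat.bit_val]
  · rw [Nat.bits_append_bit _ _ (by omega), if_neg]
    have : (f x).bits ≠ [] := fun h0 => by
      have := ofDigits_bits (f x)
      rw [h0] at this
      exact absurd this.symm h.ne'
    cases b x <;> simp [this]

theorem ofDigits {l : α → List Bool} (hl : PolyFun l) : PolyFun fun x => ofDigits (l x) := by
  refine foldr (step := fun _ => Nat.bit) hl (const 0) (natBit (fst' snd) (snd' snd))
    Nat.size size_le_esize (4 * .X + 1) (fun n => by simpa using esize_nat_le n)
    ⟨1, fun x b n => ?_⟩
  simpa using nat_size_bit_le b n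

end PolyFun

/-- Process two sequences of digits serially with a carry: `d` gives the next digit and `r` the
next carry. The state consists of what remains of the sequences, the carry, and the digits
obtained so far in reverse order. -/
def serialStep (d r : Bool → Bool → Bool → Bool) (p : List Bool × List Bool × Bool × List Bool) :
    List Bool × List Bool × Bool × List Bool :=
  (p.1.tail, p.2.1.tail, r (p.1.headD false) (p.2.1.headD false) p.2.2.1,
    d (p.1.headD false) (p.2.1.headD false) p.2.2.1 :: p.2.2.2)

/-- The last carry and the digits of the serial processing of two sequences. The number of steps is
the sum of the lengths, which exhausts both. -/
def serial (d r : Bool → Bool → Bool → Bool) (u v : List Bool) : Bool × List Bool :=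
  ((u ++ v).foldl (fun p _ => serialStep d r p) (u, v, false, [])).2.2

theorem PolyFun.serial {α : Type} [Enc α] (d r : Bool → Bool → Bool → Bool) {u v : α → List Bool}
    (hu : PolyFun u) (hv : PolyFun v) : PolyFun fun x => serial d r (u x) (v x) := by
  have h1 : PolyFun fun p : α × (List Bool × List Bool × Bool × List Bool) × Bool =>
      p.2.1.1 := fst' (fst' snd)
  have h2 : PolyFun fun p : α × (List Bool × List Bool × Bool × List Bool) × Bool =>
      p.2.1.2.1 := fst' (snd' (fst' snd))
  have h3 : PolyFun fun p : α × (List Bool × List Bool × Bool × List Bool) × Bool =>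
      p.2.1.2.2.1 := fst' (snd' (snd' (fst' snd)))
  have h4 : PolyFun fun p : α × (List Bool × List Bool × Bool × List Bool) × Bool =>
      p.2.1.2.2.2 := snd' (snd' (snd' (fst' snd)))
  have h1' := headD h1 (const false)
  have h2' := headD h2 (const false)
  refine snd' (snd' (foldl (step := fun _ p _ => serialStep d r p) (append hu hv)
    (pair hu (pair hv (const (false, []))))
    (pair (tail h1) (pair (tail h2) (pair (bool₃ r h1' h2' h3) (cons (bool₃ d h1' h2' h3) h4))))
    esize (fun _ => le_rfl) .X (fun _ => by simp) ⟨7, fun x p b => ?_⟩))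
  obtain ⟨u, v, c, w⟩ := p
  have ht : ∀ l : List Bool, esize l.tail ≤ esize l := by
    intro l
    cases l with
    | nil => exact le_rfl
    | cons b l => rw [List.tail_cons, esize_cons]; omega
  have hu := ht u
  have hv := ht v
  have hr := esize_bool_le (r (u.headD false) (v.headD false) c)
  have hd := esize_bool_le (d (u.headD false) (v.headD false) c)
  simp only [serialStep, esize_pair, esize_cons, Polynomial.eval_ofNat]
  omega

/-- The digits and carries `d` and `r` perform the operation `a + ε b` if this holds for single
digits; the carry has the same sign as `b`. -/
theorem serial_spec {d r : Bool → Bool → Bool → Bool} {ε : ℤ}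
    (h : ∀ a b c, (a.toNat : ℤ) + ε * b.toNat + ε * c.toNat =
      (d a b c).toNat + 2 * (ε * (r a b c).toNat)) (u v : List Bool) :
    (ofDigits u : ℤ) + ε * ofDigits v = ofDigits (serial d r u v).2.reverse +
      2 ^ (u.length + v.length) * (ε * (serial d r u v).1.toNat) ∧
    (serial d r u v).2.length = u.length + v.length := by
  have key : ∀ (l : List Bool) (u v w : List Bool) (c : Bool), u.length ≤ l.length →
      v.length ≤ l.length →
      (ofDigits w.reverse : ℤ) + 2 ^ w.length * (ofDigits u + ε * ofDigits v + ε * c.toNat) =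
        ofDigits (l.foldl (fun p _ => serialStep d r p) (u, v, c, w)).2.2.2.reverse +
        2 ^ (w.length + l.length) *
          (ε * (l.foldl (fun p _ => serialStep d r p) (u, v, c, w)).2.2.1.toNat) ∧
      (l.foldl (fun p _ => serialStep d r p) (u, v, c, w)).2.2.2.length = w.length + l.length := by
    intro l
    induction l with
    | nil =>
      intro u v w c hu hv
      rw [List.length_nil, Nat.le_zero, List.length_eq_zero_iff] at hu hv
      subst hu hv
      simp [ofDigits]
    | cons x l ih =>
      intro u v w c hu hv
      have hs : ∀ u : List Bool, (ofDigits u : ℤ) =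
          2 * ofDigits u.tail + (u.headD false).toNat := by
        intro u
        cases u with
        | nil => simp [ofDigits]
        | cons b u => rw [ofDigits_cons]; push_cast; rfl
      obtain ⟨h1, h2⟩ := ih u.tail v.tail (d (u.headD false) (v.headD false) c :: w)
        (r (u.headD false) (v.headD false) c) (by simp at hu ⊢; omega) (by simp at hv ⊢; omega)
      have hstep : serialStep d r (u, v, c, w) = (u.tail, v.tail,
        r (u.headD false) (v.headD false) c, d (u.headD false) (v.headD false) c :: w) := rfl
      simp only [List.foldl_cons, hstep]
      refine ⟨?_, by rw [h2, List.length_cons, List.length_cons]; omega⟩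
      rw [List.length_cons, show w.length + (l.length + 1) = w.length + 1 + l.length by omega]
      rw [List.length_cons] at h1
      rw [← h1, List.reverse_cons, ofDigits_append, List.length_reverse, ofDigits_cons, hs u, hs v]
      have := h (u.headD false) (v.headD false) c
      simp only [_root_.ShortRational.ofDigits, List.foldr_nil]
      push_cast
      linear_combination 2 ^ w.length * this
  have := key (u ++ v) u v [] false (by simp) (by simp)
  simpa [ofDigits, serial] using this

/-- The carry of an addition. -/
def majority (a b c : Bool) : Bool := (a && b) || (a && c) || (b && c)

/-- The borrow of a subtraction. -/
def borrow (a b c : Bool) : Bool := (!a && b) || (!a && c) || (b && c)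

/-- The last digit of a sum or difference. -/
def parity (a b c : Bool) : Bool := a ^^ b ^^ c

theorem add_eq_serial (m n : ℕ) : m + n = ofDigits
    ((serial parity majority m.bits n.bits).1 ::
      (serial parity majority m.bits n.bits).2).reverse := by
  obtain ⟨h1, h2⟩ := serial_spec (d := parity) (r := majority) (ε := 1) (by decide) m.bits n.bits
  rw [List.reverse_cons, ofDigits_append, List.length_reverse, h2, ofDigits_cons]
  rw [ofDigits_bits, ofDigits_bits] at h1
  zify
  simpa [ofDigits] using h1

theorem sub_serial (m n : ℕ) : (serial parity borrow m.bits n.bits).1 = decide (m < n) ∧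
    (n ≤ m → m - n = ofDigits (serial parity borrow m.bits n.bits).2.reverse) := by
  obtain ⟨h1, h2⟩ := serial_spec (d := parity) (r := borrow) (ε := -1) (by decide) m.bits n.bits
  have h3 := ofDigits_lt (serial parity borrow m.bits n.bits).2.reverse
  rw [List.length_reverse, h2] at h3
  rw [ofDigits_bits, ofDigits_bits] at h1
  zify at h3
  cases h : (serial parity borrow m.bits n.bits).1
  · simp [h] at h1
    refine ⟨?_, ?_⟩
    · symm; simp; omega
    · omega
  · simp [h] at h1
    refine ⟨?_, ?_⟩
    · symm; simp; omega
    · omega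

namespace PolyFun

variable {α : Type} [Enc α]

theorem natAdd {f g : α → ℕ} (hf : PolyFun f) (hg : PolyFun g) : PolyFun fun x => f x + g x := by
  have h := serial parity majority (bits hf) (bits hg)
  exact (ofDigits (reverse (cons (fst' h) (snd' h)))).congr fun x => add_eq_serial _ _

theorem natLt {f g : α → ℕ} (hf : PolyFun f) (hg : PolyFun g) :
    PolyFun fun x => decide (f x < g x) :=
  (fst' (serial parity borrow (bits hf) (bits hg))).congr fun _ => (sub_serial _ _).1.symm

theorem natSub {f g : α → ℕ} (hf : PolyFun f) (hg : PolyFun g) : PolyFun fun x => f x - g x := by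
  refine (cond (natLt hf hg) (const 0)
    (ofDigits (reverse (snd' (serial parity borrow (bits hf) (bits hg)))))).congr fun x => ?_
  split
  · rename_i h
    simp at h
    omega
  · rename_i h
    simp at h
    exact (sub_serial _ _).2 h

theorem natMul {f g : α → ℕ} (hf : PolyFun f) (hg : PolyFun g) : PolyFun fun x => f x * g x := by
  obtain ⟨q, hq⟩ := hg.esize_le
  have h1 : PolyFun fun p : α × Bool × ℕ => Nat.bit false p.2.2 := natBit (const false) (snd' snd)
  have h2 : PolyFun fun p : α × Bool × ℕ =>
      if p.2.1 then Nat.bit false p.2.2 + g p.1 else Nat.bit false p.2.2 :=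
    cond (fst' snd) (natAdd h1 (hg.comp fst)) h1
  have h3 : PolyFun fun x => (f x).bits.foldr
      (fun b n => if b then Nat.bit false n + g x else Nat.bit false n) 0 := by
    refine foldr
      (step := fun x (b : Bool) (n : ℕ) => if b then Nat.bit false n + g x else Nat.bit false n)
      (bits hf) (const 0) h2
      Nat.size size_le_esize (4 * .X + 1) (fun n => by simpa using esize_nat_le n)
      ⟨q + 2, fun x b n => ?_⟩
    have h1 := nat_size_bit_le false n
    have h2 := nat_size_add_le (Nat.bit false n) (g x)
    have h3 := (size_le_esize (g x)).trans
      ((hq x).trans (eval_mono q (Nat.le_add_right _ (esize b))))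
    rw [Polynomial.eval_add, Polynomial.eval_ofNat]
    split <;> omega
  refine h3.congr fun x => ?_
  have key : ∀ l : List Bool, ShortRational.ofDigits l * g x =
      l.foldr (fun b n => if b then Nat.bit false n + g x else Nat.bit false n) 0 := by
    intro l
    induction l with
    | nil => simp [ShortRational.ofDigits]
    | cons b l ih =>
      rw [ofDigits_cons, List.foldr_cons, ← ih]
      cases b <;> simp [Nat.bit_val] <;> ring
  rw [← key, ofDigits_bits]

theorem natIsZero {f : α → ℕ} (hf : PolyFun f) : PolyFun fun x => decide (f x = 0) :=
  (not (natLt (const 0) hf)).congr fun x => by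
    rcases Nat.eq_zero_or_pos (f x) with h | h
    · simp [h]
    · simp [h, h.ne']

theorem natDiv2 {f : α → ℕ} (hf : PolyFun f) : PolyFun fun x => (f x).div2 :=
  (tail (bits hf)).of_enc_eq fun x => congrArg enc (Nat.div2_bits_eq_tail (f x))

theorem natBodd {f : α → ℕ} (hf : PolyFun f) : PolyFun fun x => (f x).bodd :=
  (headD (bits hf) (const false)).congr fun x => by
    rw [Nat.bodd_eq_bits_head]
    cases (f x).bits <;> rfl

end PolyFun

/-! ### Integers -/

instance : Enc ℤ := ⟨fun z => enc (decide (z < 0), z.natAbs)⟩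

/-- The integer with a given sign and absolute value. -/
def ofSign (b : Bool) (n : ℕ) : ℤ :=
  if b then -n else n

theorem ofSign_natAbs (z : ℤ) : ofSign (decide (z < 0)) z.natAbs = z := by
  unfold ofSign
  split <;> rename_i h <;> simp at h <;> omega

namespace PolyFun

variable {α : Type} [Enc α] {f g : α → ℤ}

theorem natAbs (hf : PolyFun f) : PolyFun fun x => (f x).natAbs :=
  snd.comp (hf.of_enc_eq (g := fun x => (decide (f x < 0), (f x).natAbs)) fun _ => rfl)

theorem isNeg (hf : PolyFun f) : PolyFun fun x => decide (f x < 0) :=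
  fst.comp (hf.of_enc_eq (g := fun x => (decide (f x < 0), (f x).natAbs)) fun _ => rfl)

theorem ofSign {b : α → Bool} {n : α → ℕ} (hb : PolyFun b) (hn : PolyFun n) :
    PolyFun fun x => ofSign (b x) (n x) := by
  refine (pair (and hb (not (natIsZero hn))) hn).of_enc_eq fun x => ?_
  change enc (decide (ShortRational.ofSign (b x) (n x) < 0),
    (ShortRational.ofSign (b x) (n x)).natAbs) = _
  unfold ShortRational.ofSign
  cases b x <;> rcases Nat.eq_zero_or_pos (n x) with h | h <;> simp [h]
  · rw [decide_eq_false (by omega)]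
  · simp [h.ne']

theorem isZero (hf : PolyFun f) : PolyFun fun x => decide (f x = 0) :=
  (natIsZero (natAbs hf)).congr fun x => by simp

theorem neg (hf : PolyFun f) : PolyFun fun x => -f x :=
  (ofSign (not (isNeg hf)) (natAbs hf)).congr fun x => by
    unfold ShortRational.ofSign
    rcases lt_or_ge (f x) 0 with h | h
    · simp [h, -Nat.cast_natAbs]; omega
    · simp [not_lt.2 h, -Nat.cast_natAbs]; omega

theorem mul (hf : PolyFun f) (hg : PolyFun g) : PolyFun fun x => f x * g x :=
  (ofSign (cond (isNeg hf) (not (isNeg hg)) (isNeg hg)) (natMul (natAbs hf) (natAbs hg))).congr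
    fun x => by
      conv_lhs => rw [← ofSign_natAbs (f x), ← ofSign_natAbs (g x)]
      unfold ShortRational.ofSign
      cases decide (f x < 0) <;> cases decide (g x < 0) <;> simp [-Nat.cast_natAbs]

theorem add (hf : PolyFun f) (hg : PolyFun g) : PolyFun fun x => f x + g x := by
  have hs := isNeg hf
  have ht := isNeg hg
  have hm := natAbs hf
  have hn := natAbs hg
  refine (cond (cond hs ht (not ht)) (ofSign hs (natAdd hm hn))
    (cond (natLt hm hn) (ofSign ht (natSub hn hm)) (ofSign hs (natSub hm hn)))).congr fun x => ?_
  rcases lt_or_ge (f x) 0 with h | h <;> rcases lt_or_ge (g x) 0 with h' | h' <;>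
    simp [h, h', not_lt.2, ShortRational.ofSign, -Nat.cast_natAbs] <;> (try split) <;> omega

end PolyFun

theorem size_natAbs_le_esize (z : ℤ) : z.natAbs.size ≤ esize z := by
  change _ ≤ esize (decide (z < 0), z.natAbs)
  rw [esize_pair]
  have := size_le_esize z.natAbs
  omega

theorem esize_int_le (z : ℤ) : esize z ≤ 4 * z.natAbs.size + 5 := by
  change esize (decide (z < 0), z.natAbs) ≤ _
  rw [esize_pair]
  have := esize_nat_le z.natAbs
  have := esize_bool_le (decide (z < 0))
  omega

/-! ### Words as values -/

/-- The symbols, in the order of their unary codes. -/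
def symbols : List Γ' :=
  [.comma, .bra, .ket, .bit false, .bit true, .blank]

/-- The unary code of a symbol. -/
def symbolCode (s : Γ') : List Unit :=
  .replicate (symbols.idxOf s) ()

instance : Enc Γ' := ⟨fun s => enc (symbolCode s)⟩

theorem esize_symbol_le (s : Γ') : esize s ≤ 11 := by
  change esize (symbolCode s) ≤ 11
  revert s
  have h : ∀ n, esize (List.replicate n ()) = 2 * n + 1 := by
    intro n
    induction n with
    | zero => rfl
    | succ n ih =>
      rw [List.replicate_succ, esize_cons, ih, show esize () = 1 from rfl]
      ring
  intro s
  rw [symbolCode, h]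
  rcases s with _ | (_ | _) | _ | _ | _ <;> decide

theorem esize_word_le (w : List Γ') : esize w ≤ 12 * w.length + 1 := by
  induction w with
  | nil => exact le_rfl
  | cons s w ih =>
    have := esize_symbol_le s
    rw [esize_cons, List.length_cons]
    omega

/-- Do nothing, except forgetting the symbol variable. -/
def skip : Prog :=
  .seq (.push .left fun _ => .blank) (.pop .left)

/-- Push a fixed word onto the main stack. -/
def pushWord : List Γ' → Prog
  | [] => skip
  | s :: u => .seq (pushWord u) (.push .main fun _ => s)

theorem exec_pushWord (u : List Γ') (v : Option Γ') (m a b : List Γ') :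
    ∃ v', Exec (pushWord u) ⟨v, m, a, b, []⟩ ⟨v', u ++ m, a, b, []⟩ (u.length + 2) := by
  induction u with
  | nil => exact ⟨_, Exec.cast (.seq (.push .left _ _) (.pop .left _)) rfl⟩
  | cons s u ih =>
    obtain ⟨v', h⟩ := ih
    exact ⟨_, Exec.cast (.seq h (.push .main _ _)) (by simp)⟩

/-- Perform the program that belongs to the symbol read last. -/
def caseSymbol (P : Γ' → Prog) : List Γ' → Prog
  | [] => skip
  | s :: l => .ite (fun v => v = some s) (P s) (caseSymbol P l)

theorem exec_caseSymbol {P : Γ' → Prog} {l : List Γ'} {s : Γ'} (hs : s ∈ l) {m a b c : List Γ'}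
    {m' : Mem} {t : ℕ} (h : Exec (P s) ⟨some s, m, a, b, c⟩ m' t) :
    ∃ t', t' ≤ t + l.length ∧ Exec (caseSymbol P l) ⟨some s, m, a, b, c⟩ m' t' := by
  induction l with
  | nil => simp at hs
  | cons s' l ih =>
    by_cases hss : s = s'
    · subst hss
      exact ⟨t + 1, by simp, .iteTrue (by simp) h⟩
    · obtain ⟨t', ht', h'⟩ := ih ((List.mem_cons.1 hs).resolve_left hss)
      exact ⟨t' + 1, by rw [List.length_cons]; omega, .iteFalse (by simp [hss]) h'⟩

theorem mem_symbols (s : Γ') : s ∈ symbols := by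
  rcases s with _ | (_ | _) | _ | _ | _ <;> simp [symbols]

/-- Read the input word from the stack `left`; it arrives on the main stack in reverse order. -/
def readInput : Prog :=
  .seq (.push .main fun _ => .bit false) (.seq (.pop .left) (.loop Option.isSome
    (.seq (caseSymbol (fun s => pushWord (.bit true :: (enc s).word)) symbols) (.pop .left))))

theorem exec_readInput (w : List Γ') : ∃ v t, t ≤ 22 * w.length + 3 ∧
    Exec readInput ⟨none, [], w, [], []⟩ ⟨v, (enc w.reverse).word, [], [], []⟩ t := by
  have key : ∀ (w r : List Γ'), ∃ v t, t ≤ 22 * w.length + 1 ∧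
      Exec (.loop Option.isSome
        (.seq (caseSymbol (fun s => pushWord (.bit true :: (enc s).word)) symbols) (.pop .left)))
        ⟨w.head?, (enc r).word, w.tail, [], []⟩ ⟨v, (enc (w.reverse ++ r)).word, [], [], []⟩ t := by
    intro w
    induction w with
    | nil => exact fun r => ⟨_, _, le_rfl, .loopFalse rfl⟩
    | cons s w ih =>
      intro r
      obtain ⟨v, t, ht, h⟩ := ih (s :: r)
      obtain ⟨v₁, h₁⟩ := exec_pushWord (.bit true :: (enc s).word) (some s) (enc r).word w []
      obtain ⟨t₂, ht₂, h₂⟩ := exec_caseSymbol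
        (P := fun s => pushWord (.bit true :: (enc s).word)) (mem_symbols s) h₁
      rw [List.reverse_cons, List.append_assoc]
      refine ⟨v, _, ?_, .loopTrue rfl (.seq h₂ (.pop .left _)) h⟩
      have := esize_symbol_le s
      rw [esize] at this
      rw [List.length_cons, BinTree.length_word] at ht₂
      simp only [symbols, List.length_cons, List.length_nil] at ht₂ ⊢
      omega
  obtain ⟨v, t, ht, h⟩ := key w []
  rw [List.append_nil] at h
  exact ⟨v, _, by omega, .seq (.push .main _ _) (.seq (.pop .left _) h)⟩

/-- Read the unary code of a symbol and write the symbol on the stack `right`. -/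
def writeSymbol : List Γ' → Prog
  | [] => skip
  | s :: l => .seq (.pop .main) (.ite (fun v => v = some (.bit false)) (.push .right fun _ => s)
    (.seq (.pop .main) (writeSymbol l)))

theorem exec_writeSymbol {l : List Γ'} {s : Γ'} (hs : s ∈ l) (v : Option Γ') (m b : List Γ') :
    ∃ v' t, t ≤ 4 * l.length ∧
      Exec (writeSymbol l) ⟨v, (enc (List.replicate (l.idxOf s) ())).word ++ m, [], b, []⟩
        ⟨v', m, [], s :: b, []⟩ t := by
  induction l generalizing v with
  | nil => simp at hs
  | cons s' l ih =>
    by_cases hss : s' = s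
    · subst hss
      rw [List.idxOf_cons_self]
      exact ⟨_, 3, by simp; omega, .seq (.pop .main _) (.iteTrue rfl (.push .right _ _))⟩
    · obtain ⟨v', t', ht', h'⟩ := ih ((List.mem_cons.1 hs).resolve_left (Ne.symm hss))
        (some (.bit false))
      rw [List.idxOf_cons_ne _ hss, List.replicate_succ, enc_cons, BinTree.word_cons_append]
      exact ⟨_, _, by simp; omega, .seq (.pop .main _) (.iteFalse rfl (.seq (.pop .main _) h'))⟩

/-- Write the word on the main stack to the stack `right`, in reverse order. -/
def writeOutput : Prog :=
  .seq (.pop .main) (.loop (fun v => v = some (.bit true))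
    (.seq (writeSymbol symbols) (.pop .main)))

theorem exec_writeOutput (w : List Γ') (v : Option Γ') : ∃ v' t, t ≤ 26 * w.length + 2 ∧
    Exec writeOutput ⟨v, (enc w).word, [], [], []⟩ ⟨v', [], [], w.reverse, []⟩ t := by
  have key : ∀ w b : List Γ', ∃ v' t, t ≤ 26 * w.length + 1 ∧
      Exec (.loop (fun v => v = some (.bit true)) (.seq (writeSymbol symbols) (.pop .main)))
        ⟨(enc w).word.head?, (enc w).word.tail, [], b, []⟩ ⟨v', [], [], w.reverse ++ b, []⟩ t := by
    intro w
    induction w with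
    | nil => exact fun b => ⟨_, _, le_rfl, .loopFalse rfl⟩
    | cons s w ih =>
      intro b
      obtain ⟨v', t, ht, h⟩ := ih (s :: b)
      obtain ⟨v₁, t₁, ht₁, h₁⟩ := exec_writeSymbol (mem_symbols s) (some (.bit true)) (enc w).word b
      rw [List.reverse_cons, List.append_assoc]
      refine ⟨v', _, ?_, .loopTrue rfl (.seq h₁ (.pop .main _)) h⟩
      simp only [symbols, List.length_cons, List.length_nil] at ht₁ ⊢
      omega
  obtain ⟨v', t, ht, h⟩ := key w []
  rw [List.append_nil] at h
  exact ⟨v', _, by omega, .seq (.pop .main _) h⟩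

theorem BinTree.stackWord_singleton (x : BinTree) : stackWord [x] ++ [] = x.word := by
  simp [stackWord]

/-- If the elements of a type are represented by words, then a polynomial-time function from this
type to words is computed by a Turing machine in polynomial time. -/
theorem PolyFun.computableInPolyTime {α β : Type} [Enc α] {ea : α → List Γ'} {eb : β → List Γ'}
    {f : α → β} (hea : ∀ a, enc a = enc (ea a)) (hf : PolyFun fun a => eb (f a)) :
    Nonempty (Turing.TM2ComputableInPolyTime ea eb f) := by
  obtain ⟨qs, hs⟩ := hf.esize_le
  obtain ⟨p₁, q₁, h₁⟩ := PolyFun.reverse (PolyFun.id (α := List Γ'))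
  obtain ⟨p₂, q₂, h₂⟩ := PolyFun.reverse hf
  refine Prog.computableInPolyTime (.seq readInput (.seq p₁ (.seq p₂ writeOutput)))
    (22 * .X + 3 + (q₁.comp (12 * .X + 1) + (q₂.comp (12 * .X + 1) +
      (26 * qs.comp (12 * .X + 1) + 2)))) fun a => ?_
  obtain ⟨v₀, t₀, ht₀, h₀⟩ := exec_readInput (ea a)
  obtain ⟨v₁, t₁, ht₁, h₁⟩ := h₁ (ea a).reverse v₀ [] [] []
  obtain ⟨v₂, t₂, ht₂, h₂⟩ := h₂ a v₁ [] [] []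
  obtain ⟨v₃, t₃, ht₃, h₃⟩ := exec_writeOutput (eb (f a)).reverse v₂
  simp only [List.reverse_reverse, ← hea, BinTree.stackWord_singleton] at h₁ h₂
  rw [List.reverse_reverse] at h₃
  refine ⟨_, _, ?_, .seq h₀ (.seq h₁ (.seq h₂ h₃))⟩
  have e₁ := esize_word_le (ea a).reverse
  have e₂ : esize a ≤ 12 * (ea a).length + 1 := by
    rw [esize, hea]
    exact esize_word_le (ea a)
  have e₃ := (length_le_esize (eb (f a))).trans ((hs a).trans (eval_mono qs e₂))
  have e₄ := ht₂.trans (eval_mono q₂ e₂)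
  rw [List.length_reverse] at e₁ ht₃
  have e₅ := ht₁.trans (eval_mono q₁ e₁)
  simp only [Polynomial.eval_add, Polynomial.eval_mul, Polynomial.eval_X, Polynomial.eval_ofNat,
    Polynomial.eval_one, Polynomial.eval_comp]
  omega

namespace PolyFun

variable {α : Type} [Enc α]

theorem lengthEq {β : Type} [Enc β] {l : α → List β} (hl : PolyFun l) (n : ℕ) :
    PolyFun fun x => decide ((l x).length = n) := by
  induction n generalizing l with
  | zero => exact (isEmpty hl).congr fun x => by cases l x <;> rfl
  | succ n ih =>
    refine (cond (isEmpty hl) (const false) (ih (tail hl))).congr fun x => ?_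
    cases l x with
    | nil => rfl
    | cons y t => exact decide_eq_decide.2 Nat.succ_inj

theorem symbolEq {f : α → Γ'} (hf : PolyFun f) (s : Γ') : PolyFun fun x => decide (f x = s) := by
  refine (lengthEq (l := fun x => symbolCode (f x)) (hf.of_enc_eq fun _ => rfl)
    (symbols.idxOf s)).congr fun x => ?_
  rw [symbolCode, List.length_replicate]
  congr 1
  rw [List.idxOf_inj (mem_symbols _)]

end PolyFun

/-! ### Reading instances -/

theorem encodePosNum_eq_bits (p : PosNum) : Computability.encodePosNum p = (p : ℕ).bits := by
  induction p with
  | one => simp [Computability.encodePosNum]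
  | bit1 p ih =>
    rw [Computability.encodePosNum, ih, PosNum.cast_bit1, ← two_mul, Nat.bit1_bits]
  | bit0 p ih =>
    rw [Computability.encodePosNum, ih, PosNum.cast_bit0, ← two_mul, Nat.bit0_bits _ p.cast_pos.ne']

theorem encodeNat_eq_bits (n : ℕ) : Computability.encodeNat n = n.bits := by
  rw [Computability.encodeNat]
  conv_rhs => rw [← Num.to_of_nat n]
  cases (n : Num) with
  | zero => simp [Computability.encodeNum]
  | pos p => exact encodePosNum_eq_bits p

/-- One step of the parser, which reads a word from right to left. Its state is the stack of the
lists that are currently open, the innermost one first; the members read so far are trees, and an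
integer is the list of its symbols. -/
def parseStep (s : Γ') (t : List (List BinTree)) : List (List BinTree) :=
  if s = .ket then [] :: t
  else if s = .comma then (.nil :: t.headD []) :: t.tail
  else if s = .bra then (enc (t.headD []) :: t.tail.headD []) :: t.tail.tail
  else (.cons (enc (decide (s = .bit true))) ((t.headD []).headD .nil) :: (t.headD []).tail) ::
    t.tail

/-- The list of trees that a word represents. -/
def parse (w : List Γ') : List BinTree :=
  (w.foldr parseStep [[]]).headD []

theorem esize_headD_tail {α : Type} [Enc α] (l : List α) (x : α) :
    esize (l.headD x) + esize l.tail ≤ esize l + esize x := by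
  cases l with
  | nil => rw [List.headD_nil, List.tail_nil, Nat.add_comm]
  | cons y l => rw [List.headD_cons, List.tail_cons, esize_cons]; omega

theorem PolyFun.parse {α : Type} [Enc α] {f : α → List Γ'} (hf : PolyFun f) :
    PolyFun fun x => parse (f x) := by
  have h : PolyFun fun p : α × Γ' × List (List BinTree) => parseStep p.2.1 p.2.2 := by
    have hs : PolyFun fun p : α × Γ' × List (List BinTree) => p.2.1 := fst' snd
    have ht : PolyFun fun p : α × Γ' × List (List BinTree) => p.2.2 := snd' snd
    have hd := headD ht (const [])
    refine (cond (symbolEq hs .ket) (cons (const []) ht) (cond (symbolEq hs .comma)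
      (cons (cons (const .nil) hd) (tail ht)) (cond (symbolEq hs .bra)
      (cons (cons (hd.of_enc_eq (g := fun p => enc (p.2.2.headD [])) fun _ => rfl)
        (headD (tail ht) (const []))) (tail (tail ht)))
      (cons (cons ((pair (symbolEq hs (.bit true)) (headD hd (const .nil))).of_enc_eq
        (g := fun p => .cons (enc (decide (p.2.1 = .bit true))) ((p.2.2.headD []).headD .nil))
        fun _ => rfl) (tail hd)) (tail ht))))).congr fun p => ?_
    simp only [parseStep, decide_eq_true_eq]
  refine headD (foldr (step := fun _ => parseStep) hf (const [[]]) h esize (fun _ => le_rfl) .X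
    (fun _ => by simp) ⟨20, fun x s t => ?_⟩) (const [])
  have h1 := esize_headD_tail t []
  have h2 := esize_headD_tail t.tail []
  have h3 := esize_headD_tail (t.headD []) .nil
  have h4 := esize_bool_le (decide (s = .bit true))
  have h5 : esize (BinTree.nil) = 1 := rfl
  have h6 : ∀ l : List BinTree, esize (enc l) = esize l := fun _ => rfl
  have h7 : ∀ (b : Bool) (a : BinTree), esize (BinTree.cons (enc b) a) = esize b + esize a + 1 :=
    fun _ _ => rfl
  simp only [esize_nil] at h1 h2 h3
  unfold parseStep
  rw [Polynomial.eval_ofNat]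
  split_ifs <;> simp only [esize_cons, esize_nil, h5, h6, h7] <;> omega

/-- The word `w` represents the sequence `xs` of trees. -/
def Parses (w : List Γ') (xs : List BinTree) : Prop :=
  ∀ l t, w.foldr parseStep (l :: t) = (xs ++ l) :: t

theorem Parses.parse_eq {w : List Γ'} {xs : List BinTree} (h : Parses w xs) : parse w = xs := by
  rw [parse, h, List.headD_cons, List.append_nil]

theorem Parses.append {w w' : List Γ'} {xs ys : List BinTree} (h : Parses w xs)
    (h' : Parses w' ys) : Parses (w ++ w') (xs ++ ys) := fun l t => by
  rw [List.foldr_append, h', h, List.append_assoc]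

theorem Parses.flatMap {α : Type} {e : α → List Γ'} {g : α → BinTree} (h : ∀ x, Parses (e x) [g x])
    (l : List α) : Parses (l.flatMap e) (l.map g) := by
  induction l with
  | nil => exact fun _ _ => rfl
  | cons x l ih => exact (h x).append ih

theorem enc_map {α β : Type} [Enc β] (g : α → β) (l : List α) :
    enc (l.map g) = .ofList (l.map fun x => enc (g x)) :=
  congrArg BinTree.ofList List.map_map

theorem Parses.bracket {w : List Γ'} {xs : List BinTree} (h : Parses w xs) :
    Parses (.bra :: (w ++ [.ket])) [.ofList xs] := fun l t => by
  rw [List.foldr_cons, List.foldr_append]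
  have hk : [Γ'.ket].foldr parseStep (l :: t) = [] :: l :: t := by simp [parseStep]
  rw [hk, h]
  simp [parseStep, enc]

theorem parses_bits (u : List Bool) : Parses (u.map Γ'.bit ++ [.comma]) [enc u] := fun l t => by
  rw [List.foldr_append]
  induction u with
  | nil => simp [parseStep, enc, BinTree.ofList]
  | cons b u ih =>
    rw [List.map_cons, List.foldr_cons, ih]
    cases b <;> simp [parseStep, enc, BinTree.ofList]

theorem parses_encodeInt (a : ℤ) : Parses (encodeInt a) [enc a] := by
  rw [encodeInt, encodeNat_eq_bits]
  exact parses_bits (decide (a < 0) :: a.natAbs.bits)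

theorem parses_encodeVec {d : ℕ} (v : Fin d → ℤ) :
    Parses (encodeVec v) [enc (List.ofFn v)] :=
  (Parses.flatMap parses_encodeInt _).bracket

theorem parses_encodeVecs {m d : ℕ} (v : Fin m → Fin d → ℤ) :
    Parses (encodeVecs v) [enc ((List.ofFn v).map List.ofFn)] := by
  have := (Parses.flatMap (parses_encodeVec (d := d)) (List.ofFn v)).bracket
  rwa [← enc_map] at this

/-- A fraction as data for programs: the numerator and the denominator of the coefficient, the
exponent vector of the numerator and those of the denominator. -/
abbrev RawFraction : Type := ℤ × ℤ × List ℤ × List (List ℤ) × Unit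

/-- An instance as data for programs; the two numbers of variables are in unary. -/
abbrev RawInstance : Type := List Bool × List Bool × List RawFraction × List (List ℤ) × Unit

/-- The data of a fraction. -/
def Fraction.toRaw {d k : ℕ} (t : Fraction d k) : RawFraction :=
  (t.coeff.num, t.coeff.den, .ofFn t.num, (List.ofFn t.den).map .ofFn, ())

/-- The data of an instance. -/
def Instance.toRaw {k : ℕ} (I : Instance k) : RawInstance :=
  (.replicate I.d true, .replicate I.n true, I.f.map Fraction.toRaw, (List.ofFn I.l).map .ofFn, ())

theorem parses_fraction {d k : ℕ} (t : Fraction d k) : Parses t.encode [enc t.toRaw] :=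
  ((((parses_encodeInt t.coeff.num).append (parses_encodeInt t.coeff.den)).append
    (parses_encodeVec t.num)).append (parses_encodeVecs t.den)).bracket

theorem parses_formula {d k : ℕ} (f : Formula d k) :
    Parses (Formula.encode f) [enc (f.map Fraction.toRaw)] := by
  have := (Parses.flatMap (parses_fraction (d := d) (k := k)) f).bracket
  rwa [← enc_map] at this

theorem parses_encodeUnary (m : ℕ) : Parses (encodeUnary m) [enc (List.replicate m true)] := by
  have := parses_bits (.replicate m true)
  rwa [List.map_replicate] at this

theorem enc_parse_instance {k : ℕ} (I : Instance k) : enc (parse I.encode) = enc I.toRaw := by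
  have := (((parses_encodeUnary I.d).append (parses_encodeUnary I.n)).append
    (parses_formula I.f)).append (parses_encodeVecs I.l)
  rw [← Instance.encode] at this
  rw [this.parse_eq]
  rfl

instance {k : ℕ} : Enc {I : Instance k // I.Admissible} := ⟨fun I => enc I.1.encode⟩

theorem PolyFun.toRaw {k : ℕ} : PolyFun fun I : {I : Instance k // I.Admissible} => I.1.toRaw :=
  (parse (retype (f := fun I : {I : Instance k // I.Admissible} => I.1.encode)
    fun _ => rfl)).of_enc_eq fun I => (enc_parse_instance I.1).symm

/-! ### Writing formulas -/

/-- The word for a vector, given as a list. -/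
def writeVec (v : List ℤ) : List Γ' :=
  .bra :: (v.flatMap encodeInt ++ [.ket])

/-- The word for a sequence of vectors. -/
def writeVecs (v : List (List ℤ)) : List Γ' :=
  .bra :: (v.flatMap writeVec ++ [.ket])

/-- The word for a fraction. -/
def writeFraction (t : RawFraction) : List Γ' :=
  .bra :: (encodeInt t.1 ++ encodeInt t.2.1 ++ writeVec t.2.2.1 ++ writeVecs t.2.2.2.1 ++ [.ket])

/-- The word for a formula. -/
def writeFormula (f : List RawFraction) : List Γ' :=
  .bra :: (f.flatMap writeFraction ++ [.ket])

namespace PolyFun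

variable {α : Type} [Enc α]

theorem encodeInt {f : α → ℤ} (hf : PolyFun f) : PolyFun fun x => encodeInt (f x) := by
  have hb : PolyFun (Γ'.bit : Bool → Γ') :=
    (cond id (const (.bit true)) (const (.bit false))).congr fun b => by cases b <;> rfl
  refine (cons (hb.comp (isNeg hf)) (append (map (g := fun _ => Γ'.bit) (bits (natAbs hf))
    (hb.comp snd)) (const [.comma]))).congr fun x => ?_
  rw [ShortRational.encodeInt, encodeNat_eq_bits]

theorem writeVec {f : α → List ℤ} (hf : PolyFun f) : PolyFun fun x => writeVec (f x) :=
  cons (const _) (append (flatMap (g := fun _ => ShortRational.encodeInt) hf (encodeInt snd))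
    (const _))

theorem writeVecs {f : α → List (List ℤ)} (hf : PolyFun f) : PolyFun fun x => writeVecs (f x) :=
  cons (const _) (append (flatMap (g := fun _ => ShortRational.writeVec) hf (writeVec snd))
    (const _))

theorem writeFraction {f : α → RawFraction} (hf : PolyFun f) :
    PolyFun fun x => writeFraction (f x) :=
  cons (const _) (append (append (append (append (encodeInt (fst' hf)) (encodeInt (fst' (snd' hf))))
    (writeVec (fst' (snd' (snd' hf))))) (writeVecs (fst' (snd' (snd' (snd' hf)))))) (const _))

theorem writeFormula {f : α → List RawFraction} (hf : PolyFun f) :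
    PolyFun fun x => writeFormula (f x) :=
  cons (const _) (append (flatMap (g := fun _ => ShortRational.writeFraction) hf
    (writeFraction snd)) (const _))

end PolyFun

theorem writeVecs_ofFn {m n : ℕ} (v : Fin m → Fin n → ℤ) :
    writeVecs ((List.ofFn v).map List.ofFn) = encodeVecs v := by
  rw [writeVecs, encodeVecs, List.flatMap_map]
  rfl

theorem writeFormula_toRaw {n s : ℕ} (f : Formula n s) :
    writeFormula (f.map Fraction.toRaw) = Formula.encode f := by
  rw [writeFormula, Formula.encode, List.flatMap_map]
  congr 4
  funext t
  rw [writeFraction, Fraction.toRaw, Fraction.encode, writeVecs_ofFn]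
  rfl

/-! ### Values of rational functions under homomorphisms -/

/-- The extension of a homomorphism `φ` from a domain to a field, as a relation: a fraction that
can be written with a denominator outside the kernel of `φ` has a value. -/
def Val {R L : Type*} [CommRing R] [IsDomain R] [Field L] (φ : R →+* L) (f : FractionRing R)
    (y : L) : Prop :=
  ∃ P Q : R, φ Q ≠ 0 ∧ f = algebraMap _ (FractionRing R) P / algebraMap _ (FractionRing R) Q ∧
    y = φ P / φ Q

namespace Val

theorem algebraMap_ne_zero {R L : Type*} [CommRing R] [Field L] {φ : R →+* L} {Q : R}
    (h : φ Q ≠ 0) : algebraMap R (FractionRing R) Q ≠ 0 := fun h0 => by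
  rw [IsFractionRing.to_map_eq_zero_iff] at h0
  exact h (by rw [h0, map_zero])

variable {R L : Type*} [CommRing R] [IsDomain R] [Field L] {φ : R →+* L}

theorem unique {f : FractionRing R} {y y' : L} (h : Val φ f y) (h' : Val φ f y') : y = y' := by
  obtain ⟨P, Q, hQ, hf, rfl⟩ := h
  obtain ⟨P', Q', hQ', hf', rfl⟩ := h'
  rw [hf, div_eq_div_iff (algebraMap_ne_zero hQ) (algebraMap_ne_zero hQ'), ← map_mul,
    ← map_mul] at hf'
  have := congrArg φ (IsFractionRing.injective R (FractionRing R) hf')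
  rw [div_eq_div_iff hQ hQ', ← map_mul, ← map_mul, this]

theorem of_algebraMap (P : R) : Val φ (algebraMap R (FractionRing R) P) (φ P) :=
  ⟨P, 1, by simp, by simp, by simp⟩

theorem zero : Val φ 0 0 := by
  simpa using of_algebraMap (φ := φ) 0

theorem one : Val φ 1 1 := by
  simpa using of_algebraMap (φ := φ) 1

theorem add {f g : FractionRing R} {y z : L} (h : Val φ f y) (h' : Val φ g z) :
    Val φ (f + g) (y + z) := by
  obtain ⟨P, Q, hQ, rfl, rfl⟩ := h
  obtain ⟨P', Q', hQ', rfl, rfl⟩ := h'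
  refine ⟨P * Q' + Q * P', Q * Q', by rw [map_mul]; exact mul_ne_zero hQ hQ', ?_, ?_⟩
  · rw [div_add_div _ _ (algebraMap_ne_zero hQ) (algebraMap_ne_zero hQ')]
    simp
  · rw [div_add_div _ _ hQ hQ']
    simp

theorem mul {f g : FractionRing R} {y z : L} (h : Val φ f y) (h' : Val φ g z) :
    Val φ (f * g) (y * z) := by
  obtain ⟨P, Q, hQ, rfl, rfl⟩ := h
  obtain ⟨P', Q', hQ', rfl, rfl⟩ := h'
  refine ⟨P * P', Q * Q', by rw [map_mul]; exact mul_ne_zero hQ hQ', ?_, ?_⟩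
  · rw [div_mul_div_comm]
    simp
  · rw [div_mul_div_comm]
    simp

theorem neg {f : FractionRing R} {y : L} (h : Val φ f y) : Val φ (-f) (-y) := by
  have := (of_algebraMap (φ := φ) (-1)).mul h
  simpa using this

theorem sub {f g : FractionRing R} {y z : L} (h : Val φ f y) (h' : Val φ g z) :
    Val φ (f - g) (y - z) := by
  rw [sub_eq_add_neg, sub_eq_add_neg]
  exact h.add h'.neg

theorem inv {f : FractionRing R} {y : L} (h : Val φ f y) (hy : y ≠ 0) : Val φ f⁻¹ y⁻¹ := by
  obtain ⟨P, Q, hQ, rfl, rfl⟩ := h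
  exact ⟨Q, P, fun h => hy (by rw [h, zero_div]), inv_div _ _, inv_div _ _⟩

theorem div {f g : FractionRing R} {y z : L} (h : Val φ f y) (h' : Val φ g z) (hz : z ≠ 0) :
    Val φ (f / g) (y / z) := by
  rw [div_eq_mul_inv, div_eq_mul_inv]
  exact h.mul (h'.inv hz)

theorem pow {f : FractionRing R} {y : L} (h : Val φ f y) (m : ℕ) : Val φ (f ^ m) (y ^ m) := by
  induction m with
  | zero => simpa using one
  | succ m ih => rw [pow_succ, pow_succ]; exact ih.mul h

theorem zpow {f : FractionRing R} {y : L} (h : Val φ f y) {m : ℤ} (hm : m < 0 → y ≠ 0) :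
    Val φ (f ^ m) (y ^ m) := by
  cases m with
  | ofNat m => simpa using h.pow m
  | negSucc m =>
    rw [zpow_negSucc, zpow_negSucc]
    exact (h.pow _).inv (pow_ne_zero _ (hm (Int.negSucc_lt_zero m)))

theorem prod {ι : Type*} (s : Finset ι) {f : ι → FractionRing R} {y : ι → L}
    (h : ∀ i ∈ s, Val φ (f i) (y i)) : Val φ (∏ i ∈ s, f i) (∏ i ∈ s, y i) := by
  classical
  induction s using Finset.induction_on with
  | empty => simpa using one
  | insert i s hi ih =>
    rw [Finset.prod_insert hi, Finset.prod_insert hi]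
    exact (h i (Finset.mem_insert_self i s)).mul
      (ih fun j hj => h j (Finset.mem_insert_of_mem hj))

theorem list_sum {ι : Type*} (l : List ι) {f : ι → FractionRing R} {y : ι → L}
    (h : ∀ i ∈ l, Val φ (f i) (y i)) : Val φ (l.map f).sum (l.map y).sum := by
  induction l with
  | nil => simpa using zero
  | cons i l ih =>
    rw [List.map_cons, List.map_cons, List.sum_cons, List.sum_cons]
    exact (h i List.mem_cons_self).add (ih fun j hj => h j (List.mem_cons_of_mem _ hj))

theorem ratCast [CharZero R] [CharZero L] (q : ℚ) : Val φ (q : FractionRing R) (q : L) :=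
  ⟨q.num, q.den, by simp, by simp [Rat.cast_def], by simp [Rat.cast_def]⟩

end Val

/-! ### Laurent monomials -/

section

variable {n : ℕ}

theorem monomial_zero : monomial (0 : Fin n → ℤ) = 1 := by
  simp [monomial]

theorem X_ne_zero (i : Fin n) :
    algebraMap _ (RatFun n) (MvPolynomial.X i : MvPolynomial (Fin n) ℂ) ≠ 0 := by
  rw [Ne, IsFractionRing.to_map_eq_zero_iff]
  exact MvPolynomial.X_ne_zero i

theorem monomial_add (p q : Fin n → ℤ) : monomial (p + q) = monomial p * monomial q := by
  simp only [monomial, ← Finset.prod_mul_distrib, Pi.add_apply]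
  exact Finset.prod_congr rfl fun i _ => zpow_add₀ (X_ne_zero i) _ _

theorem monomial_ne_zero (p : Fin n → ℤ) : monomial p ≠ 0 :=
  Finset.prod_ne_zero_iff.2 fun i _ => zpow_ne_zero _ (X_ne_zero i)

/-- The value of a Laurent monomial. -/
theorem hasValueAt_monomial {p : Fin n → ℤ} {z : Fin n → ℂ} (h : ∀ j, p j < 0 → z j ≠ 0) :
    HasValueAt (monomial p) z (∏ j, z j ^ p j) :=
  Val.prod (φ := MvPolynomial.eval z) _ fun j _ => by
    have := Val.of_algebraMap (φ := MvPolynomial.eval z) (MvPolynomial.X j)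
    rw [MvPolynomial.eval_X] at this
    exact this.zpow (h j)

theorem one_sub_monomial_ne_zero {p : Fin n → ℤ} (hp : p ≠ 0) : 1 - monomial p ≠ 0 := by
  obtain ⟨i, hi⟩ := Function.ne_iff.1 hp
  intro h
  -- the monomial takes a value other than `1` at a point with a single coordinate `2`
  have h1 := hasValueAt_monomial (p := p) (z := Function.update 1 i 2) (fun j _ => by
    rcases eq_or_ne j i with rfl | hj
    · simp
    · simp [hj])
  rw [← sub_eq_zero.1 h] at h1
  have h2 : Val (MvPolynomial.eval (Function.update 1 i 2 : Fin n → ℂ)) 1 _ := h1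
  replace h2 := h2.unique Val.one
  rw [Finset.prod_eq_single i (fun j _ hj => by simp [hj]) (by simp)] at h2
  rw [Function.update_self] at h2
  have h3 := congrArg norm h2
  rw [norm_zpow, norm_one] at h3
  rw [zpow_eq_one_iff_right₀ (norm_nonneg _) (by norm_num)] at h3
  exact hi h3

end

/-! ### Substitution of monomials by way of power series -/

open PowerSeries in
/-- The power series `u e^{cτ}` in the variable `τ`, for a Laurent monomial `u`. -/
def expMonomial {n : ℕ} (v : Fin n → ℤ) (c : ℤ) : (RatFun n)⟦X⟧ :=
  C (monomial v) * rescale (c : RatFun n) (exp (RatFun n))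

section

open PowerSeries

variable {d n k : ℕ}

theorem constantCoeff_expMonomial (v : Fin n → ℤ) (c : ℤ) :
    constantCoeff (expMonomial v c) = monomial v := by
  simp [expMonomial, ← coeff_zero_eq_constantCoeff_apply]

theorem expMonomial_zero : expMonomial (0 : Fin n → ℤ) 0 = 1 := by
  simp [expMonomial, monomial_zero]

theorem expMonomial_add (v w : Fin n → ℤ) (b c : ℤ) :
    expMonomial (v + w) (b + c) = expMonomial v b * expMonomial w c := by
  rw [expMonomial, expMonomial, expMonomial, monomial_add, Int.cast_add,
    ← exp_mul_exp_eq_exp_add, map_mul]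
  ring

theorem one_sub_expMonomial_ne_zero (v : Fin n → ℤ) {c : ℤ} (hc : c ≠ 0) :
    1 - expMonomial v c ≠ 0 := fun h => by
  have := congrArg (coeff 1) h
  simp [expMonomial, coeff_one, coeff_exp, monomial_ne_zero, hc] at this

/-- The homomorphism `(v, c) ↦ z^v e^{cτ}`. -/
def expHom (n : ℕ) : Multiplicative ((Fin n → ℤ) × ℤ) →* FractionRing (RatFun n)⟦X⟧ where
  toFun p := algebraMap _ _ (expMonomial p.toAdd.1 p.toAdd.2)
  map_one' := by simp [expMonomial_zero]
  map_mul' p q := by simp [expMonomial_add]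

/-- The linear map on exponent vectors that belongs to a monomial map. -/
def pullback (l : Fin d → Fin n → ℤ) (a : Fin d → ℤ) : Fin n → ℤ :=
  ∑ i, a i • l i

/-- The scalar product of integer vectors. -/
def pairing (w a : Fin d → ℤ) : ℤ :=
  ∑ i, a i * w i

/-- The substitution `x_i ↦ z^{l_i} e^{w_i τ}`. -/
def seriesHom (l : Fin d → Fin n → ℤ) (w : Fin d → ℤ) :
    MvPolynomial (Fin d) ℂ →+* (RatFun n)⟦X⟧ :=
  MvPolynomial.eval₂Hom (C.comp (algebraMap ℂ (RatFun n))) fun i => expMonomial (l i) (w i)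

/-- The substitution `x_i ↦ z^{l_i}`. -/
def monomialHom (l : Fin d → Fin n → ℤ) : MvPolynomial (Fin d) ℂ →+* RatFun n :=
  MvPolynomial.eval₂Hom (algebraMap ℂ (RatFun n)) fun i => monomial (l i)

theorem constantCoeff_seriesHom (l : Fin d → Fin n → ℤ) (w : Fin d → ℤ)
    (P : MvPolynomial (Fin d) ℂ) : constantCoeff (seriesHom l w P) = monomialHom l P := by
  have : (constantCoeff (R := RatFun n)).comp (seriesHom l w) = monomialHom l := by
    ext i
    · simp [seriesHom, monomialHom]
    · simp [seriesHom, monomialHom, constantCoeff_expMonomial]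
  exact congrArg (fun f : MvPolynomial (Fin d) ℂ →+* RatFun n => f P) this

theorem hasValueAt_monomialHom {l : Fin d → Fin n → ℤ} {z : Fin n → ℂ} (hz : DefinedAt l z)
    (P : MvPolynomial (Fin d) ℂ) :
    HasValueAt (monomialHom l P) z (MvPolynomial.eval (monomialMap l z) P) := by
  induction P using MvPolynomial.induction_on with
  | C a =>
    have := Val.of_algebraMap (φ := MvPolynomial.eval z) (MvPolynomial.C a)
    rw [MvPolynomial.eval_C] at this
    rw [monomialHom, MvPolynomial.coe_eval₂Hom, MvPolynomial.eval₂_C, MvPolynomial.eval_C,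
      IsScalarTower.algebraMap_apply ℂ (MvPolynomial (Fin n) ℂ) (RatFun n)]
    exact this
  | add p q hp hq =>
    rw [map_add, map_add]
    exact Val.add (φ := MvPolynomial.eval z) hp hq
  | mul_X p i hp =>
    rw [map_mul, map_mul, MvPolynomial.eval_X, monomialHom, MvPolynomial.eval₂Hom_X']
    exact Val.mul (φ := MvPolynomial.eval z) hp (hasValueAt_monomial (hz i))

/-- The value of a Laurent monomial under the substitution. -/
theorem val_monomial (l : Fin d → Fin n → ℤ) (w a : Fin d → ℤ) :
    Val ((algebraMap _ (FractionRing (RatFun n)⟦X⟧)).comp (seriesHom l w)) (monomial a)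
      (algebraMap _ _ (expMonomial (pullback l a) (pairing w a))) := by
  have h : algebraMap _ (FractionRing (RatFun n)⟦X⟧) (expMonomial (pullback l a) (pairing w a)) =
      ∏ i, (algebraMap _ (FractionRing (RatFun n)⟦X⟧) (expMonomial (l i) (w i))) ^ a i := by
    have h1 : ∀ v c, algebraMap _ (FractionRing (RatFun n)⟦X⟧) (expMonomial v c) =
      expHom n (Multiplicative.ofAdd (v, c)) := fun _ _ => rfl
    simp only [h1, ← map_zpow, ← map_prod]
    congr 1
    have h2 : (pullback l a, pairing w a) = ∑ i, a i • (l i, w i) := by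
      ext1 <;> simp [pullback, pairing, Prod.fst_sum, Prod.snd_sum]
    rw [h2, ofAdd_sum]
    rfl
  rw [h]
  refine Val.prod _ fun i _ => ?_
  have h1 := Val.of_algebraMap (φ := (algebraMap _ (FractionRing (RatFun n)⟦X⟧)).comp
    (seriesHom l w)) (MvPolynomial.X i)
  rw [RingHom.comp_apply, seriesHom, MvPolynomial.eval₂Hom_X'] at h1
  refine h1.zpow fun _ h0 => ?_
  rw [IsFractionRing.to_map_eq_zero_iff] at h0
  have := constantCoeff_expMonomial (l i) (w i)
  rw [h0, map_zero] at this
  exact monomial_ne_zero _ this.symm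

/-- Substitution of monomials into a formula: if `G t` is the power series `τ ^ k t(z^l e^{wτ})`
for each fraction `t` of the formula, then the sum of the coefficients of `τ ^ k` has the same
values as the formula. -/
theorem hasValueAt_sum_coeff {f : Formula d k} {l : Fin d → Fin n → ℤ} {w : Fin d → ℤ}
    {G : Fraction d k → (RatFun n)⟦X⟧} (hw : ∀ t ∈ f, ∀ j, pairing w (t.den j) ≠ 0)
    (hG : ∀ t ∈ f, G t * ∏ j, (1 - expMonomial (pullback l (t.den j)) (pairing w (t.den j))) =
      C (t.coeff : RatFun n) * expMonomial (pullback l t.num) (pairing w t.num) * X ^ k)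
    {z : Fin n → ℂ} (hz : DefinedAt l z) {y : ℂ}
    (h : HasValueAt f.toRatFun (monomialMap l z) y) :
    HasValueAt (f.map fun t => coeff k (G t)).sum z y := by
  obtain ⟨P, Q, hQ, hf, rfl⟩ := h
  set A : (RatFun n)⟦X⟧ →+* FractionRing (RatFun n)⟦X⟧ := algebraMap _ _ with hA
  have hinj : Function.Injective A := IsFractionRing.injective _ _
  have : CharZero (RatFun n)⟦X⟧ :=
    charZero_of_injective_ringHom (f := C) (PowerSeries.C_injective)
  have : CharZero (FractionRing (RatFun n)⟦X⟧) := charZero_of_injective_ringHom hinj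
  have h1 : ∀ t ∈ f, Val (A.comp (seriesHom l w)) t.toRatFun (A (G t) / A (X ^ k)) := by
    intro t ht
    have h0 : ∀ j, A (1 - expMonomial (pullback l (t.den j)) (pairing w (t.den j))) ≠ 0 :=
      fun j => by
        rw [Ne, map_eq_zero_iff A hinj]
        exact one_sub_expMonomial_ne_zero _ (hw t ht j)
    have h2 := ((Val.ratCast (φ := A.comp (seriesHom l w)) t.coeff).mul
      (val_monomial l w t.num)).div (Val.prod Finset.univ fun j _ =>
        Val.one.sub (val_monomial l w (t.den j))) (Finset.prod_ne_zero_iff.2 fun j _ => by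
          simpa using h0 j)
    rw [show A (G t) / A (X ^ k) = _ from ?_]
    · exact h2
    rw [div_eq_div_iff]
    · have h3 := congrArg A (hG t ht)
      simp only [map_mul, map_prod, map_sub, map_one] at h3
      rw [← map_ratCast (A.comp C) t.coeff]
      exact h3
    · rw [Ne, map_eq_zero_iff A hinj]
      exact pow_ne_zero _ PowerSeries.X_ne_zero
    · exact Finset.prod_ne_zero_iff.2 fun j _ => by simpa using h0 j
  -- both the sum of the fractions and the representation `P / Q` of `f` compute the value of `f`
  -- under the substitution of power series, where no denominator vanishes
  have h2 := Val.list_sum f h1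
  have hQ0 : monomialHom l Q ≠ 0 := fun h0 => by
    have h3 : Val (MvPolynomial.eval z) _ _ := hasValueAt_monomialHom hz Q
    rw [h0] at h3
    exact hQ (h3.unique Val.zero)
  have hQ1 : constantCoeff (seriesHom l w Q) ≠ 0 := by rwa [constantCoeff_seriesHom]
  have hQ2 : (A.comp (seriesHom l w)) Q ≠ 0 := by
    rw [RingHom.comp_apply, Ne, map_eq_zero_iff A hinj]
    rintro h0
    simp [h0] at hQ1
  have h3 : Val (A.comp (seriesHom l w)) f.toRatFun _ := ⟨P, Q, hQ2, hf, rfl⟩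
  have h4 := h2.unique h3
  have h5 : (f.map G).sum * seriesHom l w Q = seriesHom l w P * X ^ k := by
    apply hinj
    have h6 : (f.map fun t => A (G t) / A (X ^ k)).sum = A (f.map G).sum / A (X ^ k) := by
      simp only [div_eq_mul_inv]
      rw [List.sum_map_mul_right, map_list_sum, List.map_map]
      rfl
    rw [h6, div_eq_div_iff] at h4
    · rw [map_mul, map_mul]
      exact h4
    · rw [Ne, map_eq_zero_iff A hinj]
      exact pow_ne_zero _ PowerSeries.X_ne_zero
    · exact hQ2
  -- the constant coefficient of `Q` is invertible, so the comparison can be made for power series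
  have h6 : (f.map G).sum = seriesHom l w P * (seriesHom l w Q)⁻¹ * X ^ k := by
    rw [mul_right_comm, ← h5, mul_assoc, PowerSeries.mul_inv_cancel _ hQ1, mul_one]
  have h7 : (f.map fun t => coeff k (G t)).sum = monomialHom l P / monomialHom l Q := by
    have h8 : (f.map fun t => coeff k (G t)).sum = coeff k (f.map G).sum := by
      rw [map_list_sum, List.map_map]
      rfl
    rw [h8, h6, coeff_mul_X_pow', if_pos le_rfl, Nat.sub_self, coeff_zero_eq_constantCoeff_apply,
      map_mul, PowerSeries.constantCoeff_inv, constantCoeff_seriesHom, constantCoeff_seriesHom,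
      div_eq_mul_inv]
  rw [h7]
  exact Val.div (φ := MvPolynomial.eval z) (hasValueAt_monomialHom hz P)
    (hasValueAt_monomialHom hz Q) hQ

end

/-! ### Truncated expansions of the factors -/

section

open PowerSeries

variable {K : Type*} [Field K]

theorem rescale_C (c x : K) : rescale c (C x) = C x := by
  ext m
  rw [coeff_rescale, coeff_C]
  split <;> simp [*]

/-- Congruence of power series modulo `X ^ (k + 1)`. -/
def Cong (k : ℕ) (f g : K⟦X⟧) : Prop :=
  X ^ (k + 1) ∣ f - g

theorem Cong.refl (k : ℕ) (f : K⟦X⟧) : Cong k f f := by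
  rw [Cong, sub_self]
  exact dvd_zero _

theorem Cong.mul {k : ℕ} {f g f' g' : K⟦X⟧} (h : Cong k f g) (h' : Cong k f' g') :
    Cong k (f * f') (g * g') := by
  have : f * f' - g * g' = (f - g) * f' + g * (f' - g') := by ring
  rw [Cong, this]
  exact dvd_add (dvd_mul_of_dvd_left h _) (dvd_mul_of_dvd_right h' _)

theorem Cong.rescale {k : ℕ} {f g : K⟦X⟧} (h : Cong k f g) (c : K) :
    Cong k (rescale c f) (rescale c g) := by
  rw [Cong, X_pow_dvd_iff] at h ⊢
  intro m hm
  rw [← map_sub, coeff_rescale, h m hm, mul_zero]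

theorem Cong.coeff_eq {k : ℕ} {f g : K⟦X⟧} (h : Cong k f g) : coeff k f = coeff k g := by
  rw [Cong, X_pow_dvd_iff] at h
  rw [← sub_eq_zero, ← map_sub]
  exact h k k.lt_succ_self

theorem cong_iff {k : ℕ} {f g : K⟦X⟧} : Cong k f g ↔ ∀ m ≤ k, coeff m f = coeff m g := by
  rw [Cong, X_pow_dvd_iff]
  simp only [map_sub, sub_eq_zero, Nat.lt_succ_iff]

/-- A summand `α u^j (1 - u)^{-c} τ^m` of the expansion of a factor, as data for programs: the
numerator and the denominator of `α`, the degree `m` in unary, the exponent `j` and the number `c`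
in unary. -/
abbrev Entry : Type := ℤ × ℤ × List Unit × ℤ × List Unit

/-- The summand `q u^j (1 - u)^{-c} τ^m`. -/
def entry (q : ℚ) (m : ℕ) (j : ℤ) (c : ℕ) : Entry :=
  (q.num, q.den, .replicate m (), j, .replicate c ())

/-- The power series given by a summand. -/
def entrySeries (u : K) (e : Entry) : K⟦X⟧ :=
  C ((e.1 / e.2.1 : K) * u ^ e.2.2.2.1 / (1 - u) ^ e.2.2.2.2.length) * X ^ e.2.2.1.length

/-- The power series given by a list of summands. -/
def tableSeries (u : K) (es : List Entry) : K⟦X⟧ :=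
  (es.map (entrySeries u)).sum

/-- The expansion of `u e^τ`. -/
def expTable (k : ℕ) : List Entry :=
  (List.range (k + 1)).map fun m => entry (coeff m (exp ℚ)) m 1 0

/-- The expansion of `τ / (1 - e^τ)`. -/
def poleTable (k : ℕ) : List Entry :=
  (List.range (k + 1)).map fun m => entry (coeff m (-bernoulliPowerSeries ℚ)) m 0 0

/-- The expansion of `τ / (1 - u e^τ)` for `u ≠ 1`, by means of the geometric series
`∑ u^j (e^τ - 1)^j (1 - u)^{-(j + 1)}`. -/
def geomTable (k : ℕ) : List Entry :=
  (List.range (k + 1)).flatMap fun m => (List.range (m + 1)).map fun j : ℕ =>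
    entry (coeff m ((exp ℚ - 1) ^ j)) (m + 1) j (j + 1)

theorem entrySeries_entry [CharZero K] (u : K) (q : ℚ) (m : ℕ) (j : ℤ) (c : ℕ) :
    entrySeries u (entry q m j c) = C ((q : K) * u ^ j / (1 - u) ^ c) * X ^ m := by
  simp [entrySeries, entry, Rat.cast_def]

theorem sum_map_range {M : Type*} [AddCommMonoid M] (f : ℕ → M) (k : ℕ) :
    ((List.range k).map f).sum = ∑ m ∈ Finset.range k, f m := rfl

theorem cong_sum_range (k : ℕ) (f : K⟦X⟧) :
    Cong k (∑ m ∈ Finset.range (k + 1), C (coeff m f) * X ^ m) f := by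
  rw [cong_iff]
  intro m hm
  rw [map_sum, Finset.sum_eq_single m]
  · simp
  · intro j _ hj
    simp [coeff_X_pow, hj.symm]
  · intro h
    simp at h
    omega

variable [CharZero K]

theorem coeff_map_rat (f : ℚ⟦X⟧) (m : ℕ) : ((coeff m f : ℚ) : K) =
    coeff m (PowerSeries.map (algebraMap ℚ K) f) := by
  rw [coeff_map]
  rfl

theorem cong_expTable (k : ℕ) (u : K) : Cong k (tableSeries u (expTable k)) (C u * exp K) := by
  have := cong_sum_range k (C u * exp K)
  rw [tableSeries, expTable, List.map_map, sum_map_range]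
  convert this using 3 with m
  rw [Function.comp_apply, entrySeries_entry, coeff_map_rat, map_exp, coeff_C_mul]
  simp [mul_comm]

theorem cong_poleTable (k : ℕ) (u : K) :
    Cong k (tableSeries u (poleTable k)) (-bernoulliPowerSeries K) := by
  have := cong_sum_range k (-bernoulliPowerSeries K)
  rw [tableSeries, poleTable, List.map_map, sum_map_range]
  convert this using 3 with m
  rw [Function.comp_apply, entrySeries_entry]
  simp [bernoulliPowerSeries]

/-- The expansion in powers of `u (e^τ - 1) / (1 - u)`, which has no constant coefficient, so that
the coefficient of `τ ^ m` involves finitely many powers. -/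
theorem coeff_inv_one_sub (u : K) (hu : u ≠ 1) (m : ℕ) : coeff m (1 - C u * exp K)⁻¹ =
    ∑ j ∈ Finset.range (m + 1), coeff m ((exp K - 1) ^ j) * u ^ j / (1 - u) ^ (j + 1) := by
  have hu' : 1 - u ≠ 0 := sub_ne_zero.2 hu.symm
  set y : K⟦X⟧ := C (u / (1 - u)) * (exp K - 1) with hy
  have h1 : 1 - C u * exp K = C (1 - u) * (1 - y) := by
    have : C (1 - u) * C (u / (1 - u)) = C u := by
      rw [← map_mul, mul_div_cancel₀ _ hu']
    rw [hy, mul_sub, ← mul_assoc, this, map_sub, map_one]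
    ring
  have h2 : constantCoeff (1 - C u * exp K) ≠ 0 := by
    simpa using hu'
  have h3 := PowerSeries.mul_inv_cancel _ h2
  have h4 : (1 - C u * exp K)⁻¹ = C (1 - u)⁻¹ * (∑ j ∈ Finset.range (m + 1), y ^ j) +
      y ^ (m + 1) * (1 - C u * exp K)⁻¹ := by
    have h5 : C (1 - u)⁻¹ * (∑ j ∈ Finset.range (m + 1), y ^ j) * (1 - C u * exp K) =
        1 - y ^ (m + 1) := by
      have h6 : C (1 - u)⁻¹ * C (1 - u) = (1 : K⟦X⟧) := by
        rw [← map_mul, inv_mul_cancel₀ hu', map_one]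
      rw [h1, ← geom_sum_mul_neg]
      linear_combination (∑ j ∈ Finset.range (m + 1), y ^ j) * (1 - y) * h6
    linear_combination (C (1 - u)⁻¹ * (∑ j ∈ Finset.range (m + 1), y ^ j)) * h3 -
      (1 - C u * exp K)⁻¹ * h5
  have h7 : X ^ (m + 1) ∣ y ^ (m + 1) * (1 - C u * exp K)⁻¹ := by
    refine dvd_mul_of_dvd_left (pow_dvd_pow_of_dvd ?_ _) _
    rw [X_dvd_iff]
    simp [hy]
  rw [h4, map_add, X_pow_dvd_iff.1 h7 m m.lt_succ_self, add_zero, coeff_C_mul, map_sum,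
    Finset.mul_sum]
  refine Finset.sum_congr rfl fun j _ => ?_
  rw [hy, mul_pow, ← map_pow, coeff_C_mul, div_pow, pow_succ]
  field_simp

theorem cong_geomTable (k : ℕ) (u : K) (hu : u ≠ 1) :
    Cong k (tableSeries u (geomTable k)) (X * (1 - C u * exp K)⁻¹) := by
  have h : tableSeries u (geomTable k) = X * ∑ m ∈ Finset.range (k + 1),
      C (coeff m (1 - C u * exp K)⁻¹) * X ^ m := by
    rw [tableSeries, geomTable, List.map_flatMap, List.flatMap, List.sum_flatten, List.map_map,
      sum_map_range, Finset.mul_sum]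
    refine Finset.sum_congr rfl fun m _ => ?_
    rw [Function.comp_apply, List.map_map, sum_map_range, coeff_inv_one_sub u hu, map_sum,
      Finset.sum_mul, Finset.mul_sum]
    refine Finset.sum_congr rfl fun j _ => ?_
    rw [Function.comp_apply, entrySeries_entry, coeff_map_rat, map_pow, map_sub, map_exp, map_one,
      zpow_natCast]
    ring
  rw [h]
  exact (Cong.refl k X).mul (cong_sum_range k _)

end

/-! ### Vectors and fractions as lists -/

/-- The vector with `n` coordinates that is given by a list. -/
def vec (n : ℕ) (v : List ℤ) : Fin n → ℤ :=
  fun i => v.getD i 0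

section

variable {n : ℕ}

theorem vec_ofFn (v : Fin n → ℤ) : vec n (List.ofFn v) = v := by
  funext i
  simp [vec]

theorem ofFn_vec {v : List ℤ} (h : v.length = n) : List.ofFn (vec n v) = v := by
  subst h
  exact List.ext_getElem (by simp) fun i h₁ h₂ => by simp [vec, h₂]

theorem vec_zipWith_add {u v : List ℤ} (hu : u.length = n) (hv : v.length = n) :
    vec n (List.zipWith (· + ·) u v) = vec n u + vec n v := by
  funext i
  simp [vec, hu, hv]

theorem vec_map_mul (c : ℤ) (v : List ℤ) : vec n (v.map (c * ·)) = c • vec n v := by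
  funext i
  simp only [vec, Pi.smul_apply, smul_eq_mul, List.getD_eq_getElem?_getD, List.getElem?_map]
  cases v[(i : ℕ)]? <;> simp

theorem monomial_zsmul (j : ℤ) (v : Fin n → ℤ) : monomial (j • v) = monomial v ^ j := by
  simp only [monomial, ← Finset.prod_zpow, ← zpow_mul, Pi.smul_apply, smul_eq_mul, mul_comm j]

/-- The rational function given by the numerator and the denominator of a coefficient, the exponent
vector of a numerator, those of a denominator, and data that do not matter. -/
def value {β : Type} (n : ℕ) (t : ℤ × ℤ × List ℤ × List (List ℤ) × β) : RatFun n :=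
  (t.1 / t.2.1 : RatFun n) * monomial (vec n t.2.2.1) /
    (t.2.2.2.1.map fun b => 1 - monomial (vec n b)).prod

/-- The denominator of the coefficient does not vanish, the vectors have `n` coordinates, and those
of the denominator do not vanish. -/
def Valid {β : Type} (n : ℕ) (t : ℤ × ℤ × List ℤ × List (List ℤ) × β) : Prop :=
  t.2.1 ≠ 0 ∧ t.2.2.1.length = n ∧ ∀ b ∈ t.2.2.2.1, b.length = n ∧ vec n b ≠ 0

theorem value_toRaw {s : ℕ} (t : Fraction n s) : value n t.toRaw = t.toRatFun := by
  have : (t.toRaw.2.2.2.1.map fun b => 1 - monomial (vec n b)).prod =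
      ∏ j, (1 - monomial (t.den j)) := by
    rw [Fraction.toRaw, List.map_map, List.map_ofFn, List.prod_ofFn]
    simp [vec_ofFn]
  rw [value, this, Fraction.toRatFun]
  simp [Fraction.toRaw, vec_ofFn, Rat.cast_def]

theorem exists_toRaw_eq {s : ℕ} {t : RawFraction} (h : Valid n t) (hs : t.2.2.2.1.length = s)
    (hpos : 0 < t.2.1) (hco : t.1.natAbs.Coprime t.2.1.natAbs) :
    ∃ t' : Fraction n s, t'.toRaw = t := by
  obtain ⟨N, D, q, ds, u⟩ := t
  obtain ⟨-, hq, hds⟩ := h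
  simp only at hq hds hs hpos hco
  subst hs
  refine ⟨⟨⟨N, D.natAbs, by omega, hco⟩, vec n q, fun j => vec n (ds.get j),
    fun j => (hds _ (List.get_mem _ _)).2⟩, ?_⟩
  have hD : ((D.natAbs : ℕ) : ℤ) = D := by omega
  have h1 : (List.ofFn fun j => vec n (ds.get j)).map List.ofFn = ds := by
    rw [List.map_ofFn]
    refine List.ext_getElem (by simp) fun i h₁ h₂ => ?_
    simpa using ofFn_vec (hds _ (List.getElem_mem h₂)).1
  simp only [Fraction.toRaw, h1, ofFn_vec hq, hD]

end

/-! ### The substitution on lists -/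

/-- A term `α z^q / ∏ (1 - z^b) τ^m` of a power series: the numerator and the denominator of `α`,
the vector `q`, the vectors `b`, and the degree `m` in unary. -/
abbrev Term : Type := ℤ × ℤ × List ℤ × List (List ℤ) × List Unit

/-- The data of the substitution `x_i ↦ z^{l_i} e^{B^i τ}`: the number `B`, the vectors `l_i`, and
the zero vector with as many coordinates as there are variables `z`. -/
abbrev Context : Type := ℤ × List (List ℤ) × List ℤ

/-- The power with exponent in unary. -/
def power (c : ℤ) (m : List Unit) : ℤ :=
  m.foldl (fun y _ => y * c) 1

/-- The number with the digits `a` in base `B`, the scalar product of `a` and `(1, B, B², …)`. -/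
def horner (B : ℤ) (a : List ℤ) : ℤ :=
  a.foldr (fun x y => x + B * y) 0

/-- The linear combination of the vectors `ls` with the coefficients `a`, added to a vector. -/
def combination (v : List ℤ) (ls : List (List ℤ)) (a : List ℤ) : List ℤ :=
  (a.zip ls).foldl (fun u p => List.zipWith (· + ·) u (p.2.map (p.1 * ·))) v

/-- The exponent vector of the image of `x^a`. -/
def Context.image (Γ : Context) (a : List ℤ) : List ℤ :=
  combination Γ.2.2 Γ.2.1 a

/-- The factor of `τ` in the image of `x^a`. -/
def Context.weight (Γ : Context) (a : List ℤ) : ℤ :=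
  horner Γ.1 a

/-- The term `(a / a') s(cτ)`, for a summand `s` of an expansion in which `u` stands for `z^b`. -/
def instantiate (a a' c : ℤ) (b : List ℤ) (e : Entry) : Term :=
  (a * (e.1 * power c e.2.2.1), e.2.1 * a', b.map (e.2.2.2.1 * ·), e.2.2.2.2.map fun _ => b,
    e.2.2.1)

/-- The expansion of `τ / (1 - z^b e^{cτ})`, the image of the factor `1 / (1 - x^a)`
multiplied by `τ`. -/
def factorTerms (k : ℕ) (Γ : Context) (a : List ℤ) : List Term :=
  (if (Γ.image a).all (fun x => decide (x = 0)) then poleTable k else geomTable k).map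
    (instantiate 1 (Γ.weight a) (Γ.weight a) (Γ.image a))

/-- The product of two terms. -/
def mulTerm (t t' : Term) : Term :=
  (t.1 * t'.1, t.2.1 * t'.2.1, List.zipWith (· + ·) t.2.2.1 t'.2.2.1, t.2.2.2.1 ++ t'.2.2.2.1,
    t.2.2.2.2 ++ t'.2.2.2.2)

/-- The product of two sums of terms. -/
def mulTerms (ts ts' : List Term) : List Term :=
  ts.flatMap fun t => ts'.map (mulTerm t)

/-- The product of a sum of terms and the expansions of `m` factors. -/
def prodTerms (k : ℕ) (Γ : Context) : ℕ → List (List ℤ) → List Term → List Term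
  | 0, _, ts => ts
  | m + 1, as, ts => prodTerms k Γ m as.tail (mulTerms ts (factorTerms k Γ (as.headD [])))

/-- The expansion of the image of a fraction multiplied by `τ ^ k`. -/
def fractionTerms (k : ℕ) (Γ : Context) (t : RawFraction) : List Term :=
  prodTerms k Γ k t.2.2.2.1
    ((expTable k).map (instantiate t.1 t.2.1 (Γ.weight t.2.2.1) (Γ.image t.2.2.1)))

/-- The coefficient of `τ ^ k`. -/
def topTerms (k : ℕ) (ts : List Term) : List RawFraction :=
  (ts.filter fun t => decide (t.2.2.2.2.length = k)).map fun t =>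
    (t.1, t.2.1, t.2.2.1, t.2.2.2.1, ())

/-- Multiplication of numerator and denominator by `1 - z^e`, where `e = (1, …, 1)`, unless there
are no variables or there are already `k` factors. -/
def padOnce (k : ℕ) (o : List ℤ) (t : RawFraction) : List RawFraction :=
  if o.isEmpty then [t] else if decide (t.2.2.2.1.length = k) then [t] else
    [(t.1, t.2.1, t.2.2.1, o.map (fun _ => 1) :: t.2.2.2.1, ()),
      (-t.1, t.2.1, List.zipWith (· + ·) t.2.2.1 (o.map fun _ => 1),
        o.map (fun _ => 1) :: t.2.2.2.1, ())]

/-- The repeated multiplication by `(1 - z^e) / (1 - z^e)`. -/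
def pad (k : ℕ) (o : List ℤ) : ℕ → List RawFraction → List RawFraction
  | 0, ts => ts
  | m + 1, ts => pad k o m (ts.flatMap (padOnce k o))

/-- One step of the decomposition of a fraction: the state consists of a fraction `x / y` in lowest
terms and the list of the fractions found so far. -/
def dyadicStep (p : ℕ × ℕ × List (ℕ × ℕ)) (b : Bool) : ℕ × ℕ × List (ℕ × ℕ) :=
  (if p.2.1.bodd then Nat.bit false p.1 else p.1, if p.2.1.bodd then p.2.1 else p.2.1.div2,
    if b then (p.1, p.2.1) :: p.2.2 else p.2.2)

/-- The quotient of two natural numbers as a sum of fractions `2 ^ i / D` in lowest terms, which are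
found without the computation of greatest common divisors. -/
def dyadic (N D : ℕ) : List (ℕ × ℕ) :=
  (N.bits.foldl dyadicStep (1, D, [])).2.2

/-- A fraction as a sum of fractions with coefficients in lowest terms. -/
def split (t : RawFraction) : List RawFraction :=
  (dyadic t.1.natAbs t.2.1.natAbs).map fun p =>
    (ofSign (decide (t.1 < 0) ^^ decide (t.2.1 < 0)) p.1, ofSign false p.2, t.2.2.1, t.2.2.2.1, ())

/-- A number greater than the absolute values of all numbers in the denominators. -/
def base (f : List RawFraction) : ℤ :=
  (f.flatMap fun t => t.2.2.2.1.flatMap id).foldr (fun x y => ofSign false x.natAbs + y) 1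

/-- The data of the substitution for an instance. -/
def RawInstance.context (I : RawInstance) : Context :=
  (base I.2.2.1, I.2.2.2.1, I.2.1.map fun _ => 0)

/-- The result of the substitution. -/
def substitute (k : ℕ) (I : RawInstance) : List RawFraction :=
  (pad k I.context.2.2 k
    (I.2.2.1.flatMap fun t => topTerms k (fractionTerms k I.context t))).flatMap split

/-! ### Correctness of the expansions -/

section

variable {n k : ℕ}

theorem power_eq (c : ℤ) (m : List Unit) : power c m = c ^ m.length := by
  have key : ∀ (m : List Unit) (y : ℤ), m.foldl (fun y _ => y * c) y = y * c ^ m.length := by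
    intro m
    induction m with
    | nil => simp
    | cons x m ih =>
      intro y
      rw [List.foldl_cons, ih, List.length_cons, pow_succ']
      ring
  rw [power, key, one_mul]

theorem horner_ofFn (B : ℤ) {d : ℕ} (a : Fin d → ℤ) :
    horner B (List.ofFn a) = pairing (fun i => B ^ (i : ℕ)) a := by
  induction d with
  | zero => simp [horner, pairing]
  | succ d ih =>
    have := ih fun i => a i.succ
    rw [horner] at this
    rw [horner, List.ofFn_succ, List.foldr_cons, this, pairing, pairing, Fin.sum_univ_succ,
      Finset.mul_sum]
    simp only [Fin.val_zero, pow_zero, mul_one, Fin.val_succ, pow_succ]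
    congr 1
    exact Finset.sum_congr rfl fun i _ => by ring

/-- In a large base, a vector is determined by the number that has its coordinates as digits. -/
theorem eq_zero_of_horner_eq_zero {B : ℤ} {a : List ℤ} (hB : ∀ x ∈ a, |x| < B)
    (h : horner B a = 0) : ∀ x ∈ a, x = 0 := by
  induction a with
  | nil => simp
  | cons x a ih =>
    rw [horner, List.foldr_cons, ← horner] at h
    have hx := hB x List.mem_cons_self
    have h1 : x = 0 := Int.eq_zero_of_abs_lt_dvd (m := B) ⟨-horner B a, by linarith⟩ hx
    have h2 : B ≠ 0 := by
      have := abs_nonneg x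
      omega
    rw [h1, zero_add] at h
    have h3 := ih (fun y hy => hB y (List.mem_cons_of_mem _ hy))
      ((mul_eq_zero.1 h).resolve_left h2)
    intro y hy
    rcases List.mem_cons.1 hy with rfl | hy
    · exact h1
    · exact h3 y hy

theorem combination_spec (ps : List (ℤ × List ℤ)) (hp : ∀ p ∈ ps, p.2.length = n) (v : List ℤ)
    (hv : v.length = n) :
    (ps.foldl (fun u p => List.zipWith (· + ·) u (p.2.map (p.1 * ·))) v).length = n ∧
    vec n (ps.foldl (fun u p => List.zipWith (· + ·) u (p.2.map (p.1 * ·))) v) =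
      vec n v + (ps.map fun p => p.1 • vec n p.2).sum := by
  induction ps generalizing v with
  | nil => simp [hv]
  | cons p ps ih =>
    have h1 := hp p List.mem_cons_self
    have h2 := ih (fun q hq => hp q (List.mem_cons_of_mem _ hq))
      (List.zipWith (· + ·) v (p.2.map (p.1 * ·))) (by simp [hv, h1])
    rw [List.foldl_cons]
    refine ⟨h2.1, ?_⟩
    rw [h2.2, vec_zipWith_add hv (by simpa using h1), vec_map_mul, List.map_cons, List.sum_cons,
      add_assoc]

/-- The data of the substitution that is given by vectors `l_i` and a number `B`. -/
def contextOf {d : ℕ} (B : ℤ) (l : Fin d → Fin n → ℤ) : Context :=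
  (B, (List.ofFn l).map List.ofFn, (List.replicate n true).map fun _ => 0)

theorem image_spec {d : ℕ} (B : ℤ) (l : Fin d → Fin n → ℤ) (a : Fin d → ℤ) :
    ((contextOf B l).image (List.ofFn a)).length = n ∧
    vec n ((contextOf B l).image (List.ofFn a)) = pullback l a := by
  have h0 : (List.ofFn a).zip ((List.ofFn l).map List.ofFn) =
      List.ofFn fun i => (a i, List.ofFn (l i)) := by
    refine List.ext_getElem (by simp) fun i h₁ h₂ => by simp
  have h1 := combination_spec (n := n) ((List.ofFn a).zip ((List.ofFn l).map List.ofFn))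
    (fun p hp => by
      rw [h0, List.mem_ofFn] at hp
      obtain ⟨i, rfl⟩ := hp
      simp) ((List.replicate n true).map fun _ => 0) (by simp)
  refine ⟨h1.1, h1.2.trans ?_⟩
  rw [h0, List.map_ofFn, List.sum_ofFn]
  have h2 : vec n ((List.replicate n true).map fun _ => (0 : ℤ)) = 0 := by
    funext i
    simp [vec]
  rw [h2, zero_add, pullback]
  exact Finset.sum_congr rfl fun i _ => by simp [vec_ofFn]

open PowerSeries

/-- The power series given by a term. -/
def termSeries (n : ℕ) (t : Term) : (RatFun n)⟦X⟧ :=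
  C (value n t) * X ^ t.2.2.2.2.length

/-- The power series given by a list of terms. -/
def termsSeries (n : ℕ) (ts : List Term) : (RatFun n)⟦X⟧ :=
  (ts.map (termSeries n)).sum

theorem termSeries_instantiate (a a' c : ℤ) (b : List ℤ) (e : Entry) :
    termSeries n (instantiate a a' c b e) =
      C (a / a' : RatFun n) * rescale (c : RatFun n) (entrySeries (monomial (vec n b)) e) := by
  rw [termSeries, entrySeries, map_mul, map_pow, rescale_X, mul_pow, ← map_pow,
    ← mul_assoc, ← mul_assoc]
  rw [rescale_C, ← map_mul, ← map_mul]
  congr 2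
  rw [value, instantiate]
  simp only [vec_map_mul, monomial_zsmul, power_eq, List.map_const', List.map_replicate,
    List.prod_replicate]
  push_cast
  ring

theorem termsSeries_instantiate (a a' c : ℤ) (b : List ℤ) (es : List Entry) :
    termsSeries n (es.map (instantiate a a' c b)) =
      C (a / a' : RatFun n) * rescale (c : RatFun n) (tableSeries (monomial (vec n b)) es) := by
  rw [termsSeries, tableSeries, List.map_map, map_list_sum, List.map_map, ← List.sum_map_mul_left]
  congr 1
  exact List.map_congr_left fun e _ => termSeries_instantiate a a' c b e

/-- The factors `1 - z^b` in the denominator of a term of degree `m` number at most `m`, so those of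
degree `k` have no more factors than a fraction with `k` factors. -/
def Term.Good (n : ℕ) (t : Term) : Prop :=
  Valid n t ∧ t.2.2.2.1.length ≤ t.2.2.2.2.length

theorem good_instantiate {a a' c : ℤ} {b : List ℤ} {e : Entry} (ha : a' ≠ 0) (hb : b.length = n)
    (he : e.2.1 ≠ 0) (hm : e.2.2.2.2.length ≤ e.2.2.1.length)
    (h0 : e.2.2.2.2 ≠ [] → vec n b ≠ 0) : Term.Good n (instantiate a a' c b e) := by
  refine ⟨⟨mul_ne_zero he ha, by simpa [instantiate] using hb, ?_⟩, by simpa [instantiate] using hm⟩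
  intro b' hb'
  obtain ⟨x, hx, rfl⟩ := List.mem_map.1 hb'
  exact ⟨hb, h0 (List.ne_nil_of_mem hx)⟩

theorem all_eq_zero_iff {b : List ℤ} (hb : b.length = n) :
    b.all (fun x => decide (x = 0)) = true ↔ vec n b = 0 := by
  simp only [List.all_eq_true, decide_eq_true_eq]
  constructor
  · intro h
    funext i
    have hi : (i : ℕ) < b.length := hb ▸ i.2
    simpa [vec, hi] using h _ (List.getElem_mem hi)
  · intro h x hx
    obtain ⟨i, hi, rfl⟩ := List.mem_iff_getElem.1 hx
    have := congrFun h ⟨i, hb ▸ hi⟩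
    simpa [vec, hi] using this

theorem good_factorTerms {Γ : Context} {a : List ℤ} (hw : Γ.weight a ≠ 0)
    (hb : (Γ.image a).length = n) : ∀ t ∈ factorTerms k Γ a, Term.Good n t := by
  intro t ht
  obtain ⟨e, he, rfl⟩ := List.mem_map.1 ht
  split at he
  · obtain ⟨m, -, rfl⟩ := List.mem_map.1 he
    exact good_instantiate hw hb (by simp [entry]) (by simp [entry]) (by simp [entry])
  · rename_i h
    rw [all_eq_zero_iff hb] at h
    obtain ⟨m, -, he⟩ := List.mem_flatMap.1 he
    obtain ⟨j, hj, rfl⟩ := List.mem_map.1 he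
    rw [List.mem_range] at hj
    exact good_instantiate hw hb (by simp [entry]) (by simp [entry]; omega) fun _ => h

/-- The expansion of a factor. -/
theorem factorTerms_spec {Γ : Context} {a : List ℤ} (hw : Γ.weight a ≠ 0)
    (hb : (Γ.image a).length = n) : ∃ Q : (RatFun n)⟦X⟧,
      Q * (1 - expMonomial (vec n (Γ.image a)) (Γ.weight a)) = X ∧
      Cong k (termsSeries n (factorTerms k Γ a)) Q := by
  set c := Γ.weight a with hc
  set b := Γ.image a
  set u := monomial (vec n b) with hu
  have hc0 : (c : RatFun n) ≠ 0 := by exact_mod_cast hw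
  have key : ∀ (es : List Entry) (F : (RatFun n)⟦X⟧), Cong k (tableSeries u es) F →
      F * (1 - C u * exp (RatFun n)) = X →
      ∃ Q : (RatFun n)⟦X⟧, Q * (1 - expMonomial (vec n b) c) = X ∧
        Cong k (termsSeries n (es.map (instantiate 1 c c b))) Q := by
    intro es F h1 h2
    refine ⟨C ((1 : ℤ) / c : RatFun n) * rescale (c : RatFun n) F, ?_, ?_⟩
    · have h3 := congrArg (rescale (c : RatFun n)) h2
      rw [map_mul, map_sub, map_one, map_mul, rescale_C, rescale_X] at h3
      rw [expMonomial, mul_assoc, h3, ← mul_assoc, ← map_mul]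
      simp [hc0]
    · rw [termsSeries_instantiate]
      exact (Cong.refl _ _).mul (h1.rescale _)
  rw [factorTerms]
  split
  · rename_i h
    rw [all_eq_zero_iff hb] at h
    refine key _ _ (cong_poleTable k u) ?_
    have := bernoulliPowerSeries_mul_exp_sub_one (RatFun n)
    rw [hu, h, monomial_zero, map_one]
    linear_combination this
  · rename_i h
    rw [all_eq_zero_iff hb] at h
    have h1 := one_sub_monomial_ne_zero h
    refine key _ _ (cong_geomTable k u fun h2 => h1 (by rw [← hu, h2, sub_self])) ?_
    rw [mul_assoc, PowerSeries.inv_mul_cancel _ (by simpa using h1), mul_one]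

theorem good_mulTerm {t t' : Term} (h : t.Good n) (h' : t'.Good n) : (mulTerm t t').Good n := by
  obtain ⟨⟨h1, h2, h3⟩, h4⟩ := h
  obtain ⟨⟨h1', h2', h3'⟩, h4'⟩ := h'
  refine ⟨⟨mul_ne_zero h1 h1', by simp [mulTerm, h2, h2'], ?_⟩, by simp [mulTerm]; omega⟩
  intro b hb
  rcases List.mem_append.1 hb with hb | hb
  · exact h3 b hb
  · exact h3' b hb

theorem termSeries_mulTerm {t t' : Term} (h : t.Good n) (h' : t'.Good n) :
    termSeries n (mulTerm t t') = termSeries n t * termSeries n t' := by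
  have : value n (mulTerm t t') = value n t * value n t' := by
    simp only [value, mulTerm, vec_zipWith_add h.1.2.1 h'.1.2.1, monomial_add, List.map_append,
      List.prod_append]
    push_cast
    ring
  rw [termSeries, this, mulTerm, List.length_append, pow_add, map_mul, termSeries, termSeries]
  ring

theorem good_mulTerms {ts ts' : List Term} (h : ∀ t ∈ ts, t.Good n) (h' : ∀ t ∈ ts', t.Good n) :
    ∀ t ∈ mulTerms ts ts', t.Good n := by
  intro t ht
  obtain ⟨t₁, h₁, ht⟩ := List.mem_flatMap.1 ht
  obtain ⟨t₂, h₂, rfl⟩ := List.mem_map.1 ht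
  exact good_mulTerm (h _ h₁) (h' _ h₂)

theorem termsSeries_mulTerms {ts ts' : List Term} (h : ∀ t ∈ ts, t.Good n)
    (h' : ∀ t ∈ ts', t.Good n) :
    termsSeries n (mulTerms ts ts') = termsSeries n ts * termsSeries n ts' := by
  induction ts with
  | nil => simp [mulTerms, termsSeries]
  | cons t ts ih =>
    have h1 := ih fun t ht => h t (List.mem_cons_of_mem _ ht)
    simp only [mulTerms, termsSeries, List.flatMap_cons, List.map_append, List.sum_append,
      List.map_cons, List.sum_cons] at h1 ⊢
    rw [h1, add_mul, List.map_map, ← List.sum_map_mul_left ts' (termSeries n) (termSeries n t)]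
    congr 2
    exact List.map_congr_left fun t' ht' =>
      termSeries_mulTerm (h t List.mem_cons_self) (h' t' ht')

/-- The product of the expansions of `m` factors. -/
theorem prodTerms_spec {Γ : Context} (m : ℕ) {as : List (List ℤ)} (hm : as.length = m)
    (hw : ∀ a ∈ as, Γ.weight a ≠ 0) (hb : ∀ a ∈ as, (Γ.image a).length = n) {ts : List Term}
    (hts : ∀ t ∈ ts, t.Good n) : (∀ t ∈ prodTerms k Γ m as ts, t.Good n) ∧
      ∃ Q : (RatFun n)⟦X⟧,
        Q * (as.map fun a => 1 - expMonomial (vec n (Γ.image a)) (Γ.weight a)).prod = X ^ m ∧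
        Cong k (termsSeries n (prodTerms k Γ m as ts)) (termsSeries n ts * Q) := by
  induction m generalizing as ts with
  | zero =>
    obtain rfl := List.length_eq_zero_iff.1 hm
    exact ⟨hts, 1, by simp, by rw [mul_one]; exact Cong.refl _ _⟩
  | succ m ih =>
    cases as with
    | nil => simp at hm
    | cons a as =>
      have hwa := hw a List.mem_cons_self
      have hba := hb a List.mem_cons_self
      have hf := good_factorTerms (k := k) hwa hba
      obtain ⟨h1, Q, h2, h3⟩ := ih (as := as) (by simpa using hm)
        (fun b h => hw b (List.mem_cons_of_mem _ h)) (fun b h => hb b (List.mem_cons_of_mem _ h))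
        (good_mulTerms hts hf)
      obtain ⟨R, h4, h5⟩ := factorTerms_spec (k := k) hwa hba
      refine ⟨h1, R * Q, ?_, ?_⟩
      · rw [List.map_cons, List.prod_cons, mul_mul_mul_comm, h4, h2, pow_succ']
      · have h6 : Cong k (termsSeries n (mulTerms ts (factorTerms k Γ a)) * Q)
            (termsSeries n ts * R * Q) := by
          rw [termsSeries_mulTerms hts hf]
          exact ((Cong.refl _ _).mul h5).mul (Cong.refl _ _)
        rw [← mul_assoc, Cong, ← sub_add_sub_cancel]
        exact dvd_add h3 h6

/-- The expansion of a fraction. -/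
theorem fractionTerms_spec {d : ℕ} {B : ℤ} {l : Fin d → Fin n → ℤ} (t : Fraction d k)
    (hB : ∀ j i, |t.den j i| < B) :
    (∀ t' ∈ fractionTerms k (contextOf B l) t.toRaw, t'.Good n) ∧
    ∃ G : (RatFun n)⟦X⟧,
      G * ∏ j, (1 - expMonomial (pullback l (t.den j))
        (pairing (fun i => B ^ (i : ℕ)) (t.den j))) =
        C (t.coeff : RatFun n) * expMonomial (pullback l t.num)
          (pairing (fun i => B ^ (i : ℕ)) t.num) * X ^ k ∧
      coeff k (termsSeries n (fractionTerms k (contextOf B l) t.toRaw)) = coeff k G := by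
  set Γ := contextOf B l with hΓ
  have hw : ∀ a : Fin d → ℤ, Γ.weight (List.ofFn a) = pairing (fun i => B ^ (i : ℕ)) a :=
    fun a => horner_ofFn B a
  have hw0 : ∀ j, Γ.weight (List.ofFn (t.den j)) ≠ 0 := fun j h0 => by
    have h1 := eq_zero_of_horner_eq_zero (B := B) (a := List.ofFn (t.den j)) (fun x hx => by
      rw [List.mem_ofFn] at hx
      obtain ⟨i, rfl⟩ := hx
      exact hB j i) h0
    exact t.den_ne_zero j (funext fun i => h1 _ (List.mem_ofFn.2 ⟨i, rfl⟩))
  have hmem : ∀ a ∈ t.toRaw.2.2.2.1, ∃ j, a = List.ofFn (t.den j) := fun a ha => by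
    obtain ⟨v, hv, rfl⟩ := List.mem_map.1 ha
    obtain ⟨j, rfl⟩ := List.mem_ofFn.1 hv
    exact ⟨j, rfl⟩
  set P := Γ.weight t.toRaw.2.2.1
  set p := Γ.image t.toRaw.2.2.1
  have hp : p.length = n ∧ vec n p = pullback l t.num := image_spec B l t.num
  have hP : P = pairing (fun i => B ^ (i : ℕ)) t.num := hw t.num
  have hts : ∀ t' ∈ (expTable k).map (instantiate t.toRaw.1 t.toRaw.2.1 P p), t'.Good n := by
    intro t' ht'
    obtain ⟨e, he, rfl⟩ := List.mem_map.1 ht'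
    obtain ⟨m, -, rfl⟩ := List.mem_map.1 he
    exact good_instantiate (by simp [Fraction.toRaw]) hp.1 (Int.natCast_ne_zero.2 (Rat.den_nz _))
      (by simp [entry]) (by simp [entry])
  obtain ⟨h1, Q, h2, h3⟩ := prodTerms_spec (k := k) (Γ := Γ) k (as := t.toRaw.2.2.2.1)
    (by simp [Fraction.toRaw]) (fun a ha => by obtain ⟨j, rfl⟩ := hmem a ha; exact hw0 j)
    (fun a ha => by obtain ⟨j, rfl⟩ := hmem a ha; exact (image_spec B l _).1) hts
  refine ⟨h1, C (t.coeff : RatFun n) * expMonomial (pullback l t.num)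
    (pairing (fun i => B ^ (i : ℕ)) t.num) * Q, ?_, ?_⟩
  · rw [mul_assoc, ← h2]
    congr 2
    rw [Fraction.toRaw, List.map_map, List.map_ofFn, List.prod_ofFn]
    refine Finset.prod_congr rfl fun j _ => ?_
    rw [Function.comp_apply, Function.comp_apply, hw, (image_spec B l _).2]
  · refine h3.coeff_eq.trans ?_
    have h4 : Cong k (termsSeries n ((expTable k).map (instantiate t.toRaw.1 t.toRaw.2.1 P p)))
        (C (t.coeff : RatFun n) * expMonomial (pullback l t.num)
          (pairing (fun i => B ^ (i : ℕ)) t.num)) := by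
      rw [termsSeries_instantiate, ← hP, ← hp.2, expMonomial]
      have h5 : (t.toRaw.1 / t.toRaw.2.1 : RatFun n) = t.coeff := by
        simp [Fraction.toRaw, Rat.cast_def]
      have h6 := (cong_expTable k (monomial (vec n p))).rescale (P : RatFun n)
      rw [map_mul, rescale_C] at h6
      rw [h5]
      exact (Cong.refl _ _).mul h6
    exact (h4.mul (Cong.refl _ _)).coeff_eq

/-- The coefficient of `τ ^ k` in the expansion of a fraction. -/
theorem topTerms_spec {ts : List Term} (h : ∀ t ∈ ts, t.Good n) :
    (∀ t ∈ topTerms k ts, Valid n t ∧ t.2.2.2.1.length ≤ k) ∧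
      ((topTerms k ts).map (value n)).sum = coeff k (termsSeries n ts) := by
  constructor
  · intro t ht
    obtain ⟨t', ht', rfl⟩ := List.mem_map.1 ht
    obtain ⟨ht', hk⟩ := List.mem_filter.1 ht'
    rw [decide_eq_true_eq] at hk
    exact ⟨(h _ ht').1, (h _ ht').2.trans hk.le⟩
  · clear h
    induction ts with
    | nil => simp [topTerms, termsSeries]
    | cons t ts ih =>
      rw [termsSeries, List.map_cons, List.sum_cons, map_add, ← termsSeries, ← ih, topTerms,
        List.filter_cons, termSeries, coeff_C_mul, coeff_X_pow]
      by_cases hk : t.2.2.2.2.length = k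
      · rw [if_pos (by simpa using hk), if_pos hk.symm, mul_one, List.map_cons, List.map_cons,
          List.sum_cons]
        rfl
      · rw [if_neg (by simpa using hk), if_neg (fun h => hk h.symm), mul_zero, zero_add, topTerms]

end

/-! ### Normalization of the fractions -/

section

variable {n k : ℕ}

theorem sum_map_flatMap {α β M : Type*} [AddCommMonoid M] (l : List α) (g : α → List β)
    (v : β → M) (w : α → M) (h : ∀ x ∈ l, ((g x).map v).sum = w x) :
    ((l.flatMap g).map v).sum = (l.map w).sum := by
  induction l with
  | nil => rfl
  | cons x l ih =>
    rw [List.flatMap_cons, List.map_append, List.sum_append, List.map_cons, List.sum_cons,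
      h x List.mem_cons_self, ih fun y hy => h y (List.mem_cons_of_mem _ hy)]

theorem padOnce_spec {t : RawFraction} {o : List ℤ} (ho : o.length = n) (h : Valid n t) :
    (∀ t' ∈ padOnce k o t, Valid n t') ∧ ((padOnce k o t).map (value n)).sum = value n t := by
  have he : (o.map fun _ => (1 : ℤ)).length = n := by simpa using ho
  rw [padOnce]
  split
  · simp [h]
  rename_i h0
  split
  · simp [h]
  have hne : vec n (o.map fun _ => (1 : ℤ)) ≠ 0 := fun h1 => by
    rw [List.isEmpty_iff_length_eq_zero, ho] at h0
    have := congrFun h1 ⟨0, Nat.pos_of_ne_zero h0⟩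
    have h2 : 0 < o.length := by omega
    simp [vec, h2] at this
  obtain ⟨h1, h2, h3⟩ := h
  constructor
  · have h4 : ∀ b ∈ o.map (fun _ => (1 : ℤ)) :: t.2.2.2.1, b.length = n ∧ vec n b ≠ 0 := by
      intro b hb
      rcases List.mem_cons.1 hb with rfl | hb
      · exact ⟨he, hne⟩
      · exact h3 b hb
    intro t' ht'
    simp only [List.mem_cons, List.not_mem_nil, or_false] at ht'
    rcases ht' with rfl | rfl
    · exact ⟨h1, h2, h4⟩
    · exact ⟨h1, by simp [h2, ho], h4⟩
  · have h4 := one_sub_monomial_ne_zero hne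
    simp only [List.map_cons, List.map_nil, List.sum_cons, List.sum_nil, add_zero, value,
      vec_zipWith_add h2 he, monomial_add, List.prod_cons]
    rw [← add_div, mul_comm (1 - _),
      ← mul_div_mul_right ((t.1 / t.2.1 : RatFun n) * monomial (vec n t.2.2.1)) _ h4]
    congr 1
    push_cast
    ring

/-- The number of factors in the denominators of the result; without variables there is no factor
`1 - z^b` with `b ≠ 0`. -/
def factors (k n : ℕ) : ℕ := if n = 0 then 0 else k

theorem padOnce_length {s : ℕ} {t t' : RawFraction} {o : List ℤ} (ho : o.length = n)
    (h : t.2.2.2.1.length ≤ factors k n ∧ factors k n ≤ t.2.2.2.1.length + (s + 1))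
    (ht' : t' ∈ padOnce k o t) :
    t'.2.2.2.1.length ≤ factors k n ∧ factors k n ≤ t'.2.2.2.1.length + s := by
  rw [padOnce] at ht'
  rw [factors] at h ⊢
  split at ht'
  · rename_i h0
    rw [List.isEmpty_iff_length_eq_zero, ho] at h0
    rw [if_pos h0] at h ⊢
    rw [List.mem_singleton] at ht'
    subst ht'
    exact ⟨h.1, Nat.zero_le _⟩
  rename_i h0
  rw [List.isEmpty_iff_length_eq_zero, ho] at h0
  rw [if_neg h0] at h ⊢
  split at ht'
  · rename_i h1
    rw [decide_eq_true_eq] at h1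
    rw [List.mem_singleton] at ht'
    subst ht'
    omega
  · rename_i h1
    rw [decide_eq_true_eq] at h1
    simp only [List.mem_cons, List.not_mem_nil, or_false] at ht'
    rcases ht' with rfl | rfl <;> simp only [List.length_cons] <;> omega

theorem pad_spec {o : List ℤ} (ho : o.length = n) (m : ℕ) {ts : List RawFraction}
    (h : ∀ t ∈ ts, Valid n t) (hm : ∀ t ∈ ts, t.2.2.2.1.length ≤ factors k n ∧
      factors k n ≤ t.2.2.2.1.length + m) :
    (∀ t ∈ pad k o m ts, Valid n t ∧ t.2.2.2.1.length = factors k n) ∧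
      ((pad k o m ts).map (value n)).sum = (ts.map (value n)).sum := by
  induction m generalizing ts with
  | zero => exact ⟨fun t ht => ⟨h t ht, (hm t ht).1.antisymm (hm t ht).2⟩, rfl⟩
  | succ m ih =>
    obtain ⟨h1, h2⟩ := ih (ts := ts.flatMap (padOnce k o))
      (fun t ht => by
        obtain ⟨t', ht', ht⟩ := List.mem_flatMap.1 ht
        exact (padOnce_spec ho (h t' ht')).1 t ht)
      (fun t ht => by
        obtain ⟨t', ht', ht⟩ := List.mem_flatMap.1 ht
        exact padOnce_length ho (hm t' ht') ht)
    refine ⟨h1, h2.trans ?_⟩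
    exact sum_map_flatMap _ _ _ _ fun t ht => (padOnce_spec ho (h t ht)).2

theorem length_le_factors {t : RawFraction} (h : Valid n t) (hk : t.2.2.2.1.length ≤ k) :
    t.2.2.2.1.length ≤ factors k n := by
  rw [factors]
  split
  · rename_i h0
    subst h0
    rw [List.eq_nil_iff_forall_not_mem.2 fun b hb => (h.2.2 b hb).2 (funext fun i => i.elim0)]
    rfl
  · exact hk

/-- The fraction `x / y` in the state is doubled in each step; it stays in lowest terms because an
even `y` is halved and an odd one is coprime to `2 x`. -/
theorem dyadic_foldl (bits : List Bool) (x y : ℕ) (out : List (ℕ × ℕ)) (hy : 0 < y)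
    (hxy : x.Coprime y) (hout : ∀ p ∈ out, 0 < p.2 ∧ p.1.Coprime p.2) :
    (∀ p ∈ (bits.foldl dyadicStep (x, y, out)).2.2, 0 < p.2 ∧ p.1.Coprime p.2) ∧
      ((bits.foldl dyadicStep (x, y, out)).2.2.map fun p => (p.1 / p.2 : ℚ)).sum =
        (out.map fun p => (p.1 / p.2 : ℚ)).sum + x / y * ofDigits bits := by
  induction bits generalizing x y out with
  | nil => simpa [ofDigits] using hout
  | cons b bits ih =>
    have hout' : ∀ p ∈ (if b then (x, y) :: out else out), 0 < p.2 ∧ p.1.Coprime p.2 := by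
      split
      · intro p hp
        rcases List.mem_cons.1 hp with rfl | hp
        · exact ⟨hy, hxy⟩
        · exact hout p hp
      · exact hout
    have hsum : ((if b then (x, y) :: out else out).map fun p => (p.1 / p.2 : ℚ)).sum =
        (out.map fun p => (p.1 / p.2 : ℚ)).sum + x / y * b.toNat := by
      cases b <;> simp [add_comm]
    have hy0 : (y : ℚ) ≠ 0 := by exact_mod_cast hy.ne'
    rw [List.foldl_cons, dyadicStep]
    simp only
    rcases hb : y.bodd with _ | _
    · have h2 : y = 2 * y.div2 := by
        have := Nat.bodd_add_div2 y
        rw [hb] at this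
        simpa using this.symm
      have h3 : (y : ℚ) = 2 * y.div2 := by exact_mod_cast h2
      have h4 := ih x y.div2 _ (by omega) (hxy.coprime_dvd_right ⟨2, by omega⟩) hout'
      simp only [Bool.false_eq_true, if_false]
      refine ⟨h4.1, ?_⟩
      rw [h4.2, hsum, ofDigits_cons, h3]
      rw [h3] at hy0
      push_cast
      field_simp
      ring
    · have h2 : Nat.Coprime 2 y := by
        rw [Nat.coprime_two_left, ← Nat.not_even_iff_odd, Nat.even_iff, Nat.mod_two_of_bodd, hb]
        simp
      have h4 := ih (Nat.bit false x) y _ hy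
        (by rw [Nat.bit_false]; exact h2.mul_left hxy) hout'
      simp only [if_true]
      refine ⟨h4.1, ?_⟩
      rw [h4.2, hsum, ofDigits_cons, Nat.bit_false]
      push_cast
      ring

theorem dyadic_spec (N : ℕ) {D : ℕ} (hD : 0 < D) :
    (∀ p ∈ dyadic N D, 0 < p.2 ∧ p.1.Coprime p.2) ∧
      ((dyadic N D).map fun p => (p.1 / p.2 : ℚ)).sum = N / D := by
  have := dyadic_foldl N.bits 1 D [] hD (Nat.coprime_one_left D) (by simp)
  rw [ofDigits_bits] at this
  simpa [dyadic, div_eq_inv_mul] using this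

theorem split_spec {t : RawFraction} (h : Valid n t) :
    (∀ t' ∈ split t, Valid n t' ∧ t'.2.2.2.1.length = t.2.2.2.1.length ∧ 0 < t'.2.1 ∧
      t'.1.natAbs.Coprime t'.2.1.natAbs) ∧ ((split t).map (value n)).sum = value n t := by
  obtain ⟨h1, h2⟩ := dyadic_spec t.1.natAbs (Int.natAbs_pos.2 h.1)
  constructor
  · intro t' ht'
    obtain ⟨p, hp, rfl⟩ := List.mem_map.1 ht'
    obtain ⟨h3, h4⟩ := h1 p hp
    have h5 : ofSign false p.2 = p.2 := rfl
    refine ⟨⟨?_, h.2⟩, rfl, ?_, ?_⟩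
    · simp only [h5]
      omega
    · simp only [h5]
      omega
    · simp only [ofSign]
      split <;> simpa using h4
  · have h3 : ∀ b m, ((ofSign b m : ℤ) : RatFun n) = ofSign b 1 * (m : RatFun n) := by
      intro b m
      cases b <;> simp [ofSign]
    have h4 : ((t.1 / t.2.1 : ℚ) : RatFun n) =
        (ofSign (decide (t.1 < 0) ^^ decide (t.2.1 < 0)) 1 *
          (t.1.natAbs / t.2.1.natAbs : ℚ) : ℚ) := by
      congr 1
      conv_lhs => rw [← ofSign_natAbs t.1, ← ofSign_natAbs t.2.1]
      unfold ofSign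
      cases decide (t.1 < 0) <;> cases decide (t.2.1 < 0) <;> simp [-Nat.cast_natAbs] <;> ring
    have h5 : ∀ t' : RawFraction, value n t' = ((t'.1 / t'.2.1 : ℚ) : RatFun n) *
        (monomial (vec n t'.2.2.1) / (t'.2.2.2.1.map fun b => 1 - monomial (vec n b)).prod) := by
      intro t'
      rw [value, mul_div_assoc]
      push_cast
      rfl
    have h6 := map_list_sum (Rat.castHom (RatFun n))
      ((dyadic t.1.natAbs t.2.1.natAbs).map fun p => (p.1 / p.2 : ℚ))
    rw [Rat.coe_castHom, List.map_map] at h6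
    rw [h5, h4, ← h2, Rat.cast_mul, h6, ← List.sum_map_mul_left, ← List.sum_map_mul_right, split,
      List.map_map]
    congr 1
    refine List.map_congr_left fun p _ => ?_
    rw [Function.comp_apply, h5, Function.comp_apply, ← Rat.cast_mul]
    congr 2
    cases decide (t.1 < 0) ^^ decide (t.2.1 < 0) <;> simp [ofSign, neg_div]

end

/-! ### Correctness of the substitution -/

theorem lt_base {f : List RawFraction} {t : RawFraction} (ht : t ∈ f) {b : List ℤ}
    (hb : b ∈ t.2.2.2.1) {x : ℤ} (hx : x ∈ b) : |x| < base f := by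
  have key : ∀ l : List ℤ, 0 < l.foldr (fun x y => ofSign false x.natAbs + y) 1 ∧
      ∀ x ∈ l, |x| < l.foldr (fun x y => ofSign false x.natAbs + y) 1 := by
    intro l
    induction l with
    | nil => simp
    | cons y l ih =>
      have h1 : ofSign false y.natAbs = |y| := (Int.abs_eq_natAbs y).symm
      have h2 := abs_nonneg y
      rw [List.foldr_cons, h1]
      refine ⟨by linarith [ih.1], fun x hx => ?_⟩
      rcases List.mem_cons.1 hx with rfl | hx
      · linarith [ih.1]
      · linarith [ih.2 x hx]
  exact (key _).2 x (List.mem_flatMap.2 ⟨t, ht, List.mem_flatMap.2 ⟨b, hb, hx⟩⟩)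

/-- The result of the substitution is a formula in lowest terms, and its value is that of the given
formula. -/
theorem substitute_spec {k : ℕ} (I : Instance k) :
    (∀ t ∈ substitute k I.toRaw, Valid I.n t ∧ t.2.2.2.1.length = factors k I.n ∧ 0 < t.2.1 ∧
      t.1.natAbs.Coprime t.2.1.natAbs) ∧
    ∀ z, DefinedAt I.l z → ∀ y, HasValueAt I.f.toRatFun (monomialMap I.l z) y →
      HasValueAt ((substitute k I.toRaw).map (value I.n)).sum z y := by
  obtain ⟨d, n, f, l⟩ := I
  set B := base (f.map Fraction.toRaw)
  set Γ := contextOf B l with hΓ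
  have hB : ∀ t ∈ f, ∀ j i, |t.den j i| < B := fun t ht j i =>
    lt_base (List.mem_map_of_mem ht)
      (List.mem_map_of_mem (f := List.ofFn) (List.mem_ofFn.2 ⟨j, rfl⟩)) (List.mem_ofFn.2 ⟨i, rfl⟩)
  have h1 : ∀ t ∈ f.map Fraction.toRaw, ∀ t' ∈ fractionTerms k Γ t, t'.Good n := by
    intro t ht
    obtain ⟨t₀, ht₀, rfl⟩ := List.mem_map.1 ht
    exact (fractionTerms_spec t₀ (hB t₀ ht₀)).1
  set ts := (f.map Fraction.toRaw).flatMap fun t => topTerms k (fractionTerms k Γ t) with hts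
  have h2 : ∀ t ∈ ts, Valid n t ∧ t.2.2.2.1.length ≤ k := by
    intro t ht
    obtain ⟨t', ht', ht⟩ := List.mem_flatMap.1 ht
    exact (topTerms_spec (h1 t' ht')).1 t ht
  have ho : Γ.2.2.length = n := by simp [hΓ, contextOf]
  obtain ⟨h3, h4⟩ := pad_spec (k := k) ho k (fun t ht => (h2 t ht).1) fun t ht =>
    ⟨length_le_factors (h2 t ht).1 (h2 t ht).2, by rw [factors]; split <;> omega⟩
  have h5 : substitute k (Instance.toRaw ⟨d, n, f, l⟩) = (pad k Γ.2.2 k ts).flatMap split := rfl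
  rw [h5]
  constructor
  · intro t ht
    obtain ⟨t', ht', ht⟩ := List.mem_flatMap.1 ht
    obtain ⟨h6, h7⟩ := h3 t' ht'
    obtain ⟨h8, h9, h10⟩ := (split_spec h6).1 t ht
    exact ⟨h8, h9.trans h7, h10⟩
  · intro z hz y hy
    rw [sum_map_flatMap _ _ _ _ fun t ht => (split_spec (h3 t ht).1).2, h4,
      sum_map_flatMap _ _ _ _ fun t ht => (topTerms_spec (h1 t ht)).2, List.map_map]
    have h6 := fun t ht => (fractionTerms_spec (l := l) t (hB t ht)).2
    choose! G hG using h6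
    have hw : ∀ t ∈ f, ∀ j, pairing (fun i => B ^ (i : ℕ)) (t.den j) ≠ 0 := fun t ht j h0 => by
      rw [← horner_ofFn] at h0
      have h7 := eq_zero_of_horner_eq_zero (fun x hx => by
        rw [List.mem_ofFn] at hx
        obtain ⟨i, rfl⟩ := hx
        exact hB t ht j i) h0
      exact t.den_ne_zero j (funext fun i => h7 _ (List.mem_ofFn.2 ⟨i, rfl⟩))
    have h7 := hasValueAt_sum_coeff hw (fun t ht => (hG t ht).1) hz hy
    rw [← List.map_congr_left fun t ht => (hG t ht).2] at h7
    exact h7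

/-- The result of the substitution as a formula. -/
theorem exists_formula {k : ℕ} (I : Instance k) : ∃ g : Formula I.n (factors k I.n),
    g.map Fraction.toRaw = substitute k I.toRaw := by
  have h := (substitute_spec I).1
  generalize substitute k I.toRaw = ts at h
  induction ts with
  | nil => exact ⟨[], rfl⟩
  | cons t ts ih =>
    obtain ⟨g, hg⟩ := ih fun t' ht' => h t' (List.mem_cons_of_mem _ ht')
    obtain ⟨h1, h2, h3, h4⟩ := h t List.mem_cons_self
    obtain ⟨t', ht'⟩ := exists_toRaw_eq h1 h2 h3 h4
    exact ⟨t' :: g, by rw [List.map_cons, hg, ht']⟩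

/-- Without variables, a formula is the sum of its coefficients. -/
theorem hasValueAt_of_no_variables {n s : ℕ} (hn : n = 0) (hs : s = 0) (g : Formula n s)
    (z : Fin n → ℂ) : HasValueAt g.toRatFun z (((g.map Fraction.coeff).sum : ℚ) : ℂ) := by
  subst hn hs
  have h1 := map_list_sum (Rat.castHom ℂ) (g.map Fraction.coeff)
  rw [Rat.coe_castHom, List.map_map] at h1
  rw [h1]
  refine Val.list_sum (φ := MvPolynomial.eval z) g fun t _ => ?_
  have : t.toRatFun = t.coeff := by simp [Fraction.toRatFun, monomial]
  rw [this]
  exact Val.ratCast (φ := MvPolynomial.eval z) t.coeff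

/-! ### The running time of the substitution -/

/-- The size of a vector; it is subadditive. -/
def vecSize (v : List ℤ) : ℕ :=
  (v.map fun x => x.natAbs.size + 1).sum

theorem vecSize_cons (x : ℤ) (v : List ℤ) : vecSize (x :: v) = x.natAbs.size + 1 + vecSize v := rfl

theorem vecSize_le_esize (v : List ℤ) : vecSize v ≤ esize v := by
  induction v with
  | nil => exact Nat.zero_le _
  | cons x v ih =>
    rw [esize_cons, vecSize_cons]
    have := size_natAbs_le_esize x
    omega

theorem esize_le_vecSize (v : List ℤ) : esize v ≤ 6 * vecSize v + 1 := by
  induction v with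
  | nil => rw [esize_nil]; omega
  | cons x v ih =>
    rw [esize_cons, vecSize_cons]
    have := esize_int_le x
    omega

theorem natAbs_add_size_le (x y : ℤ) :
    (x + y).natAbs.size ≤ x.natAbs.size + y.natAbs.size + 1 :=
  (Nat.size_le_size (Int.natAbs_add_le x y)).trans (nat_size_add_le _ _)

theorem vecSize_zipWith_add_le (u v : List ℤ) :
    vecSize (List.zipWith (· + ·) u v) ≤ vecSize u + vecSize v := by
  induction u generalizing v with
  | nil => exact Nat.zero_le _
  | cons x u ih =>
    cases v with
    | nil => exact Nat.zero_le _
    | cons y v =>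
      rw [List.zipWith_cons_cons, vecSize_cons, vecSize_cons, vecSize_cons]
      have := ih v
      have := natAbs_add_size_le x y
      omega

/-- The growth of the state in the decomposition of a fraction. -/
theorem size_dyadic_foldl {L S : ℕ} (bits : List Bool) (x y : ℕ) (out : List (ℕ × ℕ))
    (hx : x.size + bits.length ≤ L + 1) (hy : y.size ≤ S) :
    (bits.foldl dyadicStep (x, y, out)).1.size ≤ L + 1 ∧
      (bits.foldl dyadicStep (x, y, out)).2.1.size ≤ S ∧
      esize (bits.foldl dyadicStep (x, y, out)).2.2 ≤
        esize out + bits.length * (4 * L + 4 * S + 8) := by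
  induction bits generalizing x y out with
  | nil => exact ⟨by simpa using hx, hy, by simp⟩
  | cons b bits ih =>
    rw [List.length_cons] at hx ⊢
    have h1 : (if y.bodd then Nat.bit false x else x).size ≤ x.size + 1 := by
      split
      · exact nat_size_bit_le _ _
      · omega
    have h2 : (if y.bodd then y else y.div2).size ≤ S := by
      split
      · exact hy
      · exact (Nat.size_le_size (by rw [Nat.div2_val]; omega)).trans hy
    have h3 : esize (if b then (x, y) :: out else out) ≤ esize out + (4 * L + 4 * S + 8) := by
      split
      · rw [esize_cons, esize_pair]
        have := esize_nat_le x
        have := esize_nat_le y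
        omega
      · omega
    obtain ⟨h4, h5, h6⟩ := ih (if y.bodd then Nat.bit false x else x)
      (if y.bodd then y else y.div2) (if b then (x, y) :: out else out) (by omega) h2
    refine ⟨h4, h5, h6.trans ?_⟩
    rw [add_mul, one_mul]
    omega

namespace PolyFun

variable {α : Type} [Enc α]

theorem power {c : α → ℤ} {m : α → List Unit} (hc : PolyFun c) (hm : PolyFun m) :
    PolyFun fun x => power (c x) (m x) := by
  obtain ⟨q, hq⟩ := hc.esize_le
  refine foldl (step := fun x y _ => y * c x) hm (const 1) (mul (fst' snd) (hc.comp fst))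
    (fun y => y.natAbs.size) size_natAbs_le_esize (4 * .X + 5)
    (fun y => by simpa using esize_int_le y) ⟨q, fun x y b => ?_⟩
  have h1 := nat_size_mul_le y.natAbs (c x).natAbs
  have h2 := (size_natAbs_le_esize (c x)).trans ((hq x).trans
    (eval_mono q (Nat.le_add_right (esize x) (esize b))))
  rw [← Int.natAbs_mul] at h1
  omega

theorem horner {B : α → ℤ} {a : α → List ℤ} (hB : PolyFun B) (ha : PolyFun a) :
    PolyFun fun x => horner (B x) (a x) := by
  obtain ⟨q, hq⟩ := hB.esize_le
  refine foldr (step := fun x b y => b + B x * y) ha (const 0)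
    (add (fst' snd) (mul (hB.comp fst) (snd' snd)))
    (fun y => y.natAbs.size) size_natAbs_le_esize (4 * .X + 5)
    (fun y => by simpa using esize_int_le y) ⟨q + .X + 1, fun x b y => ?_⟩
  have h1 := nat_size_mul_le (B x).natAbs y.natAbs
  have h2 := (size_natAbs_le_esize (B x)).trans ((hq x).trans
    (eval_mono q (Nat.le_add_right (esize x) (esize b))))
  have h3 := natAbs_add_size_le b (B x * y)
  have h4 := size_natAbs_le_esize b
  rw [← Int.natAbs_mul] at h1
  simp only [Polynomial.eval_add, Polynomial.eval_X, Polynomial.eval_one]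
  omega

theorem vecAdd {u v : α → List ℤ} (hu : PolyFun u) (hv : PolyFun v) :
    PolyFun fun x => List.zipWith (· + ·) (u x) (v x) :=
  zipWith hu hv (add fst snd)

theorem vecSmul {c : α → ℤ} {v : α → List ℤ} (hc : PolyFun c) (hv : PolyFun v) :
    PolyFun fun x => (v x).map (c x * ·) :=
  map (g := fun x y => c x * y) hv (mul (hc.comp fst) snd)

theorem combination {v : α → List ℤ} {ls : α → List (List ℤ)} {a : α → List ℤ} (hv : PolyFun v)
    (hls : PolyFun ls) (ha : PolyFun a) : PolyFun fun x => combination (v x) (ls x) (a x) := by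
  have h1 : PolyFun fun p : ℤ × List ℤ => p.2.map (p.1 * ·) := vecSmul fst snd
  obtain ⟨q, hq⟩ := h1.esize_le
  refine foldl (step := fun _ u p => List.zipWith (· + ·) u (p.2.map (p.1 * ·))) (zip ha hls) hv
    (vecAdd (fst' snd) (h1.comp (snd' snd))) vecSize vecSize_le_esize (6 * .X + 1)
    (fun y => by simpa using esize_le_vecSize y) ⟨q, fun x u p => ?_⟩
  refine (vecSize_zipWith_add_le _ _).trans (Nat.add_le_add_left ?_ _)
  exact (vecSize_le_esize _).trans ((hq p).trans (eval_mono q (Nat.le_add_left _ _)))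

theorem image {Γ : α → Context} {a : α → List ℤ} (hΓ : PolyFun Γ) (ha : PolyFun a) :
    PolyFun fun x => (Γ x).image (a x) :=
  combination (snd' (snd' hΓ)) (fst' (snd' hΓ)) ha

theorem weight {Γ : α → Context} {a : α → List ℤ} (hΓ : PolyFun Γ) (ha : PolyFun a) :
    PolyFun fun x => (Γ x).weight (a x) :=
  horner (fst' hΓ) ha

theorem instantiate {a a' c : α → ℤ} {b : α → List ℤ} {e : α → Entry} (ha : PolyFun a)
    (ha' : PolyFun a') (hc : PolyFun c) (hb : PolyFun b) (he : PolyFun e) :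
    PolyFun fun x => instantiate (a x) (a' x) (c x) (b x) (e x) :=
  pair (mul ha (mul (fst' he) (power hc (fst' (snd' (snd' he))))))
    (pair (mul (fst' (snd' he)) ha') (pair (vecSmul (fst' (snd' (snd' (snd' he)))) hb)
      (pair (map (g := fun x _ => b x) (snd' (snd' (snd' (snd' he)))) (hb.comp fst))
        (fst' (snd' (snd' he))))))

theorem instantiateAll {a a' c : α → ℤ} {b : α → List ℤ} {es : α → List Entry} (ha : PolyFun a)
    (ha' : PolyFun a') (hc : PolyFun c) (hb : PolyFun b) (he : PolyFun es) :
    PolyFun fun x => (es x).map (ShortRational.instantiate (a x) (a' x) (c x) (b x)) :=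
  map (g := fun x e => ShortRational.instantiate (a x) (a' x) (c x) (b x) e) he
    (instantiate (ha.comp fst) (ha'.comp fst) (hc.comp fst) (hb.comp fst) snd)

theorem factorTerms (k : ℕ) {Γ : α → Context} {a : α → List ℤ} (hΓ : PolyFun Γ) (ha : PolyFun a) :
    PolyFun fun x => factorTerms k (Γ x) (a x) :=
  instantiateAll (const 1) (weight hΓ ha) (weight hΓ ha) (image hΓ ha)
    (cond (all (c := fun _ (y : ℤ) => decide (y = 0)) (image hΓ ha) (isZero snd))
      (const _) (const _))

theorem mulTerm {t t' : α → Term} (h : PolyFun t) (h' : PolyFun t') :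
    PolyFun fun x => mulTerm (t x) (t' x) :=
  pair (mul (fst' h) (fst' h')) (pair (mul (fst' (snd' h)) (fst' (snd' h')))
    (pair (vecAdd (fst' (snd' (snd' h))) (fst' (snd' (snd' h'))))
      (pair (append (fst' (snd' (snd' (snd' h)))) (fst' (snd' (snd' (snd' h')))))
        (append (snd' (snd' (snd' (snd' h)))) (snd' (snd' (snd' (snd' h'))))))))

theorem mulTerms {ts ts' : α → List Term} (h : PolyFun ts) (h' : PolyFun ts') :
    PolyFun fun x => mulTerms (ts x) (ts' x) :=
  flatMap (g := fun x t => (ts' x).map (ShortRational.mulTerm t)) h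
    (map (g := fun (p : α × Term) t' => ShortRational.mulTerm p.2 t') (h'.comp fst)
      (mulTerm (snd' fst) snd))

theorem prodTerms (k m : ℕ) {Γ : α → Context} {as : α → List (List ℤ)} {ts : α → List Term}
    (hΓ : PolyFun Γ) (ha : PolyFun as) (ht : PolyFun ts) :
    PolyFun fun x => prodTerms k (Γ x) m (as x) (ts x) := by
  induction m generalizing as ts with
  | zero => exact ht
  | succ m ih => exact ih (tail ha) (mulTerms ht (factorTerms k hΓ (headD ha (const []))))

theorem fractionTerms (k : ℕ) {Γ : α → Context} {t : α → RawFraction} (hΓ : PolyFun Γ)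
    (ht : PolyFun t) : PolyFun fun x => fractionTerms k (Γ x) (t x) :=
  prodTerms k k hΓ (fst' (snd' (snd' (snd' ht)))) (instantiateAll (fst' ht) (fst' (snd' ht))
    (weight hΓ (fst' (snd' (snd' ht)))) (image hΓ (fst' (snd' (snd' ht)))) (const _))

theorem topTerms (k : ℕ) {ts : α → List Term} (h : PolyFun ts) :
    PolyFun fun x => topTerms k (ts x) :=
  map (g := fun _ (t : Term) => ((t.1, t.2.1, t.2.2.1, t.2.2.2.1, ()) : RawFraction))
    (filter (c := fun _ (t : Term) => decide (t.2.2.2.2.length = k)) h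
      (lengthEq (snd' (snd' (snd' (snd' snd)))) k))
    (pair (fst' snd) (pair (fst' (snd' snd)) (pair (fst' (snd' (snd' snd)))
      (pair (fst' (snd' (snd' (snd' snd)))) (const ())))))

theorem padOnce (k : ℕ) {o : α → List ℤ} {t : α → RawFraction} (ho : PolyFun o) (ht : PolyFun t) :
    PolyFun fun x => padOnce k (o x) (t x) := by
  have h1 : PolyFun fun x => (o x).map fun _ => (1 : ℤ) :=
    map (g := fun _ (_ : ℤ) => (1 : ℤ)) ho (const 1)
  have h2 := fst' (snd' (snd' (snd' ht)))
  exact cond (isEmpty ho) (cons ht (const [])) (cond (lengthEq h2 k) (cons ht (const []))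
    (cons (pair (fst' ht) (pair (fst' (snd' ht)) (pair (fst' (snd' (snd' ht)))
      (pair (cons h1 h2) (const ())))))
    (cons (pair (neg (fst' ht)) (pair (fst' (snd' ht)) (pair (vecAdd (fst' (snd' (snd' ht))) h1)
      (pair (cons h1 h2) (const ()))))) (const []))))

theorem pad (k m : ℕ) {o : α → List ℤ} {ts : α → List RawFraction} (ho : PolyFun o)
    (ht : PolyFun ts) : PolyFun fun x => pad k (o x) m (ts x) := by
  induction m generalizing ts with
  | zero => exact ht
  | succ m ih =>
    exact ih (flatMap (g := fun x t => ShortRational.padOnce k (o x) t) ht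
      (padOnce k (ho.comp fst) snd))

theorem dyadic {N D : α → ℕ} (hN : PolyFun N) (hD : PolyFun D) :
    PolyFun fun x => dyadic (N x) (D x) := by
  obtain ⟨q, hq⟩ := hN.esize_le
  obtain ⟨r, hr⟩ := hD.esize_le
  have h1 : PolyFun fun p : α × (ℕ × ℕ × List (ℕ × ℕ)) × Bool => p.2.1.1 := fst' (fst' snd)
  have h2 : PolyFun fun p : α × (ℕ × ℕ × List (ℕ × ℕ)) × Bool => p.2.1.2.1 :=
    fst' (snd' (fst' snd))
  have h3 : PolyFun fun p : α × (ℕ × ℕ × List (ℕ × ℕ)) × Bool => p.2.1.2.2 :=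
    snd' (snd' (fst' snd))
  have hstep : PolyFun fun p : α × (ℕ × ℕ × List (ℕ × ℕ)) × Bool => dyadicStep p.2.1 p.2.2 :=
    pair (cond (natBodd h2) (natBit (const false) h1) h1)
      (pair (cond (natBodd h2) h2 (natDiv2 h2)) (cond (snd' snd) (cons (pair h1 h2) h3) h3))
  refine snd' (snd' (foldl_of_size (l := fun x => (N x).bits)
    (s := fun x => (1, D x, ([] : List (ℕ × ℕ)))) (step := fun _ => dyadicStep) (bits hN)
    (pair (const 1) (pair hD (const []))) hstep
    ⟨(q + 1) * (4 * q + 4 * r + 8) + 1, fun x l' hl' => ?_⟩))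
  set L := q.eval (esize x)
  set S := r.eval (esize x)
  have h4 : l'.length ≤ L :=
    hl'.length_le.trans ((length_le_esize (N x).bits).trans (hq x))
  obtain ⟨h5, h6, h7⟩ := size_dyadic_foldl (L := L) (S := S) l' 1 (D x) []
    (by rw [Nat.size_one]; omega) ((size_le_esize _).trans (hr x))
  generalize l'.foldl dyadicStep (1, D x, []) = p at h5 h6 h7 ⊢
  obtain ⟨u, v, out⟩ := p
  rw [esize_pair, esize_pair]
  have h8 := esize_nat_le u
  have h9 := esize_nat_le v
  have h10 := Nat.mul_le_mul_right (4 * L + 4 * S + 8) h4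
  rw [esize_nil] at h7
  dsimp only at h5 h6 h7
  simp only [Polynomial.eval_add, Polynomial.eval_mul, Polynomial.eval_one, Polynomial.eval_ofNat]
  change _ ≤ (L + 1) * (4 * L + 4 * S + 8) + 1
  rw [add_mul, one_mul]
  omega

theorem split {t : α → RawFraction} (h : PolyFun t) : PolyFun fun x => split (t x) :=
  map (g := fun x (p : ℕ × ℕ) =>
    ((ShortRational.ofSign (decide ((t x).1 < 0) ^^ decide ((t x).2.1 < 0)) p.1,
      ShortRational.ofSign false p.2, (t x).2.2.1, (t x).2.2.2.1, ()) : RawFraction))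
    (dyadic (natAbs (fst' h)) (natAbs (fst' (snd' h))))
    (pair (ofSign (bool₃ (fun a b _ => a ^^ b) (isNeg (fst' (h.comp fst)))
      (isNeg (fst' (snd' (h.comp fst)))) (const true)) (fst' snd))
      (pair (ofSign (const false) (snd' snd)) (pair (fst' (snd' (snd' (h.comp fst))))
        (pair (fst' (snd' (snd' (snd' (h.comp fst))))) (const ())))))

theorem base {f : α → List RawFraction} (hf : PolyFun f) : PolyFun fun x => base (f x) := by
  have h1 : PolyFun fun x => (f x).flatMap fun t => t.2.2.2.1.flatMap _root_.id :=
    flatMap (g := fun _ (t : RawFraction) => t.2.2.2.1.flatMap _root_.id) hf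
      (flatMap (g := fun _ (b : List ℤ) => b) (fst' (snd' (snd' (snd' snd)))) snd)
  refine foldr (step := fun _ (x y : ℤ) => ShortRational.ofSign false x.natAbs + y) h1 (const 1)
    (add (ofSign (const false) (natAbs (fst' snd))) (snd' snd))
    (fun y => y.natAbs.size) size_natAbs_le_esize (4 * .X + 5)
    (fun y => by simpa using esize_int_le y) ⟨.X + 1, fun x b y => ?_⟩
  have h3 := natAbs_add_size_le (ShortRational.ofSign false b.natAbs) y
  have h4 := size_natAbs_le_esize b
  have h5 : (ShortRational.ofSign false b.natAbs).natAbs = b.natAbs := rfl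
  rw [h5] at h3
  simp only [Polynomial.eval_add, Polynomial.eval_X, Polynomial.eval_one]
  omega

theorem substitute (k : ℕ) {I : α → RawInstance} (hI : PolyFun I) :
    PolyFun fun x => substitute k (I x) := by
  have hΓ : PolyFun fun x => (I x).context :=
    pair (base (fst' (snd' (snd' hI)))) (pair (fst' (snd' (snd' (snd' hI))))
      (map (g := fun _ (_ : Bool) => (0 : ℤ)) (fst' (snd' hI)) (const 0)))
  exact flatMap (g := fun _ t => ShortRational.split t) (pad k k (snd' (snd' hΓ))
    (flatMap (g := fun x t =>
        ShortRational.topTerms k (ShortRational.fractionTerms k (I x).context t))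
      (fst' (snd' (snd' hI))) (topTerms k (fractionTerms k (hΓ.comp fst) snd)))) (split snd)

end PolyFun

end ShortRational

theorem theorem2p6 (k : ℕ) :
    ∃ (s : {I : ShortRational.Instance k // I.Admissible} → ℕ)
      (g : ∀ I : {I : ShortRational.Instance k // I.Admissible},
        ShortRational.Formula I.1.n (s I)),
      -- a Turing machine computes the formula `g I` from `I` in polynomial time
      Nonempty (Turing.TM2ComputableInPolyTime
        (fun I : {I : ShortRational.Instance k // I.Admissible} => I.1.encode)
        (fun w : List Computability.Γ' => w)
        (fun I => (g I).encode)) ∧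
      ∀ I : {I : ShortRational.Instance k // I.Admissible},
        s I ≤ k ∧
        -- `g(z) = f(φ(z))` for all `z` for which `φ(z)` is defined and not a pole of `f`
        (∀ z : Fin I.1.n → ℂ, ShortRational.DefinedAt I.1.l z → ∀ y : ℂ,
          ShortRational.HasValueAt I.1.f.toRatFun (ShortRational.monomialMap I.1.l z) y →
          ShortRational.HasValueAt (g I).toRatFun z y) ∧
        -- evaluation at `(1, …, 1)`: no variables are left, and the coefficients sum to the value
        (I.1.n = 0 →
          ShortRational.HasValueAt I.1.f.toRatFun (fun _ => 1)
            ((((g I).map ShortRational.Fraction.coeff).sum : ℚ) : ℂ)) := by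
  choose g hg using fun I : {I : ShortRational.Instance k // I.Admissible} =>
    ShortRational.exists_formula I.1
  have hval : ∀ I, ∀ z, ShortRational.DefinedAt I.1.l z → ∀ y : ℂ,
      ShortRational.HasValueAt I.1.f.toRatFun (ShortRational.monomialMap I.1.l z) y →
      ShortRational.HasValueAt (g I).toRatFun z y := by
    intro I z hz y hy
    have h := (ShortRational.substitute_spec I.1).2 z hz y hy
    rw [← hg I, List.map_map] at h
    rw [ShortRational.Formula.toRatFun, ← List.map_congr_left fun t _ =>
      ShortRational.value_toRaw t]
    exact h
  refine ⟨_, g, ?_, fun I => ⟨?_, hval I, fun hn => ?_⟩⟩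
  · refine ShortRational.PolyFun.computableInPolyTime (fun I => rfl) ?_
    refine (ShortRational.PolyFun.writeFormula (ShortRational.PolyFun.substitute k
      ShortRational.PolyFun.toRaw)).congr fun I => ?_
    rw [← hg I, ShortRational.writeFormula_toRaw]
  · rw [ShortRational.factors]
    split <;> omega
  · obtain ⟨x, ⟨z, hz, rfl⟩, hx⟩ := Set.not_subset.1 I.2
    obtain ⟨y, hy⟩ := not_not.1 hx
    have h1 := hval I z hz y hy
    have h2 := ShortRational.hasValueAt_of_no_variables hn (if_pos hn) (g I) z
    have h3 : y = _ := ShortRational.Val.unique (φ := MvPolynomial.eval z) h1 h2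
    have h4 : ShortRational.monomialMap I.1.l z = fun _ => 1 := by
      funext i
      have : IsEmpty (Fin I.1.n) := by rw [hn]; infer_instance
      simp [ShortRational.monomialMap]
    rw [h3, h4] at hy
    exact hy

end
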